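/- Let $n\ge 2$ and let $f\in W^{1,1}_{\mathrm{loc}}(\mathbb R^n;\mathbb R^n)$ with weak gradient matrix $\nabla f$. Then $$K_{f^*}^{\mathrm{fine}}(x)^{\,n-1}\,|\det\nabla f(x)|\;\le\;\frac{2^n}{\omega_n}\,\|\nabla f(x)\|^n\qquad\text{for a.e. }x\in\mathbb R^n,$$ with the interpretation $\infty\cdot 0=0$ if $\det\nabla f(x)=0$. Here $|\cdot|$ denotes the Euclidean norm of vectors, the absolute value of numbers and the Lebesgue (outer) measure of sets, $B(x,r)$ is the open ball, $\omega_n=|B(0,1)|$, and $\|A\|=\max_{|v|=1}|Av|$ for $A\in\mathbb R^{n\times n}$. The precise representative $f^*=(f_1^*,\dots,f_n^*)\colon\mathbb R^n\to[-\infty,\infty]^n$ is given by $f_j^*(x)=\limsup_{r\to0}\frac1{|B(x,r)|}\int_{B(x,r)}f_j$. For $A\subset\mathbb R^n$ let $\mathrm{cap}_1(A)=\inf\big(\|u\|_{L^1(\mathbb R^n)}+\|\nabla u\|_{L^1(\mathbb R^n)}\big)$ over all $u\in W^{1,1}(\mathbb R^n)$ with $u\ge1$ in a neighborhood of $A$.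 A set $U\subset\mathbb R^n$ is called $1$-finely open if $\lim_{r\to0}\mathrm{cap}_1(B(x,r)\setminus U)/r^{n-1}=0$ for every $x\in U$. For $g\colon\mathbb R^n\to[-\infty,\infty]^n$ put $$K_{g,U}(x,r)=\left(\frac{\operatorname{diam}g(B(x,r)\cap U)^n}{|g(B(x,r))|}\right)^{1/(n-1)},\qquad K_g^{\mathrm{fine}}(x)=\inf_{U}\,\limsup_{r\to0}K_{g,U}(x,r),$$ where the infimum is over all $1$-finely open sets $U\ni x$, and where $K_{g,U}(x,r)=\infty$ if $|g(B(x,r))|=0$ or if $\operatorname{diam}g(B(x,r)\cap U)=\infty$. The diameter of a subset of $[-\infty,\infty]^n$ is taken with respect to the Euclidean distance, extended by $|a-b|=\infty$ when $a\ne b$ are extended reals that are not both finite, and its Lebesgue measure is that of its part in $\mathbb R^n$. -/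

import Mathlib

open MeasureTheory Filter Topology
open scoped ENNReal

namespace FineQC

/-- Euclidean space `ℝⁿ`. -/
abbrev Rn (n : ℕ) : Type := EuclideanSpace ℝ (Fin n)

/-! ### Weak derivatives and Sobolev maps -/

/-- `v ∈ L¹_loc(ℝⁿ)` is the `k`-th weak partial derivative of `u`, tested against `C_c^∞(ℝⁿ)`. -/
def IsWeakPartialDeriv {n : ℕ} (u : Rn n → ℝ) (k : Fin n) (v : Rn n → ℝ) : Prop :=
  LocallyIntegrable v volume ∧
    ∀ φ : Rn n → ℝ, ContDiff ℝ ((⊤ : ℕ∞) : WithTop ℕ∞) φ → HasCompactSupport φ →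
      ∫ x, u x * fderiv ℝ φ x (EuclideanSpace.single k 1) = -∫ x, φ x * v x

/-- `G` is (a representative of) the weak gradient matrix of `f : ℝⁿ → ℝⁿ`:
the entry `G · j k` is the weak partial derivative `∂f_j/∂x_k`, and it lies in `L¹_loc`. -/
def IsWeakGradient {n : ℕ} (f : Rn n → Rn n) (G : Rn n → Matrix (Fin n) (Fin n) ℝ) : Prop :=
  ∀ j k : Fin n, IsWeakPartialDeriv (fun x => f x j) k (fun x => G x j k)

/-- The class `W^{1,1}_loc(ℝⁿ; ℝⁿ)`. -/
def MemW11Loc {n : ℕ} (f : Rn n → Rn n) : Prop :=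
  LocallyIntegrable f volume ∧ ∃ G : Rn n → Matrix (Fin n) (Fin n) ℝ, IsWeakGradient f G

/-- The norm `‖A‖ = max_{|v| = 1} |A v|` of a matrix, that is, its operator norm with respect
to the Euclidean norm. -/
noncomputable def matrixMaxNorm {n : ℕ} (A : Matrix (Fin n) (Fin n) ℝ) : ℝ :=
  ‖Matrix.toEuclideanCLM (𝕜 := ℝ) A‖

/-! ### The Sobolev 1-capacity and the 1-fine topology -/

/-- `u ∈ W^{1,1}(ℝⁿ)` with weak gradient `g`, and `u ≥ 1` a.e. in an open set containing `A`. -/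
def IsCapAdmissible {n : ℕ} (A : Set (Rn n)) (u : Rn n → ℝ) (g : Rn n → Rn n) : Prop :=
  Integrable u volume ∧ Integrable g volume ∧
    (∀ k : Fin n, IsWeakPartialDeriv u k (fun x => g x k)) ∧
    ∃ V : Set (Rn n), IsOpen V ∧ A ⊆ V ∧ ∀ᵐ x ∂(volume : Measure (Rn n)), x ∈ V → 1 ≤ u x

/-- The Sobolev `1`-capacity: the infimum of `‖u‖_{L¹} + ‖∇u‖_{L¹}` over admissible `u`. -/
noncomputable def cap1 {n : ℕ} (A : Set (Rn n)) : ℝ≥0∞ :=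
  ⨅ (u : Rn n → ℝ) (g : Rn n → Rn n) (_ : IsCapAdmissible A u g),
    (∫⁻ x, ‖u x‖ₑ) + ∫⁻ x, ‖g x‖ₑ

/-- `A` is `1`-thin at `x`. -/
def IsThinAt {n : ℕ} (A : Set (Rn n)) (x : Rn n) : Prop :=
  Tendsto (fun r : ℝ => cap1 (A ∩ Metric.ball x r) / ENNReal.ofReal (r ^ (n - 1)))
    (𝓝[>] 0) (𝓝 0)

/-- `U` is `1`-finely open. -/
def IsFinelyOpen {n : ℕ} (U : Set (Rn n)) : Prop :=
  ∀ x ∈ U, IsThinAt Uᶜ x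

/-! ### Precise representative -/

/-- The precise representative `f* : ℝⁿ → [-∞, ∞]ⁿ`, whose components are the upper limits of the
ball averages of the components of `f`. -/
noncomputable def preciseRep {n : ℕ} (f : Rn n → Rn n) (x : Rn n) : Fin n → EReal :=
  fun j => limsup (fun r : ℝ => ((⨍ y in Metric.ball x r, f y j : ℝ) : EReal)) (𝓝[>] 0)

/-! ### Diameter and Lebesgue measure of subsets of `[-∞, ∞]ⁿ` -/

open Classical in
/-- The distance `|a - b| ∈ [0, ∞]` of extended reals; it is `∞` if `a ≠ b` and one of them is
infinite. -/
noncomputable def erealDist (a b : EReal) : ℝ≥0∞ :=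
  if a = b then 0 else (a - b).abs

/-- The Euclidean distance on `[-∞, ∞]ⁿ`. -/
noncomputable def extDist {n : ℕ} (p q : Fin n → EReal) : ℝ≥0∞ :=
  (∑ i, erealDist (p i) (q i) ^ 2) ^ (1 / 2 : ℝ)

/-- The diameter of a subset of `[-∞, ∞]ⁿ`. -/
noncomputable def extDiam {n : ℕ} (S : Set (Fin n → EReal)) : ℝ≥0∞ :=
  ⨆ (p ∈ S) (q ∈ S), extDist p q

/-- The Lebesgue (outer) measure of a subset of `[-∞, ∞]ⁿ`: the measure of its part in `ℝⁿ`. -/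
noncomputable def extVolume {n : ℕ} (S : Set (Fin n → EReal)) : ℝ≥0∞ :=
  volume {y : Rn n | (fun i => ((y i : ℝ) : EReal)) ∈ S}

/-! ### The fine distortion -/

open Classical in
/-- `K_{f,U}(x,r) = (diam f(B(x,r) ∩ U)ⁿ / |f(B(x,r))|)^{1/(n-1)}`, interpreted as `∞` when
`|f(B(x,r))| = 0` or the diameter is infinite (so `0/0 = ∞/∞ = ∞`). -/
noncomputable def distortionOn {n : ℕ} (f : Rn n → Fin n → EReal) (U : Set (Rn n))
    (x : Rn n) (r : ℝ) : ℝ≥0∞ :=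
  if extVolume (f '' Metric.ball x r) = 0 ∨ extDiam (f '' (Metric.ball x r ∩ U)) = ∞ then ∞
  else (extDiam (f '' (Metric.ball x r ∩ U)) ^ n / extVolume (f '' Metric.ball x r)) ^
    (1 / ((n : ℝ) - 1))

/-- `K_f^fine(x)`: the infimum of `limsup_{r → 0} K_{f,U}(x,r)` over `1`-finely open `U ∋ x`. -/
noncomputable def fineDistortion {n : ℕ} (f : Rn n → Fin n → EReal) (x : Rn n) : ℝ≥0∞ :=
  ⨅ (U : Set (Rn n)) (_ : IsFinelyOpen U) (_ : x ∈ U),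
    limsup (fun r : ℝ => distortionOn f U x r) (𝓝[>] 0)

end FineQC

/-!
At almost every point `x` the map `f` has `G x` as derivative in the mean, and two facts about the
precise representative `f*` near such a point give the estimate.

* *Upper bound for the diameter.* For every `ε > 0` there is a `1`-finely open set `U ∋ x` such that
  `|f*(y) - f(x) - G(x)(y - x)| ≤ n ε |y - x|` for `y ∈ U` near `x`
  (`IsGoodPoint.exists_isFinelyOpen`). Hence `diam f*(B(x, r) ∩ U) ≤ 2 r (‖G x‖ + n ε)` for small
  `r`.
* *Lower bound for the measure.* For every `m < |det G x|`, `|f*(B(x, r))| ≥ m |B(x, r)|` for small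
  `r` (`ae_le_extVolume_image_ball`).

The quotient of the two bounds does not depend on `r`, and `ε → 0` and `m → |det G x|` yield the
claim.

For the upper bound, let `u` be plus or minus a component of the Taylor remainder of `f` at `x`. Its
gradient has mean `o(1)` over `B(x, r)`, so by the Poincaré inequality its own mean is `o(r)`. The
boxing inequality `exists_boxing`, applied in each dyadic annulus around `x`, covers the points `y`
near which averages of `u` reach `ε |y - x|` by balls with `∑ s ^ (n - 1) = o(r ^ (n - 1))`. As the
capacity is bounded by such sums (`exists_cap1_le_of_hasBallCover`), the union of these balls is
thin at `x`. It need not be the complement of a finely open set, but `exists_isFinelyOpen` enlarges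
it to one: the points at which the family of balls is not thin, and those in infinitely many of the
enlarged balls, form sets of zero capacity.

The boxing inequality uses the Poincaré inequality for truncations `ψ ∘ u` of `u`, with `ψ' ∘ u`
supported in a thin layer `{t < u ≤ t + δ}`, in the role of the relative isoperimetric inequality
for `{u > t}` (`poincare_comp`). This avoids the theory of sets of finite perimeter and the coarea
formula.

For the lower bound, comparison of Taylor polynomials at two points shows that `f` is close to
linear on pieces of countably many sets that exhaust the space up to a null set. On these sets `f`
agrees with `f*`, and almost every point of each of them is a density point, so that Mathlib's
estimate for approximately linear maps, `mul_le_addHaar_image_of_lt_det`, applies.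
-/

namespace FineQC

/-! ### Ball covers and the capacity -/

/-- The vector of classical partial derivatives of `u`. -/
noncomputable def gradVec {n : ℕ} (u : Rn n → ℝ) (x : Rn n) : Rn n :=
  WithLp.toLp 2 fun k => fderiv ℝ u x (EuclideanSpace.single k 1)

lemma continuous_gradVec {n : ℕ} {u : Rn n → ℝ} (hu : ContDiff ℝ 1 u) :
    Continuous (gradVec u) := by
  refine (PiLp.continuous_toLp 2 _).comp (continuous_pi fun k => ?_)
  exact (hu.continuous_fderiv one_ne_zero).clm_apply continuous_const

lemma hasCompactSupport_gradVec {n : ℕ} {u : Rn n → ℝ} (hu : HasCompactSupport u) :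
    HasCompactSupport (gradVec u) := by
  refine (hu.fderiv ℝ).comp_left (g := fun L : Rn n →L[ℝ] ℝ =>
    (WithLp.toLp 2 fun k => L (EuclideanSpace.single k 1) : Rn n)) ?_
  ext k; simp

/-- The termwise sum of a sequence of test functions whose `W^{1,1}` norms are summable is in
`W^{1,1}`, and its weak gradient is the termwise sum of the gradients. -/
lemma isWeakPartialDeriv_tsum {n : ℕ} {ι : Type} [Countable ι] {b : ι → Rn n → ℝ}
    (hb : ∀ i, ContDiff ℝ 1 (b i)) (hc : ∀ i, HasCompactSupport (b i))
    (h0 : ∑' i, ∫⁻ x, ‖b i x‖ₑ ≠ ∞) (h1 : ∑' i, ∫⁻ x, ‖gradVec (b i) x‖ₑ ≠ ∞) (k : Fin n) :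
    IsWeakPartialDeriv (fun x => ∑' i, b i x) k (fun x => (∑' i, gradVec (b i) x) k) := by
  have hg : ∀ i, Continuous (gradVec (b i)) := fun i => continuous_gradVec (hb i)
  have hm : ∫⁻ x, ∑' i, ‖gradVec (b i) x‖ₑ ≠ ∞ := by
    rwa [lintegral_tsum fun i => (hg i).enorm.measurable.aemeasurable]
  have hint : Integrable (fun x => ∑' i, gradVec (b i) x) := by
    refine ⟨AEStronglyMeasurable.tsum fun i => (hg i).aestronglyMeasurable, ?_⟩
    exact (lintegral_mono fun x => enorm_tsum_le_tsum_enorm).trans_lt hm.lt_top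
  have hsum : ∀ᵐ x : Rn n, Summable fun i => gradVec (b i) x := by
    filter_upwards [ae_lt_top' (AEMeasurable.tsum fun i =>
      (hg i).enorm.measurable.aemeasurable) hm] with x hx
    exact Summable.of_enorm hx.ne
  have hcoord : ∀ᵐ x : Rn n, (∑' i, gradVec (b i) x) k
      = ∑' i, fderiv ℝ (b i) x (EuclideanSpace.single k 1) := by
    filter_upwards [hsum] with x hx
    simpa [gradVec] using (EuclideanSpace.proj (𝕜 := ℝ) k).map_tsum hx
  refine ⟨?_, fun φ hφ hφc => ?_⟩
  · exact ((EuclideanSpace.proj (𝕜 := ℝ) k).integrable_comp hint).locallyIntegrable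
  have hφ1 : ContDiff ℝ 1 φ := hφ.of_le (by exact_mod_cast le_top)
  have hdφ : Continuous fun x => fderiv ℝ φ x (EuclideanSpace.single k 1) :=
    (hφ1.continuous_fderiv one_ne_zero).clm_apply continuous_const
  obtain ⟨M, hM⟩ := (hφc.fderiv_apply ℝ (EuclideanSpace.single k 1)).exists_bound_of_continuous hdφ
  obtain ⟨N, hN⟩ := hφc.exists_bound_of_continuous hφ.continuous
  have hbd : ∀ i, Continuous fun x => fderiv ℝ (b i) x (EuclideanSpace.single k 1) := fun i =>
    ((hb i).continuous_fderiv one_ne_zero).clm_apply continuous_const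
  have e1 : ∫ x, (∑' i, b i x) * fderiv ℝ φ x (EuclideanSpace.single k 1)
      = ∑' i, ∫ x, b i x * fderiv ℝ φ x (EuclideanSpace.single k 1) := by
    rw [← integral_tsum]
    · simp_rw [tsum_mul_right]
    · exact fun i => ((hb i).continuous.mul hdφ).aestronglyMeasurable
    · refine ne_top_of_le_ne_top (ENNReal.mul_ne_top h0 (ENNReal.ofReal_ne_top (r := M))) ?_
      rw [← ENNReal.tsum_mul_right]
      refine ENNReal.tsum_le_tsum fun i => ?_
      rw [← lintegral_mul_const _ (hb i).continuous.enorm.measurable]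
      refine lintegral_mono fun x => ?_
      simp only [enorm_mul]
      gcongr
      rw [← ofReal_norm]
      exact ENNReal.ofReal_le_ofReal (hM x)
  have e2 : ∫ x, φ x * (∑' i, gradVec (b i) x) k
      = ∑' i, ∫ x, φ x * fderiv ℝ (b i) x (EuclideanSpace.single k 1) := by
    rw [← integral_tsum]
    · refine integral_congr_ae ?_
      filter_upwards [hcoord] with x hx
      rw [hx, tsum_mul_left]
    · exact fun i => (hφ.continuous.mul (hbd i)).aestronglyMeasurable
    · refine ne_top_of_le_ne_top (ENNReal.mul_ne_top (ENNReal.ofReal_ne_top (r := N)) h1) ?_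
      rw [← ENNReal.tsum_mul_left]
      refine ENNReal.tsum_le_tsum fun i => ?_
      rw [← lintegral_const_mul _ (hg i).enorm.measurable]
      refine lintegral_mono fun x => ?_
      simp only [enorm_mul]
      gcongr
      · rw [← ofReal_norm]
        exact ENNReal.ofReal_le_ofReal (hN x)
      · have := PiLp.norm_apply_le (gradVec (b i) x) k
        rw [← ofReal_norm, ← ofReal_norm]
        exact ENNReal.ofReal_le_ofReal this
  rw [e1, e2, ← tsum_neg]
  refine tsum_congr fun i => ?_
  have hi := integral_mul_fderiv_eq_neg_fderiv_mul_of_integrable (μ := volume) (f := b i) (g := φ)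
    (v := EuclideanSpace.single k (1 : ℝ))
    (((hbd i).mul hφ.continuous).integrable_of_hasCompactSupport (hφc.mul_left))
    (((hb i).continuous.mul hdφ).integrable_of_hasCompactSupport ((hc i).mul_right))
    (((hb i).continuous.mul hφ.continuous).integrable_of_hasCompactSupport ((hc i).mul_right))
    (fun x _ => ((hb i).differentiable one_ne_zero) x)
    (fun x _ => (hφ1.differentiable one_ne_zero) x)
  rw [hi]
  simp_rw [mul_comm]

/-- `A` is covered by countably many balls of radius at most `1` whose radii `s` satisfy
`∑ s ^ (n - 1) ≤ a`. -/
def HasBallCover {n : ℕ} (A : Set (Rn n)) (a : ℝ≥0∞) : Prop :=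
  ∃ (ι : Type) (_ : Countable ι) (c : ι → Rn n) (s : ι → ℝ),
    (∀ i, 0 < s i ∧ s i ≤ 1) ∧ A ⊆ ⋃ i, Metric.ball (c i) (s i) ∧
      ∑' i, ENNReal.ofReal (s i ^ (n - 1)) ≤ a

lemma HasBallCover.mono {n : ℕ} {A B : Set (Rn n)} {a b : ℝ≥0∞} (h : HasBallCover A a)
    (hB : B ⊆ A) (hab : a ≤ b) : HasBallCover B b := by
  obtain ⟨ι, hι, c, s, hs, hA, ha⟩ := h
  exact ⟨ι, hι, c, s, hs, hB.trans hA, ha.trans hab⟩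

lemma HasBallCover.iUnion {n : ℕ} {κ : Type} [Countable κ] {A : κ → Set (Rn n)} {a : κ → ℝ≥0∞}
    (h : ∀ j, HasBallCover (A j) (a j)) : HasBallCover (⋃ j, A j) (∑' j, a j) := by
  choose ι hι c s hs hA ha using h
  refine ⟨Σ j, ι j, inferInstance, fun p => c p.1 p.2, fun p => s p.1 p.2, fun p => hs _ _, ?_, ?_⟩
  · refine Set.iUnion_subset fun j x hx => ?_
    obtain ⟨i, hi⟩ := Set.mem_iUnion.1 (hA j hx)
    exact Set.mem_iUnion.2 ⟨⟨j, i⟩, hi⟩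
  · rw [ENNReal.tsum_sigma']
    exact ENNReal.tsum_le_tsum ha

lemma HasBallCover.union {n : ℕ} {A B : Set (Rn n)} {a b : ℝ≥0∞} (hA : HasBallCover A a)
    (hB : HasBallCover B b) : HasBallCover (A ∪ B) (a + b) := by
  have := HasBallCover.iUnion (κ := Bool) (A := fun i => bif i then A else B)
    (a := fun i => bif i then a else b) (by rintro (_ | _) <;> simpa)
  refine this.mono ?_ (by simp)
  rintro x (hx | hx)
  · exact Set.mem_iUnion.2 ⟨true, hx⟩
  · exact Set.mem_iUnion.2 ⟨false, hx⟩

/-- A cut-off function for the unit ball. -/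
noncomputable def unitBump (n : ℕ) : ContDiffBump (0 : Rn n) := ⟨1, 2, one_pos, one_lt_two⟩

/-- The cut-off function `unitBump`, transported to the ball of centre `c` and radius `s`. -/
noncomputable def ballBump {n : ℕ} (c : Rn n) (s : ℝ) (x : Rn n) : ℝ :=
  unitBump n (s⁻¹ • (x - c))

lemma contDiff_ballBump {n : ℕ} (c : Rn n) (s : ℝ) : ContDiff ℝ 1 (ballBump c s) :=
  (unitBump n).contDiff.comp ((contDiff_id.sub contDiff_const).const_smul s⁻¹)

lemma hasCompactSupport_ballBump {n : ℕ} (c : Rn n) {s : ℝ} (hs : 0 < s) :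
    HasCompactSupport (ballBump c s) := by
  exact (unitBump n).hasCompactSupport.comp_homeomorph
    ((Homeomorph.subRight c).trans (Homeomorph.smulOfNeZero s⁻¹ (inv_ne_zero hs.ne')))

lemma gradVec_ballBump {n : ℕ} (c : Rn n) (s : ℝ) (x : Rn n) :
    gradVec (ballBump c s) x = s⁻¹ • gradVec (unitBump n) (s⁻¹ • (x - c)) := by
  have : fderiv ℝ (ballBump c s) x = s⁻¹ • fderiv ℝ (unitBump n) (s⁻¹ • (x - c)) := by
    have h1 : ballBump c s = fun x => (fun y => (unitBump n) (s⁻¹ • y)) (x - c) := rfl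
    rw [h1, fderiv_comp_sub (f := fun y => (unitBump n) (s⁻¹ • y)), fderiv_comp_smul]
  ext k
  simp [gradVec, this]

lemma lintegral_comp_inv_smul_sub {n : ℕ} {F : Rn n → ℝ≥0∞} (hF : Measurable F) (c : Rn n)
    {s : ℝ} (hs : 0 < s) :
    ∫⁻ x, F (s⁻¹ • (x - c)) = ENNReal.ofReal (s ^ n) * ∫⁻ x, F x := by
  rw [lintegral_sub_right_eq_self (fun x => F (s⁻¹ • x)) c,
    ← lintegral_map hF (measurable_const_smul s⁻¹),
    Measure.map_addHaar_smul _ (inv_ne_zero hs.ne'), lintegral_smul_measure]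
  simp [abs_of_pos hs]

/-- The capacity of a set is controlled by the sum of `s ^ (n - 1)` over any cover of it by balls
of radii `s ≤ 1`: the sum of cut-off functions of the balls is admissible. -/
lemma exists_cap1_le_of_hasBallCover {n : ℕ} (hn : 2 ≤ n) :
    ∃ C : ℝ≥0∞, C ≠ ∞ ∧ ∀ (A : Set (Rn n)) (a : ℝ≥0∞), HasBallCover A a → cap1 A ≤ C * a := by
  have hub : ContDiff ℝ 1 (unitBump n) := (unitBump n).contDiff
  set K0 := ∫⁻ x, ‖unitBump n x‖ₑ with hK0
  set K1 := ∫⁻ x, ‖gradVec (unitBump n) x‖ₑ with hK1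
  have fK0 : K0 ≠ ∞ := (hub.continuous.integrable_of_hasCompactSupport
    (unitBump n).hasCompactSupport).2.ne
  have fK1 : K1 ≠ ∞ := ((continuous_gradVec hub).integrable_of_hasCompactSupport
    (hasCompactSupport_gradVec (unitBump n).hasCompactSupport)).2.ne
  refine ⟨K0 + K1 + 1, by simp [fK0, fK1], fun A a h => ?_⟩
  rcases eq_or_ne a ∞ with rfl | ha
  · rw [ENNReal.mul_top (by simp)]; exact le_top
  obtain ⟨ι, hι, c, s, hs, hA, hsum⟩ := h
  set S := ∑' i, ENNReal.ofReal (s i ^ (n - 1)) with hS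
  have fS : S ≠ ∞ := ne_top_of_le_ne_top ha hsum
  set b : ι → Rn n → ℝ := fun i => ballBump (c i) (s i) with hb
  have hbd : ∀ i, ContDiff ℝ 1 (b i) := fun i => contDiff_ballBump _ _
  have hbc : ∀ i, HasCompactSupport (b i) := fun i => hasCompactSupport_ballBump _ (hs i).1
  have l0 : ∑' i, ∫⁻ x, ‖b i x‖ₑ ≤ K0 * S := by
    rw [hS, ← ENNReal.tsum_mul_left]
    refine ENNReal.tsum_le_tsum fun i => ?_
    have := lintegral_comp_inv_smul_sub hub.continuous.enorm.measurable (c i) (hs i).1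
    rw [show (∫⁻ x, ‖b i x‖ₑ) = _ from this, mul_comm]
    exact mul_le_mul_right (ENNReal.ofReal_le_ofReal
      (pow_le_pow_of_le_one (hs i).1.le (hs i).2 (by omega))) _
  have l1 : ∑' i, ∫⁻ x, ‖gradVec (b i) x‖ₑ ≤ K1 * S := by
    rw [hS, ← ENNReal.tsum_mul_left]
    refine ENNReal.tsum_le_tsum fun i => ?_
    have h2 := lintegral_comp_inv_smul_sub (continuous_gradVec hub).enorm.measurable (c i) (hs i).1
    simp_rw [hb, gradVec_ballBump, enorm_smul]
    rw [lintegral_const_mul' _ _ (by simp), h2, mul_comm K1, ← mul_assoc]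
    gcongr
    rw [← ofReal_norm, ← ENNReal.ofReal_mul (norm_nonneg _), Real.norm_eq_abs,
      abs_of_pos (inv_pos.2 (hs i).1)]
    refine (congrArg _ ?_).le
    obtain ⟨m, rfl⟩ : ∃ m, n = m + 1 := ⟨n - 1, by omega⟩
    have := (hs i).1.ne'
    simp only [add_tsub_cancel_right]
    field_simp
    ring
  have f0 : ∑' i, ∫⁻ x, ‖b i x‖ₑ ≠ ∞ := ne_top_of_le_ne_top (ENNReal.mul_ne_top fK0 fS) l0
  have f1 : ∑' i, ∫⁻ x, ‖gradVec (b i) x‖ₑ ≠ ∞ :=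
    ne_top_of_le_ne_top (ENNReal.mul_ne_top fK1 fS) l1
  have m0 : ∀ i, AEMeasurable (fun x => ‖b i x‖ₑ) := fun i =>
    (hbd i).continuous.enorm.measurable.aemeasurable
  have m1 : ∀ i, AEMeasurable (fun x => ‖gradVec (b i) x‖ₑ) := fun i =>
    (continuous_gradVec (hbd i)).enorm.measurable.aemeasurable
  have I0 : ∫⁻ x, ‖∑' i, b i x‖ₑ ≤ ∑' i, ∫⁻ x, ‖b i x‖ₑ := by
    rw [← lintegral_tsum m0]
    exact lintegral_mono fun x => enorm_tsum_le_tsum_enorm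
  have I1 : ∫⁻ x, ‖∑' i, gradVec (b i) x‖ₑ ≤ ∑' i, ∫⁻ x, ‖gradVec (b i) x‖ₑ := by
    rw [← lintegral_tsum m1]
    exact lintegral_mono fun x => enorm_tsum_le_tsum_enorm
  have hadm : IsCapAdmissible A (fun x => ∑' i, b i x) (fun x => ∑' i, gradVec (b i) x) := by
    refine ⟨⟨AEStronglyMeasurable.tsum fun i => (hbd i).continuous.aestronglyMeasurable,
      I0.trans_lt f0.lt_top⟩, ⟨AEStronglyMeasurable.tsum fun i =>
        (continuous_gradVec (hbd i)).aestronglyMeasurable, I1.trans_lt f1.lt_top⟩,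
      isWeakPartialDeriv_tsum hbd hbc f0 f1, ⋃ i, Metric.ball (c i) (s i),
      isOpen_iUnion fun i => Metric.isOpen_ball, hA, ?_⟩
    have hfin : ∫⁻ x, ∑' i, ‖b i x‖ₑ ≠ ∞ := by rwa [lintegral_tsum m0]
    filter_upwards [ae_lt_top' (AEMeasurable.tsum m0) hfin] with x hx hxV
    obtain ⟨i, hi⟩ := Set.mem_iUnion.1 hxV
    have hsx : Summable fun i => b i x := Summable.of_enorm hx.ne
    have h1 : b i x = 1 := by
      refine (unitBump n).one_of_mem_closedBall ?_
      have : ‖x - c i‖ < s i := by rwa [← dist_eq_norm]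
      have h0 := (hs i).1
      rw [mem_closedBall_zero_iff, norm_smul, norm_inv, Real.norm_eq_abs, abs_of_pos h0]
      change (s i)⁻¹ * ‖x - c i‖ ≤ 1
      rw [inv_mul_le_one₀ h0]
      exact this.le
    rw [← h1]
    exact hsx.le_tsum i fun j _ => (unitBump n).nonneg
  calc cap1 A ≤ (∫⁻ x, ‖∑' i, b i x‖ₑ) + ∫⁻ x, ‖∑' i, gradVec (b i) x‖ₑ :=
        iInf₂_le_of_le _ _ (iInf_le _ hadm)
    _ ≤ K0 * S + K1 * S := add_le_add (I0.trans l0) (I1.trans l1)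
    _ = (K0 + K1) * S := (add_mul _ _ _).symm
    _ ≤ (K0 + K1 + 1) * a := by
        exact mul_le_mul' le_self_add hsum

/-! ### The Poincaré inequality on balls for smooth functions -/

/-- The homothety with centre `y ∈ B` and ratio `τ ≥ 1 / 2` maps the ball `B` into itself, and
changes volumes at most by the factor `2 ^ n`. -/
lemma lintegral_closedBall_segment_le {n : ℕ} {F : Rn n → ℝ≥0∞} (hF : Measurable F) {c y : Rn n}
    {s τ : ℝ} (hy : y ∈ Metric.closedBall c s) (h1 : 1 / 2 ≤ τ) (h2 : τ ≤ 1) :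
    ∫⁻ x in Metric.closedBall c s, F (y + τ • (x - y))
      ≤ 2 ^ n * ∫⁻ x in Metric.closedBall c s, F x := by
  have hτ : 0 < τ := by linarith
  have hB : MeasurableSet (Metric.closedBall c s) := Metric.isClosed_closedBall.measurableSet
  set G := (Metric.closedBall c s).indicator F with hG
  have key := lintegral_comp_inv_smul_sub (hF.indicator hB) (-((1 - τ) / τ) • y) (inv_pos.2 hτ)
  rw [lintegral_indicator hB] at key
  calc ∫⁻ x in Metric.closedBall c s, F (y + τ • (x - y))
      ≤ ∫⁻ x in Metric.closedBall c s, G (τ⁻¹⁻¹ • (x - -((1 - τ) / τ) • y)) := by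
        refine setLIntegral_mono' hB fun x hx => ?_
        have e : τ⁻¹⁻¹ • (x - -((1 - τ) / τ) • y) = y + τ • (x - y) := by
          rw [inv_inv, smul_sub, smul_smul, smul_sub]
          have : τ * -((1 - τ) / τ) = τ - 1 := by field_simp; ring
          rw [this, sub_smul, one_smul]
          abel
        rw [e, hG, Set.indicator_of_mem]
        exact (convex_closedBall c s).add_smul_sub_mem hy hx ⟨hτ.le, h2⟩
    _ ≤ ∫⁻ x, G (τ⁻¹⁻¹ • (x - -((1 - τ) / τ) • y)) := setLIntegral_le_lintegral _ _
    _ ≤ _ := by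
        rw [key]
        gcongr
        rw [show (2 : ℝ≥0∞) ^ n = ENNReal.ofReal (2 ^ n) by
          rw [ENNReal.ofReal_pow zero_le_two]; simp]
        gcongr
        rw [inv_le_comm₀ hτ two_pos]
        linarith

/-- The Poincaré inequality on balls in the form of a double integral, for `C¹` functions. The
difference `w x - w y` is the integral of the derivative over the segment; whichever endpoint is
farther from the point `y + τ (x - y)` serves as centre of a homothety of ratio at least `1 / 2`. -/
lemma poincare_contDiff {n : ℕ} {w : Rn n → ℝ} (hw : ContDiff ℝ 1 w) (c : Rn n) {s : ℝ}
    (hs : 0 ≤ s) :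
    ∫⁻ x in Metric.closedBall c s, ∫⁻ y in Metric.closedBall c s, ‖w x - w y‖ₑ
      ≤ ENNReal.ofReal (2 * s) * (volume (Metric.closedBall c s) *
        (2 ^ n * ∫⁻ x in Metric.closedBall c s, ‖fderiv ℝ w x‖ₑ)) := by
  set B := Metric.closedBall c s with hBdef
  have hB : MeasurableSet B := Metric.isClosed_closedBall.measurableSet
  set F : Rn n → ℝ≥0∞ := fun x => ‖fderiv ℝ w x‖ₑ with hFdef
  have hFc : Continuous F := (hw.continuous_fderiv one_ne_zero).enorm
  have hseg : ∀ x ∈ B, ∀ y ∈ B, ‖w x - w y‖ₑ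
      ≤ ENNReal.ofReal (2 * s) * ∫⁻ τ in Set.Icc (0 : ℝ) 1, F (y + τ • (x - y)) := by
    intro x hx y hy
    have hd : ∀ τ : ℝ, HasDerivAt (fun τ : ℝ => w (y + τ • (x - y)))
        (fderiv ℝ w (y + τ • (x - y)) (x - y)) τ := by
      intro τ
      have h1 : HasDerivAt (fun τ : ℝ => y + τ • (x - y)) (x - y) τ := by
        simpa using ((hasDerivAt_id τ).smul_const (x - y)).const_add y
      exact ((hw.differentiable one_ne_zero _).hasFDerivAt).comp_hasDerivAt τ h1
    have hcont : Continuous fun τ : ℝ => fderiv ℝ w (y + τ • (x - y)) (x - y) :=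
      ((hw.continuous_fderiv one_ne_zero).comp (by fun_prop)).clm_apply continuous_const
    have hftc := intervalIntegral.integral_eq_sub_of_hasDerivAt (fun τ _ => hd τ)
      (hcont.intervalIntegrable 0 1)
    simp only [one_smul, add_sub_cancel, zero_smul, add_zero] at hftc
    rw [← hftc, intervalIntegral.integral_of_le zero_le_one, ← integral_Icc_eq_integral_Ioc]
    refine (enorm_integral_le_lintegral_enorm _).trans ?_
    rw [← lintegral_const_mul _ (by fun_prop : Measurable fun τ : ℝ => F (y + τ • (x - y)))]
    refine lintegral_mono fun τ => ?_
    have hxy : ‖x - y‖ ≤ 2 * s := by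
      rw [← dist_eq_norm]
      have := dist_triangle_right x y c
      have h1 : dist x c ≤ s := hx
      have h2 : dist y c ≤ s := hy
      linarith
    simp only [hFdef]
    rw [← ofReal_norm, ← ofReal_norm, ← ENNReal.ofReal_mul (by positivity)]
    apply ENNReal.ofReal_le_ofReal
    refine (ContinuousLinearMap.le_opNorm _ _).trans ?_
    rw [mul_comm]
    gcongr
  have hJ : ∀ τ ∈ Set.Icc (0 : ℝ) 1, ∫⁻ x in B, ∫⁻ y in B, F (y + τ • (x - y))
      ≤ volume B * (2 ^ n * ∫⁻ x in B, F x) := by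
    intro τ hτ
    rcases le_total (1 / 2) τ with h | h
    · rw [lintegral_lintegral_swap
        (by fun_prop : Measurable _).aemeasurable]
      calc ∫⁻ y in B, ∫⁻ x in B, F (y + τ • (x - y))
          ≤ ∫⁻ y in B, 2 ^ n * ∫⁻ x in B, F x :=
            setLIntegral_mono' hB fun y hy =>
              lintegral_closedBall_segment_le hFc.measurable hy h hτ.2
        _ = _ := by rw [setLIntegral_const, mul_comm]
    · calc ∫⁻ x in B, ∫⁻ y in B, F (y + τ • (x - y))
          ≤ ∫⁻ x in B, 2 ^ n * ∫⁻ y in B, F y := by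
            refine setLIntegral_mono' hB fun x hx => ?_
            have := lintegral_closedBall_segment_le hFc.measurable hx
              (τ := 1 - τ) (by linarith) (by linarith [hτ.1])
            refine le_trans (le_of_eq (lintegral_congr fun y => ?_)) this
            congr 1
            simp only [sub_smul, one_smul, smul_sub]
            abel
        _ = _ := by rw [setLIntegral_const, mul_comm]
  calc ∫⁻ x in B, ∫⁻ y in B, ‖w x - w y‖ₑ
      ≤ ∫⁻ x in B, ∫⁻ y in B,
          ENNReal.ofReal (2 * s) * ∫⁻ τ in Set.Icc (0 : ℝ) 1, F (y + τ • (x - y)) :=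
        setLIntegral_mono' hB fun x hx => setLIntegral_mono' hB fun y hy => hseg x hx y hy
    _ = ENNReal.ofReal (2 * s) *
          ∫⁻ x in B, ∫⁻ y in B, ∫⁻ τ in Set.Icc (0 : ℝ) 1, F (y + τ • (x - y)) := by
        rw [← lintegral_const_mul' _ _ ENNReal.ofReal_ne_top]
        refine lintegral_congr fun x => ?_
        rw [lintegral_const_mul' _ _ ENNReal.ofReal_ne_top]
    _ = ENNReal.ofReal (2 * s) *
          ∫⁻ τ in Set.Icc (0 : ℝ) 1, ∫⁻ x in B, ∫⁻ y in B, F (y + τ • (x - y)) := by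
        congr 1
        refine (lintegral_congr fun x => lintegral_lintegral_swap ?_).trans
          (lintegral_lintegral_swap ?_)
        · exact (hFc.comp (by fun_prop :
            Continuous fun p : Rn n × ℝ => p.1 + p.2 • (x - p.1))).measurable.aemeasurable
        · refine Measurable.aemeasurable ?_
          exact Measurable.lintegral_prod_right' (f := fun q : (Rn n × ℝ) × Rn n =>
            F (q.2 + q.1.2 • (q.1.1 - q.2))) (by fun_prop)
    _ ≤ ENNReal.ofReal (2 * s) *
          ∫⁻ τ in Set.Icc (0 : ℝ) 1, volume B * (2 ^ n * ∫⁻ x in B, F x) := by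
        gcongr 1
        exact setLIntegral_mono' measurableSet_Icc hJ
    _ = _ := by simp

/-! ### Mollification and the Poincaré inequality for weakly differentiable functions -/

/-- The standard mollifying bump functions, with support radius `1 / (i + 1)`. -/
noncomputable def molBump (n i : ℕ) : ContDiffBump (0 : Rn n) :=
  ⟨1 / (i + 1) / 2, 1 / (i + 1), by positivity, half_lt_self (by positivity)⟩

/-- The `i`-th mollification of `u`. -/
noncomputable def mollify {n : ℕ} (i : ℕ) (u : Rn n → ℝ) : Rn n → ℝ :=
  MeasureTheory.convolution ((molBump n i).normed volume) u
    (ContinuousLinearMap.lsmul ℝ ℝ) volume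

lemma mollify_apply {n : ℕ} (i : ℕ) (u : Rn n → ℝ) (x : Rn n) :
    mollify i u x = ∫ t, (molBump n i).normed volume (x - t) * u t :=
  convolution_lsmul_swap

lemma contDiff_mollify {n : ℕ} (i : ℕ) {u : Rn n → ℝ} (hu : LocallyIntegrable u volume) :
    ContDiff ℝ 1 (mollify i u) :=
  (molBump n i).hasCompactSupport_normed.contDiff_convolution_left (n := 1) _
    (molBump n i).contDiff_normed hu

lemma ae_tendsto_mollify {n : ℕ} {u : Rn n → ℝ} (hu : LocallyIntegrable u volume) :
    ∀ᵐ x, Tendsto (fun i => mollify i u x) atTop (𝓝 (u x)) := by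
  refine ContDiffBump.ae_convolution_tendsto_right_of_locallyIntegrable (K := 2) ?_ ?_ hu
  · exact tendsto_one_div_add_atTop_nhds_zero_nat
  · refine Eventually.of_forall fun i => ?_
    simp only [molBump]
    linarith

lemma integrable_mollify_integrand {n : ℕ} (i : ℕ) {u : Rn n → ℝ}
    (hu : LocallyIntegrable u volume) (x : Rn n) :
    Integrable fun t => (molBump n i).normed volume (x - t) * u t := by
  have h := (molBump n i).hasCompactSupport_normed (μ := volume) |>.convolutionExists_left
    (ContinuousLinearMap.lsmul ℝ ℝ) ((molBump n i).contDiff_normed (n := 0)).continuous hu x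
  exact h.integrable_swap

/-- Mollification commutes with weak partial derivatives. -/
lemma fderiv_mollify {n : ℕ} (i : ℕ) {u v : Rn n → ℝ} {k : Fin n}
    (hu : LocallyIntegrable u volume) (hv : IsWeakPartialDeriv u k v) (x : Rn n) :
    fderiv ℝ (mollify i u) x (EuclideanSpace.single k 1) = mollify i v x := by
  set ρ := (molBump n i).normed (volume : Measure (Rn n)) with hρ
  have hρc : HasCompactSupport ρ := (molBump n i).hasCompactSupport_normed
  have hρs : ContDiff ℝ ((⊤ : ℕ∞) : WithTop ℕ∞) ρ := (molBump n i).contDiff_normed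
  have hρ1 : ContDiff ℝ 1 ρ := (molBump n i).contDiff_normed
  have h1 := (hρc.hasFDerivAt_convolution_left (ContinuousLinearMap.lsmul ℝ ℝ) hρ1 hu x).fderiv
  rw [mollify, h1, convolution_eq_swap, ContinuousLinearMap.integral_apply, mollify_apply]
  · have h2 := hv.2 (fun t => ρ (x - t)) (hρs.comp (contDiff_const.sub contDiff_id))
      (hρc.comp_homeomorph (Homeomorph.subLeft x))
    have h3 : ∀ t, fderiv ℝ (fun t => ρ (x - t)) t = -fderiv ℝ ρ (x - t) := by
      intro t
      have h := (hρ1.differentiable one_ne_zero (x - t)).hasFDerivAt.comp t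
        ((hasFDerivAt_id t).const_sub x)
      rw [show (fun t => ρ (x - t)) = ρ ∘ fun t => x - t from rfl]
      refine h.fderiv.trans ?_
      ext y
      simp
    simp only [h3, neg_apply, mul_neg, integral_neg, neg_inj] at h2
    rw [← h2]
    refine integral_congr_ae (Eventually.of_forall fun t => ?_)
    simp [mul_comm]
  · exact ((hρc.fderiv ℝ).convolutionExists_left _ (hρ1.continuous_fderiv one_ne_zero)
      hu x).integrable_swap

lemma norm_le_sum_single {n : ℕ} (L : Rn n →L[ℝ] ℝ) :
    ‖L‖ ≤ ∑ k, |L (EuclideanSpace.single k 1)| := by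
  refine L.opNorm_le_bound (Finset.sum_nonneg fun k _ => abs_nonneg _) fun x => ?_
  have hx : x = ∑ k, x k • EuclideanSpace.single k (1 : ℝ) := by
    ext j
    simp [Finset.sum_apply, Pi.single_apply]
  conv_lhs => rw [hx]
  rw [map_sum, Finset.sum_mul]
  refine (norm_sum_le _ _).trans (Finset.sum_le_sum fun k _ => ?_)
  rw [map_smul, smul_eq_mul, norm_mul, mul_comm]
  exact mul_le_mul_of_nonneg_left (PiLp.norm_apply_le x k) (abs_nonneg _)

/-- The gradient of a mollification is at most the mollification of the `ℓ¹` norm of the weak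
gradient. -/
lemma norm_fderiv_mollify_le {n : ℕ} (i : ℕ) {u : Rn n → ℝ} {v : Fin n → Rn n → ℝ}
    (hu : LocallyIntegrable u volume) (hv : ∀ k, IsWeakPartialDeriv u k (v k)) (x : Rn n) :
    ‖fderiv ℝ (mollify i u) x‖ ≤ mollify i (fun x => ∑ k, |v k x|) x := by
  refine (norm_le_sum_single _).trans ?_
  simp_rw [fderiv_mollify i hu (hv _), mollify_apply, Finset.mul_sum]
  have hint : ∀ k, Integrable fun t => (molBump n i).normed volume (x - t) * |v k t| := fun k =>
    integrable_mollify_integrand i (u := fun t => |v k t|) (fun y => ((hv k).1 y).norm) x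
  rw [integral_finsetSum _ fun k _ => hint k]
  refine Finset.sum_le_sum fun k _ => ?_
  refine (abs_integral_le_integral_abs).trans (integral_mono
    (integrable_mollify_integrand i (hv k).1 x).abs (hint k) fun t => ?_)
  simp only [abs_mul]
  rw [abs_of_nonneg ((molBump n i).nonneg_normed _)]

/-- Mollification does not increase the `L¹` norm, if the ball is enlarged by the radius of the
support of the mollifier. -/
lemma lintegral_mollify_le {n : ℕ} (i : ℕ) {γ : Rn n → ℝ} (hγ : LocallyIntegrable γ volume)
    (c : Rn n) (s : ℝ) :
    ∫⁻ x in Metric.closedBall c s, ‖mollify i γ x‖ₑ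
      ≤ ∫⁻ x in Metric.closedBall c (s + 1 / (i + 1)), ‖γ x‖ₑ := by
  set ρ := (molBump n i).normed (volume : Measure (Rn n)) with hρ
  have hρ1 : ContDiff ℝ 1 ρ := (molBump n i).contDiff_normed
  have hB : MeasurableSet (Metric.closedBall c s) := Metric.isClosed_closedBall.measurableSet
  have hB' : MeasurableSet (Metric.closedBall c (s + 1 / (i + 1))) :=
    Metric.isClosed_closedBall.measurableSet
  have hρint : ∫⁻ x, ‖ρ x‖ₑ = 1 := by
    have := (molBump n i).integral_normed (μ := volume)
    rw [← ofReal_integral_norm_eq_lintegral_enorm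
      (f := ρ) (μ := volume) (molBump n i).integrable_normed]
    have e : ∀ x, ‖ρ x‖ = ρ x := fun x => Real.norm_of_nonneg ((molBump n i).nonneg_normed x)
    simp_rw [e]
    rw [this, ENNReal.ofReal_one]
  calc ∫⁻ x in Metric.closedBall c s, ‖mollify i γ x‖ₑ
      ≤ ∫⁻ x in Metric.closedBall c s, ∫⁻ t, ‖ρ (x - t)‖ₑ * ‖γ t‖ₑ := by
        refine lintegral_mono fun x => ?_
        rw [mollify_apply]
        simp_rw [← enorm_mul]
        exact enorm_integral_le_lintegral_enorm _
    _ = ∫⁻ t, ∫⁻ x in Metric.closedBall c s, ‖ρ (x - t)‖ₑ * ‖γ t‖ₑ := by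
        refine lintegral_lintegral_swap ?_
        refine AEMeasurable.mul (f := fun p : Rn n × Rn n => ‖ρ (p.1 - p.2)‖ₑ)
          (g := fun p => ‖γ p.2‖ₑ) (Continuous.measurable ?_).aemeasurable ?_
        · exact (hρ1.continuous.comp (continuous_fst.sub continuous_snd)).enorm
        · have := hγ.aestronglyMeasurable.aemeasurable.comp_quasiMeasurePreserving
            (Measure.quasiMeasurePreserving_snd (μ := volume.restrict (Metric.closedBall c s)))
          exact this.enorm
    _ ≤ ∫⁻ t, (Metric.closedBall c (s + 1 / (i + 1))).indicator (fun t => ‖γ t‖ₑ) t := by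
        refine lintegral_mono fun t => ?_
        by_cases ht : t ∈ Metric.closedBall c (s + 1 / (i + 1))
        · rw [Set.indicator_of_mem ht, lintegral_mul_const' _ _ enorm_ne_top]
          refine (mul_le_mul' ((setLIntegral_le_lintegral _ _).trans ?_) le_rfl).trans
            (one_mul _).le
          rw [lintegral_sub_right_eq_self (fun x => ‖ρ x‖ₑ) t, hρint]
        · rw [Set.indicator_of_notMem ht]
          refine (setLIntegral_congr_fun hB (g := fun _ => 0) fun x hx => ?_).trans_le (by simp)
          have h0 : ρ (x - t) = 0 := by
            by_contra h
            have : x - t ∈ Function.support ρ := h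
            rw [(molBump n i).support_normed_eq, mem_ball_zero_iff, ← dist_eq_norm] at this
            refine ht ?_
            have h1 : dist x c ≤ s := hx
            have h2 : dist x t < 1 / (i + 1) := this
            rw [Metric.mem_closedBall]
            linarith [dist_triangle_left t c x]
          simp [h0]
    _ = _ := lintegral_indicator hB' _

lemma tendsto_lintegral_closedBall_add {n : ℕ} {γ : Rn n → ℝ} (hγ : LocallyIntegrable γ volume)
    (c : Rn n) (s : ℝ) :
    Tendsto (fun i : ℕ => ∫⁻ x in Metric.closedBall c (s + 1 / (i + 1)), ‖γ x‖ₑ) atTop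
      (𝓝 (∫⁻ x in Metric.closedBall c s, ‖γ x‖ₑ)) := by
  have h := tendsto_measure_iInter_atTop (μ := volume.withDensity fun x => ‖γ x‖ₑ)
    (s := fun i : ℕ => Metric.closedBall c (s + 1 / ((i : ℝ) + 1)))
    (fun i => Metric.isClosed_closedBall.measurableSet.nullMeasurableSet)
    (fun i j hij => Metric.closedBall_subset_closedBall (by
      have : (i : ℝ) ≤ j := by exact_mod_cast hij
      gcongr)) ⟨0, ?_⟩
  · have e : ⋂ i : ℕ, Metric.closedBall c (s + 1 / ((i : ℝ) + 1)) = Metric.closedBall c s := by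
      ext x
      simp only [Set.mem_iInter, Metric.mem_closedBall]
      refine ⟨fun h => ?_, fun h i => h.trans (by simp; positivity)⟩
      refine ge_of_tendsto' (x := atTop) ?_ h
      simpa using (tendsto_const_nhds (x := s)).add tendsto_one_div_add_atTop_nhds_zero_nat
    rw [e, withDensity_apply _ Metric.isClosed_closedBall.measurableSet] at h
    simpa only [Function.comp_def, withDensity_apply _ Metric.isClosed_closedBall.measurableSet]
      using h
  · rw [withDensity_apply _ Metric.isClosed_closedBall.measurableSet]
    exact (hγ.integrableOn_isCompact (isCompact_closedBall _ _)).2.ne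

lemma liminf_add_liminf_le (u v : ℕ → ℝ≥0∞) :
    liminf u atTop + liminf v atTop ≤ liminf (fun i => u i + v i) atTop := by
  simp only [liminf_eq_iSup_iInf_of_nat']
  rw [ENNReal.iSup_add_iSup_of_monotone]
  · exact iSup_mono fun n => le_iInf fun i => add_le_add (iInf_le _ i) (iInf_le _ i)
  · intro a b hab
    exact le_iInf fun i => iInf_le_of_le (i + (b - a)) (by rw [add_assoc, Nat.sub_add_cancel hab])
  · intro a b hab
    exact le_iInf fun i => iInf_le_of_le (i + (b - a)) (by rw [add_assoc, Nat.sub_add_cancel hab])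

/-- The Poincaré inequality on balls for `ψ ∘ u`, where `u` is weakly differentiable and `ψ` is a
`C¹` function with bounded derivative. The right-hand side only sees the gradient of `u` where
`ψ' ∘ u` does not vanish. -/
theorem poincare_comp {n : ℕ} {u : Rn n → ℝ} {v : Fin n → Rn n → ℝ}
    (hu : LocallyIntegrable u volume) (hv : ∀ k, IsWeakPartialDeriv u k (v k))
    {ψ : ℝ → ℝ} (hψ : ContDiff ℝ 1 ψ) {M : ℝ} (hM : ∀ t, |deriv ψ t| ≤ M) (c : Rn n) {s : ℝ}
    (hs : 0 ≤ s) :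
    ∫⁻ x in Metric.closedBall c s, ∫⁻ y in Metric.closedBall c s, ‖ψ (u x) - ψ (u y)‖ₑ
      ≤ ENNReal.ofReal (2 * s) * (volume (Metric.closedBall c s) *
        (2 ^ n * ∫⁻ x in Metric.closedBall c s, ‖deriv ψ (u x)‖ₑ * ‖∑ k, |v k x|‖ₑ)) := by
  set B := Metric.closedBall c s with hBdef
  set γ : Rn n → ℝ := fun x => ∑ k, |v k x| with hγdef
  have hγ : LocallyIntegrable γ volume :=
    locallyIntegrable_finsetSum _ fun k _ y => ((hv k).1 y).norm
  have hψ' : Continuous (deriv ψ) := hψ.continuous_deriv le_rfl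
  have hB : MeasurableSet B := Metric.isClosed_closedBall.measurableSet
  set A := ENNReal.ofReal (2 * s) * (volume B * 2 ^ n) with hA
  have hAt : A ≠ ∞ := ENNReal.mul_ne_top ENNReal.ofReal_ne_top
    (ENNReal.mul_ne_top (measure_closedBall_lt_top).ne (by simp))
  set ui : ℕ → Rn n → ℝ := fun i => mollify i u with hui
  set ki : ℕ → Rn n → ℝ := fun i => mollify i γ with hki
  have huic : ∀ i, ContDiff ℝ 1 (ui i) := fun i => contDiff_mollify i hu
  have hkic : ∀ i, Continuous (ki i) := fun i => (contDiff_mollify i hγ).continuous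
  have hut : ∀ᵐ x ∂(volume.restrict B), Tendsto (fun i => ui i x) atTop (𝓝 (u x)) :=
    ae_restrict_of_ae (ae_tendsto_mollify hu)
  have hkt : ∀ᵐ x ∂(volume.restrict B), Tendsto (fun i => ki i x) atTop (𝓝 (γ x)) :=
    ae_restrict_of_ae (ae_tendsto_mollify hγ)
  set L : ℕ → ℝ≥0∞ := fun i => ∫⁻ x in B, ∫⁻ y in B, ‖ψ (ui i x) - ψ (ui i y)‖ₑ with hL
  -- The deficit `M - |ψ'|` turns an upper bound for the limit of the right-hand sides into a
  -- lower bound, to which Fatou's lemma applies.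
  set Y : ℕ → ℝ≥0∞ := fun i => ∫⁻ x in B, ENNReal.ofReal (M - |deriv ψ (ui i x)|) * ‖ki i x‖ₑ
    with hY
  have hsplit : ∀ t : ℝ, ‖deriv ψ t‖ₑ + ENNReal.ofReal (M - |deriv ψ t|) = ENNReal.ofReal M := by
    intro t
    rw [← ofReal_norm, Real.norm_eq_abs, ← ENNReal.ofReal_add (abs_nonneg _)
      (sub_nonneg.2 (hM t))]
    ring_nf
  have hLY : ∀ i, L i + A * Y i ≤ A * (ENNReal.ofReal M *
      ∫⁻ x in Metric.closedBall c (s + 1 / (i + 1)), ‖γ x‖ₑ) := by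
    intro i
    have h1 : L i ≤ A * ∫⁻ x in B, ‖deriv ψ (ui i x)‖ₑ * ‖ki i x‖ₑ := by
      have hp := poincare_contDiff (hψ.comp (huic i)) c hs
      rw [hA, mul_assoc, mul_assoc]
      refine hp.trans ?_
      gcongr with x
      have hd : fderiv ℝ (ψ ∘ ui i) x = deriv ψ (ui i x) • fderiv ℝ (ui i) x :=
        ((hψ.differentiable one_ne_zero _).hasDerivAt.comp_hasFDerivAt x
          ((huic i).differentiable one_ne_zero x).hasFDerivAt).fderiv
      rw [hd, enorm_smul]
      gcongr
      rw [← ofReal_norm, ← ofReal_norm]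
      exact ENNReal.ofReal_le_ofReal
        ((norm_fderiv_mollify_le i hu hv x).trans (Real.le_norm_self _))
    calc L i + A * Y i ≤ A * (∫⁻ x in B, ‖deriv ψ (ui i x)‖ₑ * ‖ki i x‖ₑ) + A * Y i := by gcongr
      _ = A * (ENNReal.ofReal M * ∫⁻ x in B, ‖ki i x‖ₑ) := by
        have hm : Measurable fun x => ‖deriv ψ (ui i x)‖ₑ * ‖ki i x‖ₑ :=
          (hψ'.comp (huic i).continuous).enorm.measurable.mul (hkic i).enorm.measurable
        rw [← mul_add, ← lintegral_add_left hm, ← lintegral_const_mul' _ _ ENNReal.ofReal_ne_top]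
        simp_rw [← add_mul, hsplit]
      _ ≤ _ := by
        exact mul_le_mul' le_rfl (mul_le_mul' le_rfl (lintegral_mollify_le i hγ c s))
  set X' := ∫⁻ x in B, ‖deriv ψ (u x)‖ₑ * ‖γ x‖ₑ with hX
  set Y' := ∫⁻ x in B, ENNReal.ofReal (M - |deriv ψ (u x)|) * ‖γ x‖ₑ with hY'
  have hγB : ∫⁻ x in B, ‖γ x‖ₑ ≠ ∞ :=
    (hγ.integrableOn_isCompact (isCompact_closedBall _ _)).2.ne
  have hXY : X' + Y' = ENNReal.ofReal M * ∫⁻ x in B, ‖γ x‖ₑ := by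
    rw [hX, hY', ← lintegral_add_left', ← lintegral_const_mul' _ _ ENNReal.ofReal_ne_top]
    · simp_rw [← add_mul, hsplit]
    · exact ((hψ'.measurable.comp_aemeasurable hu.aestronglyMeasurable.aemeasurable).enorm.mul
        hγ.aestronglyMeasurable.aemeasurable.enorm).restrict
  have hYt : Y' ≠ ∞ := ne_top_of_le_ne_top (ENNReal.mul_ne_top ENNReal.ofReal_ne_top hγB)
    (le_add_self.trans hXY.le)
  have hYliminf : A * Y' ≤ liminf (fun i => A * Y i) atTop := by
    rw [ENNReal.liminf_const_mul_of_ne_top hAt]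
    gcongr
    refine le_trans (le_of_eq (lintegral_congr_ae ?_)) (lintegral_liminf_le fun i => ?_)
    · filter_upwards [hut, hkt] with x h1 h2
      refine (Tendsto.liminf_eq ?_).symm
      refine ENNReal.Tendsto.mul ?_ (Or.inr enorm_ne_top) (h2.enorm) (Or.inr ENNReal.ofReal_ne_top)
      exact ENNReal.tendsto_ofReal (tendsto_const_nhds.sub
        (((hψ'.tendsto _).comp h1).abs))
    · have hc : Continuous fun x => M - |deriv ψ (ui i x)| :=
        continuous_const.sub (hψ'.comp (huic i).continuous).abs
      exact hc.measurable.ennreal_ofReal.mul (hkic i).enorm.measurable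
  have hcont : ∀ i, Continuous fun p : Rn n × Rn n => ‖ψ (ui i p.1) - ψ (ui i p.2)‖ₑ := fun i =>
    ((hψ.continuous.comp ((huic i).continuous.comp continuous_fst)).sub
      (hψ.continuous.comp ((huic i).continuous.comp continuous_snd))).enorm
  have hLliminf : ∫⁻ x in B, ∫⁻ y in B, ‖ψ (u x) - ψ (u y)‖ₑ ≤ liminf L atTop := by
    refine le_trans (lintegral_mono_ae (g := fun x =>
      liminf (fun i => ∫⁻ y in B, ‖ψ (ui i x) - ψ (ui i y)‖ₑ) atTop) ?_)
      (lintegral_liminf_le fun i => ?_)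
    · filter_upwards [hut] with x hx
      refine le_trans (le_of_eq (lintegral_congr_ae ?_)) (lintegral_liminf_le fun i => ?_)
      · filter_upwards [hut] with y hy
        refine (Tendsto.liminf_eq ?_).symm
        exact (((hψ.continuous.tendsto _).comp hx).sub ((hψ.continuous.tendsto _).comp hy)).enorm
      · exact ((hcont i).comp (Continuous.prodMk_right x)).measurable
    · exact Measurable.lintegral_prod_right' (hcont i).measurable
  have key : (∫⁻ x in B, ∫⁻ y in B, ‖ψ (u x) - ψ (u y)‖ₑ) + A * Y' ≤ A * X' + A * Y' := by
    calc _ ≤ liminf L atTop + liminf (fun i => A * Y i) atTop := add_le_add hLliminf hYliminf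
      _ ≤ liminf (fun i => L i + A * Y i) atTop :=
          liminf_add_liminf_le L fun i => A * Y i
      _ ≤ liminf (fun i : ℕ => A * (ENNReal.ofReal M *
            ∫⁻ x in Metric.closedBall c (s + 1 / (i + 1)), ‖γ x‖ₑ)) atTop :=
          liminf_le_liminf (Eventually.of_forall hLY)
      _ = A * (ENNReal.ofReal M * ∫⁻ x in B, ‖γ x‖ₑ) := by
          refine Tendsto.liminf_eq ?_
          exact ENNReal.Tendsto.const_mul (ENNReal.Tendsto.const_mul
            (tendsto_lintegral_closedBall_add hγ c s) (Or.inr ENNReal.ofReal_ne_top)) (Or.inr hAt)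
      _ = A * X' + A * Y' := by rw [← hXY, mul_add]
  have := (ENNReal.add_le_add_iff_right (ENNReal.mul_ne_top hAt hYt)).1 key
  rw [hA, mul_assoc, mul_assoc] at this
  exact this

/-! ### A boxing inequality -/

/-- The measure with density `∑ₖ |vₖ|`, where `v` is a (weak) gradient. The `ℓ¹` norm in place of
the Euclidean one only affects constants. -/
noncomputable def gradMeasure {n : ℕ} (v : Fin n → Rn n → ℝ) : Measure (Rn n) :=
  volume.withDensity fun x => ‖∑ k, |v k x|‖ₑ

/-- If the mean slope of an increasing function over `[a, b]` is less than `K`, then at some point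
of `[a, b)` there are arbitrarily small increments for which its difference quotient is at most `K`.
This replaces the differentiation of monotone functions. -/
lemma exists_frequently_sub_le {F : ℝ → ℝ} (hF : Monotone F) {a b K : ℝ} (hab : a < b)
    (hK : F b - F a < K * (b - a)) :
    ∃ t, a ≤ t ∧ t < b ∧ ∃ᶠ δ in 𝓝[>] (0 : ℝ), F (t + δ) - F t ≤ K * δ := by
  by_contra! hcon
  have hKpos : 0 < K := by
    have := hF hab.le
    by_contra! h
    nlinarith
  -- the supremum of the points up to which the mean slope is at least `K` would be `b`
  set S := {t | a ≤ t ∧ t ≤ b ∧ F a + K * (t - a) ≤ F t} with hS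
  have haS : a ∈ S := ⟨le_rfl, hab.le, by simp⟩
  have hbdd : BddAbove S := ⟨b, fun t ht => ht.2.1⟩
  have h1 : a ≤ sSup S := le_csSup hbdd haS
  have h2 : sSup S ≤ b := csSup_le ⟨a, haS⟩ fun t ht => ht.2.1
  have h3 : F a + K * (sSup S - a) ≤ F (sSup S) := by
    have : sSup S ≤ (F (sSup S) - F a) / K + a := by
      refine csSup_le ⟨a, haS⟩ fun t ht => ?_
      have := hF (le_csSup hbdd ht)
      rw [← sub_le_iff_le_add, le_div_iff₀ hKpos]
      linarith [ht.2.2]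
    rw [← sub_le_iff_le_add, le_div_iff₀ hKpos] at this
    linarith
  rcases h2.lt_or_eq with h | h
  · have hev := hcon _ h1 h
    obtain ⟨δ, hδ, hδb, hδ0⟩ := (hev.and ((eventually_nhdsWithin_of_eventually_nhds
      (eventually_lt_nhds (sub_pos.2 h))).and self_mem_nhdsWithin)).exists
    have hδ0' : 0 < δ := hδ0
    have : sSup S + δ ∈ S := ⟨by linarith, by linarith, by linarith⟩
    linarith [le_csSup hbdd this]
  · rw [h] at h3
    linarith

lemma deriv_smoothTransition_eq_zero {x : ℝ} (hx : x ≤ 0 ∨ 1 ≤ x) :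
    deriv Real.smoothTransition x = 0 := by
  rcases hx with h | h
  · refine IsLocalMin.deriv_eq_zero (Eventually.of_forall fun y => ?_)
    rw [Real.smoothTransition.zero_of_nonpos h]
    exact Real.smoothTransition.nonneg y
  · refine IsLocalMax.deriv_eq_zero (Eventually.of_forall fun y => ?_)
    rw [Real.smoothTransition.one_of_one_le h]
    exact Real.smoothTransition.le_one y

lemma exists_abs_deriv_smoothTransition_le :
    ∃ K : ℝ, 0 < K ∧ ∀ x, |deriv Real.smoothTransition x| ≤ K := by
  have hc : Continuous (deriv Real.smoothTransition) :=
    (Real.smoothTransition.contDiff (n := 1)).continuous_deriv le_rfl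
  obtain ⟨K, hK⟩ := (isCompact_Icc (a := (0 : ℝ)) (b := 1)).exists_bound_of_continuousOn
    hc.continuousOn
  refine ⟨max K 1, by positivity, fun x => ?_⟩
  by_cases hx : x ∈ Set.Icc (0 : ℝ) 1
  · exact (hK x hx).trans (le_max_left _ _)
  · rw [deriv_smoothTransition_eq_zero, abs_zero]
    · positivity
    · rw [Set.mem_Icc, not_and_or, not_le, not_le] at hx
      exact hx.imp le_of_lt le_of_lt

lemma mul_measure_le_setLIntegral {n : ℕ} {B S : Set (Rn n)} (hS : MeasurableSet S) (hSB : S ⊆ B)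
    {a : ℝ≥0∞} {g : Rn n → ℝ≥0∞} (h : ∀ x ∈ S, a ≤ g x) :
    a * volume S ≤ ∫⁻ x in B, g x := by
  rw [← setLIntegral_const]
  exact (setLIntegral_mono' hS h).trans (lintegral_mono_set hSB)

/-- Cancellation of a ball volume and a radius in an estimate of isoperimetric type. -/
lemma ofReal_pow_le_of_volume_mul_le {n : ℕ} (hn : 2 ≤ n) {y : Rn n} {s : ℝ} (hs : 0 < s)
    {D X : ℝ≥0∞}
    (h : volume (Metric.closedBall y s) * volume (Metric.closedBall y s)
      ≤ D * (ENNReal.ofReal s * (volume (Metric.closedBall y s) * X))) :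
    ENNReal.ofReal (s ^ (n - 1)) ≤ D / volume (Metric.ball (0 : Rn n) 1) * X := by
  set ω := volume (Metric.ball (0 : Rn n) 1) with hω
  have hω0 : ω ≠ 0 := (Metric.measure_ball_pos volume _ one_pos).ne'
  have hωt : ω ≠ ∞ := measure_ball_lt_top.ne
  set a := volume (Metric.closedBall y s) with ha
  have ha0 : a ≠ 0 := (Metric.measure_closedBall_pos volume _ hs).ne'
  have hat : a ≠ ∞ := measure_closedBall_lt_top.ne
  have hs0 : ENNReal.ofReal s ≠ 0 := by simpa using hs
  have h1 : a * a ≤ a * (ENNReal.ofReal s * (D * X)) := by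
    refine h.trans (le_of_eq ?_); ring
  rw [ENNReal.mul_le_mul_iff_right ha0 hat] at h1
  have h2 : a = ENNReal.ofReal s * (ENNReal.ofReal (s ^ (n - 1)) * ω) := by
    rw [ha, Measure.addHaar_closedBall _ _ hs.le, ← mul_assoc, ← ENNReal.ofReal_mul hs.le,
      ← pow_succ', finrank_euclideanSpace_fin, Nat.sub_add_cancel (by omega)]
  rw [h2, ENNReal.mul_le_mul_iff_right hs0 ENNReal.ofReal_ne_top] at h1
  rw [ENNReal.div_eq_inv_mul, mul_assoc, ← ENNReal.div_eq_inv_mul,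
    ENNReal.le_div_iff_mul_le (Or.inl hω0) (Or.inl hωt)]
  exact h1

section Boxing

variable {n : ℕ} {u : Rn n → ℝ} {v : Fin n → Rn n → ℝ}

/-- If both `{u ≤ t}` and `{u > t}` occupy a definite portion of a ball of radius `s`, then
`s ^ (n - 1)` is controlled by the mass of the gradient of `u` near the level set `{u = t}`. -/
lemma eventually_ofReal_pow_le_of_density (hn : 2 ≤ n) (hum : Measurable u)
    (hu : LocallyIntegrable u volume) (hv : ∀ k, IsWeakPartialDeriv u k (v k)) {K : ℝ}
    (hK : ∀ x, |deriv Real.smoothTransition x| ≤ K) {t s : ℝ} {y : Rn n}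
    (hs : 0 < s)
    (h1 : volume (Metric.closedBall y s) ≤ 2 * volume (Metric.closedBall y s ∩ {x | u x ≤ t}))
    (h2 : volume (Metric.closedBall y s)
      ≤ 2 ^ (2 * n + 1) * volume (Metric.closedBall y s ∩ {x | t < u x})) :
    ∀ᶠ δ in 𝓝[>] (0 : ℝ), ENNReal.ofReal (s ^ (n - 1))
      ≤ ENNReal.ofReal K * 2 ^ (3 * n + 4) / volume (Metric.ball (0 : Rn n) 1) *
        (gradMeasure v (Metric.closedBall y s ∩ {x | t < u x ∧ u x ≤ t + δ})
          / ENNReal.ofReal δ) := by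
  set B := Metric.closedBall y s with hBdef
  have hB : MeasurableSet B := Metric.isClosed_closedBall.measurableSet
  have ha0 : volume B ≠ 0 := (Metric.measure_closedBall_pos volume _ hs).ne'
  have hat : volume B ≠ ∞ := measure_closedBall_lt_top.ne
  -- for small `δ`, the set `{u > t + δ}` still occupies a definite portion of the ball
  have h3 : ∀ᶠ δ in 𝓝[>] (0 : ℝ),
      volume B ≤ 2 ^ (2 * n + 2) * volume (B ∩ {x | t + δ < u x}) := by
    have hlt : volume B / 2 ^ (2 * n + 2) < volume (B ∩ {x | t < u x}) := by
      rw [ENNReal.div_lt_iff (by simp) (by simp)]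
      rcases eq_or_ne (volume (B ∩ {x | t < u x})) 0 with h0 | h0
      · simp [h0] at h2; exact absurd h2 ha0
      · refine h2.trans_lt ?_
        have hfin : volume (B ∩ {x | t < u x}) ≠ ∞ :=
          ne_top_of_le_ne_top hat (measure_mono Set.inter_subset_left)
        rw [mul_comm, ENNReal.mul_lt_mul_iff_right h0 hfin]
        exact_mod_cast (Nat.pow_lt_pow_right (by norm_num) (by omega) :
          2 ^ (2 * n + 1) < 2 ^ (2 * n + 2))
    have hU : B ∩ {x | t < u x} = ⋃ i : ℕ, B ∩ {x | t + 1 / ((i : ℝ) + 1) < u x} := by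
      ext x
      simp only [Set.mem_inter_iff, Set.mem_ofPred_eq, Set.mem_iUnion, exists_and_left]
      refine and_congr_right fun _ => ⟨fun h => ?_, fun ⟨i, hi⟩ => ?_⟩
      · obtain ⟨i, hi⟩ := exists_nat_one_div_lt (sub_pos.2 h)
        exact ⟨i, by linarith⟩
      · have : (0 : ℝ) < 1 / ((i : ℝ) + 1) := by positivity
        linarith
    have hmono : Monotone fun i : ℕ => B ∩ {x | t + 1 / ((i : ℝ) + 1) < u x} := by
      intro i j hij x hx
      have h2 : t + 1 / ((i : ℝ) + 1) < u x := hx.2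
      refine ⟨hx.1, show t + 1 / ((j : ℝ) + 1) < u x from lt_of_le_of_lt ?_ h2⟩
      have : (i : ℝ) ≤ j := by exact_mod_cast hij
      gcongr
    have ht := tendsto_measure_iUnion_atTop (μ := volume) hmono
    rw [← hU] at ht
    obtain ⟨i, hi⟩ := (ht.eventually (lt_mem_nhds hlt)).exists
    have hpos : (0 : ℝ) < 1 / ((i : ℝ) + 1) := by positivity
    filter_upwards [eventually_nhdsWithin_of_eventually_nhds (eventually_lt_nhds hpos)] with δ hδ
    have hsub : B ∩ {x | t + 1 / ((i : ℝ) + 1) < u x} ⊆ B ∩ {x | t + δ < u x} := by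
      intro x hx
      have h2 : t + 1 / ((i : ℝ) + 1) < u x := hx.2
      exact ⟨hx.1, show t + δ < u x by linarith⟩
    have := (hi.trans_le (measure_mono hsub)).le
    rwa [ENNReal.div_le_iff (by simp) (by simp), mul_comm] at this
  filter_upwards [h3, self_mem_nhdsWithin] with δ hδ hδ0
  have hδ0 : 0 < δ := hδ0
  -- `ψ ∘ u` passes from `0` to `1` in the layer `{t < u ≤ t + δ}`, where its gradient is supported
  set ψ : ℝ → ℝ := fun τ => Real.smoothTransition ((τ - t) / δ) with hψdef
  have hψ : ContDiff ℝ 1 ψ :=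
    Real.smoothTransition.contDiff.comp ((contDiff_id.sub contDiff_const).div_const δ)
  have hψd : ∀ τ, deriv ψ τ = deriv Real.smoothTransition ((τ - t) / δ) / δ := by
    intro τ
    have h1 : HasDerivAt (fun τ => (τ - t) / δ) (1 / δ) τ :=
      ((hasDerivAt_id τ).sub_const t).div_const δ
    have h2 := ((Real.smoothTransition.contDiff (n := 1)).differentiable one_ne_zero
      ((τ - t) / δ)).hasDerivAt.comp τ h1
    rw [show ψ = Real.smoothTransition ∘ fun τ => (τ - t) / δ from rfl, h2.deriv]
    ring
  have hψK : ∀ τ, |deriv ψ τ| ≤ K / δ := by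
    intro τ
    rw [hψd, abs_div, abs_of_pos hδ0]
    gcongr
    exact hK _
  have hP := poincare_comp hu hv hψ hψK y hs.le
  rw [← hBdef] at hP
  have hL1 : MeasurableSet (B ∩ {x | t + δ < u x}) :=
    hB.inter (measurableSet_lt measurable_const hum)
  have hL2 : MeasurableSet (B ∩ {x | u x ≤ t}) :=
    hB.inter (measurableSet_le hum measurable_const)
  have hL3 : MeasurableSet {x | t < u x ∧ u x ≤ t + δ} :=
    (measurableSet_lt measurable_const hum).inter (measurableSet_le hum measurable_const)
  have hlow : volume (B ∩ {x | t + δ < u x}) * volume (B ∩ {x | u x ≤ t})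
      ≤ ∫⁻ x in B, ∫⁻ z in B, ‖ψ (u x) - ψ (u z)‖ₑ := by
    refine mul_measure_le_setLIntegral hL2 Set.inter_subset_left fun x hx => ?_
    refine (one_mul _).symm.le.trans
      (mul_measure_le_setLIntegral hL1 Set.inter_subset_left fun z hz => ?_)
    have e1 : ψ (u x) = 0 := Real.smoothTransition.zero_of_nonpos
      (div_nonpos_of_nonpos_of_nonneg (sub_nonpos.2 hx.2) hδ0.le)
    have e2 : ψ (u z) = 1 := Real.smoothTransition.one_of_one_le (by
      rw [le_div_iff₀ hδ0]; have : t + δ < u z := hz.2; linarith)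
    rw [e1, e2]; simp
  have hup : ∫⁻ x in B, ‖deriv ψ (u x)‖ₑ * ‖∑ k, |v k x|‖ₑ
      ≤ ENNReal.ofReal K / ENNReal.ofReal δ *
        gradMeasure v (B ∩ {x | t < u x ∧ u x ≤ t + δ}) := by
    rw [gradMeasure, withDensity_apply _ (hB.inter hL3), ← ENNReal.ofReal_div_of_pos hδ0,
      ← lintegral_const_mul' _ _ ENNReal.ofReal_ne_top, Set.inter_comm,
      ← setLIntegral_indicator hL3]
    refine lintegral_mono fun x => ?_
    by_cases hx : x ∈ {x | t < u x ∧ u x ≤ t + δ}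
    · rw [Set.indicator_of_mem hx]
      gcongr
      rw [← ofReal_norm]
      exact ENNReal.ofReal_le_ofReal (hψK _)
    · rw [Set.indicator_of_notMem hx, hψd, deriv_smoothTransition_eq_zero]
      · simp
      · rw [Set.mem_ofPred_eq, not_and_or, not_lt, not_le] at hx
        refine hx.imp (fun h => ?_) fun h => ?_
        · exact div_nonpos_of_nonpos_of_nonneg (sub_nonpos.2 h) hδ0.le
        · rw [le_div_iff₀ hδ0]; linarith
  refine ofReal_pow_le_of_volume_mul_le hn hs (y := y) ?_
  set mδ := gradMeasure v (B ∩ {x | t < u x ∧ u x ≤ t + δ})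
  calc volume B * volume B
      ≤ (2 ^ (2 * n + 2) * volume (B ∩ {x | t + δ < u x})) *
        (2 * volume (B ∩ {x | u x ≤ t})) := mul_le_mul' hδ h1
    _ = 2 ^ (2 * n + 3) *
        (volume (B ∩ {x | t + δ < u x}) * volume (B ∩ {x | u x ≤ t})) := by ring
    _ ≤ 2 ^ (2 * n + 3) * (ENNReal.ofReal (2 * s) * (volume B * (2 ^ n *
        (ENNReal.ofReal K / ENNReal.ofReal δ * mδ)))) := by
        exact mul_le_mul' le_rfl ((hlow.trans hP).trans
          (mul_le_mul' le_rfl (mul_le_mul' le_rfl (mul_le_mul' le_rfl hup))))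
    _ = _ := by
        rw [ENNReal.ofReal_mul zero_le_two, ENNReal.ofReal_ofNat, ENNReal.div_eq_inv_mul,
          ENNReal.div_eq_inv_mul]
        ring

/-- If `{u ≤ t}` occupies half of a ball of radius `s` in which the average of `u` is at least
`lam ≥ 2 t`, then `s ^ (n - 1)` is controlled by the mass of the gradient of `u` in the ball. -/
lemma ofReal_pow_le_of_average (hn : 2 ≤ n) (hum : Measurable u)
    (hu : LocallyIntegrable u volume) (hv : ∀ k, IsWeakPartialDeriv u k (v k)) {lam t s : ℝ}
    {y : Rn n} (hlam : 0 < lam) (ht : t ≤ lam / 2) (hs : 0 < s)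
    (h1 : volume (Metric.closedBall y s) ≤ 2 * volume (Metric.closedBall y s ∩ {x | u x ≤ t}))
    (h2 : lam ≤ ⨍ x in Metric.closedBall y s, u x) :
    ENNReal.ofReal (s ^ (n - 1)) ≤ 2 ^ (n + 3) / volume (Metric.ball (0 : Rn n) 1) *
      (gradMeasure v (Metric.closedBall y s) / ENNReal.ofReal lam) := by
  set B := Metric.closedBall y s with hBdef
  have hB : MeasurableSet B := Metric.isClosed_closedBall.measurableSet
  have ha0 : volume B ≠ 0 := (Metric.measure_closedBall_pos volume _ hs).ne'
  have hat : volume B ≠ ∞ := measure_closedBall_lt_top.ne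
  have hP := poincare_comp hu hv (ψ := id) contDiff_id (M := 1) (by simp) y hs.le
  simp only [id, deriv_id, enorm_one, one_mul] at hP
  rw [← hBdef] at hP
  have hL2 : MeasurableSet (B ∩ {x | u x ≤ t}) :=
    hB.inter (measurableSet_le hum measurable_const)
  have hint : IntegrableOn u B := hu.integrableOn_isCompact (isCompact_closedBall _ _)
  have hlow : ENNReal.ofReal (lam / 2) * volume B * volume (B ∩ {x | u x ≤ t})
      ≤ ∫⁻ x in B, ∫⁻ z in B, ‖u x - u z‖ₑ := by
    refine mul_measure_le_setLIntegral hL2 Set.inter_subset_left fun x hx => ?_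
    have hux : u x ≤ t := hx.2
    refine le_trans ?_ (enorm_integral_le_lintegral_enorm _)
    rw [integral_sub (integrableOn_const (C := u x) hat enorm_ne_top) hint, setIntegral_const,
      smul_eq_mul, ← measure_smul_setAverage u hat, smul_eq_mul, ← mul_sub, ← ofReal_norm, norm_mul,
      ENNReal.ofReal_mul (norm_nonneg _), mul_comm]
    gcongr
    · rw [Real.norm_of_nonneg measureReal_nonneg, ofReal_measureReal hat]
    · rw [Real.norm_eq_abs, abs_sub_comm]
      refine le_trans ?_ (le_abs_self _)
      linarith
  refine ofReal_pow_le_of_volume_mul_le hn hs (y := y) ?_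
  have hl0 : ENNReal.ofReal (lam / 2) ≠ 0 := by simpa using hlam
  have hg : ∫⁻ x in B, ‖∑ k, |v k x|‖ₑ = gradMeasure v B := by
    rw [gradMeasure, withDensity_apply _ hB]
  rw [hg] at hP
  have hX := hlow.trans hP
  have e : ENNReal.ofReal lam = 2 * ENNReal.ofReal (lam / 2) := by
    rw [← ENNReal.ofReal_ofNat, ← ENNReal.ofReal_mul zero_le_two]; congr 1; ring
  set l := ENNReal.ofReal (lam / 2) with hl
  have hlt : l ≠ ∞ := ENNReal.ofReal_ne_top
  rw [← ENNReal.mul_le_mul_iff_right hl0 hlt]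
  have h22 : (2 : ℝ≥0∞)⁻¹ * 2 = 1 := ENNReal.inv_mul_cancel two_ne_zero ENNReal.ofNat_ne_top
  calc l * (volume B * volume B) ≤ l * (volume B * (2 * volume (B ∩ {x | u x ≤ t}))) := by gcongr
    _ = 2 * (l * volume B * volume (B ∩ {x | u x ≤ t})) := by ring
    _ ≤ 2 * (ENNReal.ofReal (2 * s) * (volume B * (2 ^ n * gradMeasure v B))) := by gcongr
    _ = (l * l⁻¹) * (2⁻¹ * 2) * (2 * (ENNReal.ofReal (2 * s) *
          (volume B * (2 ^ n * gradMeasure v B)))) := by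
        rw [ENNReal.mul_inv_cancel hl0 hlt, h22, one_mul, one_mul]
    _ = _ := by
        rw [e, ENNReal.ofReal_mul zero_le_two, ENNReal.ofReal_ofNat, ENNReal.div_eq_inv_mul,
          ENNReal.mul_inv (Or.inl two_ne_zero) (Or.inl ENNReal.ofNat_ne_top)]
        ring

end Boxing

lemma volume_closedBall_le_pow_mul {n : ℕ} {x y : Rn n} {r s : ℝ} (hs : 0 ≤ s) {k : ℕ}
    (h : r ≤ 2 ^ k * s) :
    volume (Metric.closedBall x r) ≤ 2 ^ (k * n) * volume (Metric.closedBall y s) := by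
  have h2 : volume (Metric.closedBall x r) ≤ volume (Metric.closedBall x (2 ^ k * s)) :=
    measure_mono (Metric.closedBall_subset_closedBall h)
  refine h2.trans (le_of_eq ?_)
  rw [Measure.addHaar_closedBall _ _ (by positivity), Measure.addHaar_closedBall _ _ hs, mul_pow,
    finrank_euclideanSpace_fin, ENNReal.ofReal_mul (by positivity), ← pow_mul, mul_assoc]
  congr 1
  rw [ENNReal.ofReal_pow zero_le_two, ENNReal.ofReal_ofNat]

/-- There is a level `t` near which a finite measure `μ` gives little mass to the thin layers
`{t < u ≤ t + δ}`. -/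
lemma exists_level {n : ℕ} {u : Rn n → ℝ} (hum : Measurable u) {μ : Measure (Rn n)}
    {lam J : ℝ} (hlam : 0 < lam) {W : Set (Rn n)} (hW : MeasurableSet W) (hJ0 : 0 < J)
    (hJ : μ W < ENNReal.ofReal J) :
    ∃ t, lam / 4 ≤ t ∧ t < lam / 2 ∧ ∃ᶠ δ in 𝓝[>] (0 : ℝ),
      μ (W ∩ {x | t < u x ∧ u x ≤ t + δ}) ≤ ENNReal.ofReal (4 * J / lam * δ) := by
  have hWt : μ W ≠ ∞ := hJ.ne_top
  have hfin : ∀ A, μ (W ∩ A) ≠ ∞ := fun A =>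
    ne_top_of_le_ne_top hWt (measure_mono Set.inter_subset_left)
  have hmeas : ∀ t δ : ℝ, MeasurableSet (W ∩ {x | t < u x ∧ u x ≤ t + δ}) := fun t δ =>
    hW.inter ((measurableSet_lt measurable_const hum).inter
      (measurableSet_le hum measurable_const))
  set F : ℝ → ℝ := fun t => μ.real (W ∩ {x | u x ≤ t}) with hF
  have hFmono : Monotone F := by
    intro a b hab
    refine measureReal_mono (Set.inter_subset_inter_right _ ?_) (hfin _)
    exact fun x (hx : u x ≤ a) => hx.trans hab
  have hFdiff : ∀ t δ : ℝ, 0 < δ →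
      F (t + δ) = F t + μ.real (W ∩ {x | t < u x ∧ u x ≤ t + δ}) := by
    intro t δ hδ
    have hdisj : Disjoint (W ∩ {x | u x ≤ t}) (W ∩ {x | t < u x ∧ u x ≤ t + δ}) := by
      rw [Set.disjoint_left]
      rintro x ⟨_, h1⟩ ⟨_, h2⟩
      have h1 : u x ≤ t := h1
      have h2 : t < u x := h2.1
      linarith
    simp only [hF]
    rw [← measureReal_union hdisj (hmeas t δ) (hfin _) (hfin _)]
    congr 1
    ext x
    simp only [Set.mem_inter_iff, Set.mem_union, Set.mem_ofPred_eq]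
    constructor
    · rintro ⟨h1, h2⟩
      rcases le_or_gt (u x) t with h | h
      · exact Or.inl ⟨h1, h⟩
      · exact Or.inr ⟨h1, h, h2⟩
    · rintro (⟨h1, h2⟩ | ⟨h1, h2, h3⟩)
      · exact ⟨h1, by linarith⟩
      · exact ⟨h1, h3⟩
  obtain ⟨t, ht1, ht2, hfreq⟩ := exists_frequently_sub_le hFmono (a := lam / 4) (b := lam / 2)
    (K := 4 * J / lam) (by linarith) (by
      have h1 : F (lam / 2) ≤ μ.real W := measureReal_mono Set.inter_subset_left hWt
      have h2 : 0 ≤ F (lam / 4) := measureReal_nonneg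
      have h3 : μ.real W < J := by
        rw [Measure.real, ← ENNReal.toReal_ofReal hJ0.le]
        exact (ENNReal.toReal_lt_toReal hWt ENNReal.ofReal_ne_top).2 hJ
      have h4 : 4 * J / lam * (lam / 2 - lam / 4) = J := by field_simp; ring
      rw [h4]
      linarith)
  refine ⟨t, ht1, ht2, (hfreq.and_eventually self_mem_nhdsWithin).mono ?_⟩
  rintro δ ⟨hδF, hδ0⟩
  rw [hFdiff t δ hδ0, add_sub_cancel_left] at hδF
  rw [← ENNReal.ofReal_toReal (hfin _)]
  exact ENNReal.ofReal_le_ofReal hδF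

section Boxing

variable {n : ℕ}

/-- A point `y` near which the averages of `u` are at least `lam`, while `{u > t}` is sparse at the
scale `R`, is the centre of a ball whose `s ^ (n - 1)` is controlled by the mass of the gradient of
`u` in the ball. Going down from the scale `R`, either `{u > t}` starts to occupy a definite portion
of a ball around `y`, and the relative isoperimetric inequality for `{u > t}` applies, or it never
does, and the Poincaré inequality applies at any scale with a large average. -/
lemma exists_radius (hn : 2 ≤ n) :
    ∃ C : ℝ≥0∞, C ≠ ∞ ∧ ∀ (u : Rn n → ℝ) (v : Fin n → Rn n → ℝ), Measurable u →
      LocallyIntegrable u volume → (∀ k, IsWeakPartialDeriv u k (v k)) →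
      ∀ (lam t R : ℝ) (y : Rn n), 0 < lam → t ≤ lam / 2 → 0 < R →
        2 ^ (n + 1) * volume (Metric.closedBall y R ∩ {x | t < u x})
          ≤ volume (Metric.closedBall y R) →
        (∃ᶠ s in 𝓝[>] (0 : ℝ), lam ≤ ⨍ x in Metric.closedBall y s, u x) →
        ∃ s, 0 < s ∧ s ≤ R ∧ ∀ᶠ δ in 𝓝[>] (0 : ℝ), ENNReal.ofReal (s ^ (n - 1)) ≤
          C * (gradMeasure v (Metric.closedBall y s) / ENNReal.ofReal lam +
            gradMeasure v (Metric.closedBall y s ∩ {x | t < u x ∧ u x ≤ t + δ})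
              / ENNReal.ofReal δ) := by
  obtain ⟨K, hK0, hK⟩ := exists_abs_deriv_smoothTransition_le
  set ω := volume (Metric.ball (0 : Rn n) 1) with hω
  have hω0 : ω ≠ 0 := (Metric.measure_ball_pos volume _ one_pos).ne'
  set C1 := ENNReal.ofReal K * 2 ^ (3 * n + 4) / ω with hC1
  set C2 := 2 ^ (n + 3) / ω with hC2
  refine ⟨C1 + C2, ENNReal.add_ne_top.2 ⟨ENNReal.div_ne_top
    (ENNReal.mul_ne_top ENNReal.ofReal_ne_top (by simp)) hω0,
    ENNReal.div_ne_top (by simp) hω0⟩, ?_⟩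
  intro u v hum hu hv lam t R y hlam ht hR hdens hfreq
  have hhalf : ∀ s : ℝ, 2 * volume (Metric.closedBall y s ∩ {x | t < u x})
      ≤ volume (Metric.closedBall y s) →
      volume (Metric.closedBall y s) ≤ 2 * volume (Metric.closedBall y s ∩ {x | u x ≤ t}) := by
    intro s h
    set B := Metric.closedBall y s
    have hsplit : volume (B ∩ {x | u x ≤ t}) + volume (B ∩ {x | t < u x}) = volume B := by
      rw [← measure_inter_add_sdiff B (measurableSet_le hum measurable_const : MeasurableSet
        {x | u x ≤ t})]
      congr 2
      ext x; simp
    have hfin : volume (B ∩ {x | t < u x}) ≠ ∞ :=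
      ne_top_of_le_ne_top (measure_closedBall_lt_top (x := y) (r := s)).ne
        (measure_mono Set.inter_subset_left)
    have : volume (B ∩ {x | t < u x}) ≤ volume (B ∩ {x | u x ≤ t}) := by
      rw [← hsplit, two_mul] at h
      exact (ENNReal.add_le_add_iff_right hfin).1 h
    calc volume B = volume (B ∩ {x | u x ≤ t}) + volume (B ∩ {x | t < u x}) := hsplit.symm
      _ ≤ volume (B ∩ {x | u x ≤ t}) + volume (B ∩ {x | u x ≤ t}) := by gcongr
      _ = _ := (two_mul _).symm
  by_cases hall : ∀ k : ℕ, 2 ^ (n + 1) * volume (Metric.closedBall y (R / 2 ^ k) ∩ {x | t < u x})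
      ≤ volume (Metric.closedBall y (R / 2 ^ k))
  · -- `{u > t}` is sparse at all scales
    obtain ⟨s, hs, hsR, hs0⟩ := (hfreq.and_eventually
      ((eventually_nhdsWithin_of_eventually_nhds (eventually_lt_nhds hR)).and
        self_mem_nhdsWithin)).exists
    have hs0 : 0 < s := hs0
    obtain ⟨k, hk1, hk2⟩ : ∃ k : ℕ, R / 2 ^ (k + 1) < s ∧ s ≤ R / 2 ^ k := by
      have hex : ∃ k : ℕ, R / 2 ^ k < s := by
        obtain ⟨k, hk⟩ := pow_unbounded_of_one_lt (R / s) one_lt_two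
        exact ⟨k, by rw [div_lt_iff₀ (by positivity)]; rwa [div_lt_iff₀' hs0] at hk⟩
      classical
      have h0 : Nat.find hex ≠ 0 := by
        intro h
        have := Nat.find_spec hex
        rw [h] at this
        simp at this
        linarith
      refine ⟨Nat.find hex - 1, ?_, ?_⟩
      · rw [Nat.sub_add_cancel (Nat.one_le_iff_ne_zero.2 h0)]
        exact Nat.find_spec hex
      · exact not_lt.1 (Nat.find_min hex (by omega))
    refine ⟨s, hs0, hsR.le, ?_⟩
    have hd : 2 * volume (Metric.closedBall y s ∩ {x | t < u x})
        ≤ volume (Metric.closedBall y s) := by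
      have h1 := hall k
      have h2 : volume (Metric.closedBall y (R / 2 ^ k))
          ≤ 2 ^ (1 * n) * volume (Metric.closedBall y s) := by
        refine volume_closedBall_le_pow_mul hs0.le ?_
        rw [pow_succ, ← div_div, div_lt_iff₀ two_pos] at hk1
        linarith
      have h3 : volume (Metric.closedBall y s ∩ {x | t < u x})
          ≤ volume (Metric.closedBall y (R / 2 ^ k) ∩ {x | t < u x}) := by
        gcongr
      have h4 : 2 ^ n * (2 * volume (Metric.closedBall y s ∩ {x | t < u x}))
          ≤ 2 ^ n * volume (Metric.closedBall y s) := by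
        calc _ = 2 ^ (n + 1) * volume (Metric.closedBall y s ∩ {x | t < u x}) := by ring
          _ ≤ 2 ^ (n + 1) * volume (Metric.closedBall y (R / 2 ^ k) ∩ {x | t < u x}) := by gcongr
          _ ≤ _ := h1.trans (by simpa using h2)
      rwa [ENNReal.mul_le_mul_iff_right (by simp) (by simp)] at h4
    have := ofReal_pow_le_of_average hn hum hu hv hlam ht hs0 (hhalf s hd) hs
    refine Eventually.of_forall fun δ => this.trans ?_
    gcongr
    · exact le_add_self
    · exact le_self_add
  · -- `{u > t}` is not sparse at some first scale
    push Not at hall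
    classical
    have h0 : Nat.find hall ≠ 0 := by
      intro h
      have := Nat.find_spec hall
      rw [h] at this
      simp only [pow_zero, div_one] at this
      exact absurd hdens (not_le.2 this)
    obtain ⟨k, hk⟩ : ∃ k, Nat.find hall = k + 1 := ⟨_, (Nat.succ_pred_eq_of_ne_zero h0).symm⟩
    have hspec := Nat.find_spec hall
    rw [hk] at hspec
    have hmin : 2 ^ (n + 1) * volume (Metric.closedBall y (R / 2 ^ k) ∩ {x | t < u x})
      ≤ volume (Metric.closedBall y (R / 2 ^ k)) := not_lt.1 (Nat.find_min hall (by omega))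
    have hs0 : 0 < R / 2 ^ k := by positivity
    refine ⟨R / 2 ^ k, hs0, div_le_self hR.le (one_le_pow₀ one_le_two), ?_⟩
    have hd : 2 * volume (Metric.closedBall y (R / 2 ^ k) ∩ {x | t < u x})
        ≤ volume (Metric.closedBall y (R / 2 ^ k)) := by
      refine le_trans ?_ hmin
      gcongr
      exact le_self_pow₀ one_le_two (by omega)
    have hd2 : volume (Metric.closedBall y (R / 2 ^ k)) ≤ 2 ^ (2 * n + 1) *
        volume (Metric.closedBall y (R / 2 ^ k) ∩ {x | t < u x}) := by
      have hsub : R / 2 ^ (k + 1) ≤ R / 2 ^ k := by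
        gcongr
        · exact one_le_two
        · omega
      calc volume (Metric.closedBall y (R / 2 ^ k))
          ≤ 2 ^ (1 * n) * volume (Metric.closedBall y (R / 2 ^ (k + 1))) := by
            refine volume_closedBall_le_pow_mul (by positivity) (le_of_eq ?_)
            field_simp
            ring
        _ ≤ 2 ^ (1 * n) * (2 ^ (n + 1) *
              volume (Metric.closedBall y (R / 2 ^ (k + 1)) ∩ {x | t < u x})) := by
            gcongr
        _ ≤ 2 ^ (1 * n) * (2 ^ (n + 1) *
              volume (Metric.closedBall y (R / 2 ^ k) ∩ {x | t < u x})) := by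
            gcongr 2 ^ (1 * n) * (2 ^ (n + 1) * volume (?_ ∩ _))
            exact Metric.closedBall_subset_closedBall hsub
        _ = _ := by ring
    filter_upwards [eventually_ofReal_pow_le_of_density hn hum hu hv hK hs0
      (hhalf _ hd) hd2] with δ hδ
    refine hδ.trans ?_
    gcongr
    · exact le_self_add
    · exact le_add_self

/-- A boxing inequality: the set of points `E` near which averages of `u` reach `lam`, while `u`
is small at the fixed scale `R`, has a ball cover whose sum of `s ^ (n - 1)` is at most
`C / lam` times the mass of the gradient. -/
theorem exists_boxing (hn : 2 ≤ n) :
    ∃ C : ℝ≥0∞, C ≠ ∞ ∧ ∀ (u : Rn n → ℝ) (v : Fin n → Rn n → ℝ), Measurable u →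
      LocallyIntegrable u volume → (∀ k, IsWeakPartialDeriv u k (v k)) →
      ∀ (lam R J : ℝ) (E W : Set (Rn n)), 0 < lam → 0 < R →
        MeasurableSet W → (∀ y ∈ E, Metric.closedBall y R ⊆ W) →
        gradMeasure v W < ENNReal.ofReal J →
        (∀ y ∈ E, 2 ^ (n + 1) * ∫⁻ x in Metric.closedBall y R, ‖u x‖ₑ
          ≤ ENNReal.ofReal (lam / 4) * volume (Metric.closedBall y R)) →
        (∀ y ∈ E, ∃ᶠ s in 𝓝[>] (0 : ℝ), lam ≤ ⨍ x in Metric.closedBall y s, u x) →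
        ∃ (T : Set (Rn n)) (s : Rn n → ℝ), T.Countable ∧ T ⊆ E ∧ (∀ y ∈ T, 0 < s y ∧ s y ≤ R) ∧
          E ⊆ ⋃ y ∈ T, Metric.closedBall y (5 * s y) ∧
          ∑' y : T, ENNReal.ofReal (s y ^ (n - 1))
            ≤ C * (ENNReal.ofReal J / ENNReal.ofReal lam) := by
  obtain ⟨C, hC, hmain⟩ := exists_radius hn
  refine ⟨5 * C, ENNReal.mul_ne_top (by simp) hC, ?_⟩
  intro u v hum hu hv lam R J E W hlam hR hW hEW hJ hEu hEfreq
  set μ := gradMeasure v with hμ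
  have hJ0 : 0 < J := by
    rw [← ENNReal.ofReal_pos]; exact bot_le.trans_lt hJ
  have hLm : ∀ t δ : ℝ, MeasurableSet {x | t < u x ∧ u x ≤ t + δ} := fun t δ =>
    (measurableSet_lt measurable_const hum).inter (measurableSet_le hum measurable_const)
  obtain ⟨t, ht1, ht2, hfreq⟩ := exists_level hum hlam hW hJ0 hJ
  have hrad : ∀ y ∈ E, ∃ s, 0 < s ∧ s ≤ R ∧ ∀ᶠ δ in 𝓝[>] (0 : ℝ), ENNReal.ofReal (s ^ (n - 1)) ≤
      C * (μ (Metric.closedBall y s) / ENNReal.ofReal lam +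
        μ (Metric.closedBall y s ∩ {x | t < u x ∧ u x ≤ t + δ}) / ENNReal.ofReal δ) := by
    intro y hy
    refine hmain u v hum hu hv lam t R y hlam ht2.le hR ?_ (hEfreq y hy)
    have hl0 : ENNReal.ofReal (lam / 4) ≠ 0 := by simpa using hlam
    have hmk : ENNReal.ofReal (lam / 4) * volume (Metric.closedBall y R ∩ {x | t < u x})
        ≤ ∫⁻ x in Metric.closedBall y R, ‖u x‖ₑ := by
      refine mul_measure_le_setLIntegral (Metric.isClosed_closedBall.measurableSet.inter
        (measurableSet_lt measurable_const hum)) Set.inter_subset_left fun x hx => ?_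
      have hx2 : t < u x := hx.2
      rw [← ofReal_norm]
      exact ENNReal.ofReal_le_ofReal ((ht1.trans hx2.le).trans (Real.le_norm_self _))
    rw [← ENNReal.mul_le_mul_iff_right hl0 ENNReal.ofReal_ne_top]
    refine le_trans ?_ (hEu y hy)
    calc _ = 2 ^ (n + 1) * (ENNReal.ofReal (lam / 4) *
          volume (Metric.closedBall y R ∩ {x | t < u x})) := by ring
      _ ≤ _ := by gcongr
  choose! s hs0 hsR hsδ using hrad
  obtain ⟨T, hTE, hTd, hTc⟩ := Vitali.exists_disjoint_subfamily_covering_enlargement_closedBall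
    E (fun y => y) s R hsR 5 (by norm_num)
  have hTcount : T.Countable := by
    refine hTd.countable_of_nonempty_interior fun y hy => ?_
    exact ⟨y, Metric.ball_subset_interior_closedBall (Metric.mem_ball_self (hs0 y (hTE hy)))⟩
  refine ⟨T, s, hTcount, hTE, fun y hy => ⟨hs0 y (hTE hy), hsR y (hTE hy)⟩, ?_, ?_⟩
  · intro y hy
    obtain ⟨z, hz, hyz⟩ := hTc y hy
    exact Set.mem_biUnion hz (hyz (Metric.mem_closedBall_self (hs0 y hy).le))
  rw [ENNReal.tsum_eq_iSup_sum]
  refine iSup_le fun A => ?_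
  have hdisj : ∀ L : Set (Rn n), MeasurableSet L →
      ∑ y ∈ A, μ (Metric.closedBall (y : Rn n) (s y) ∩ L) ≤ μ (W ∩ L) := by
    intro L hL
    rw [← measure_biUnion_finset]
    · refine measure_mono (Set.iUnion₂_subset fun y _ => ?_)
      exact Set.inter_subset_inter_left _ ((Metric.closedBall_subset_closedBall
        (hsR y (hTE y.2))).trans (hEW y (hTE y.2)))
    · intro y _ z _ hyz
      exact (hTd y.2 z.2 (fun h => hyz (Subtype.ext h))).mono
        Set.inter_subset_left Set.inter_subset_left
    · exact fun y _ => Metric.isClosed_closedBall.measurableSet.inter hL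
  have hev : ∀ᶠ δ in 𝓝[>] (0 : ℝ), ∀ y ∈ A, ENNReal.ofReal (s y ^ (n - 1)) ≤
      C * (μ (Metric.closedBall (y : Rn n) (s y)) / ENNReal.ofReal lam +
        μ (Metric.closedBall (y : Rn n) (s y) ∩ {x | t < u x ∧ u x ≤ t + δ})
          / ENNReal.ofReal δ) :=
    (Filter.eventually_all_finset A).2 fun y _ => hsδ y (hTE y.2)
  -- one width `δ` of the layer that serves the finitely many balls of the partial sum
  obtain ⟨δ, hδF, hδ, hδ0⟩ := (hfreq.and_eventually (hev.and self_mem_nhdsWithin)).exists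
  have hδ0 : 0 < δ := hδ0
  have hδt : ENNReal.ofReal δ ≠ 0 := by simpa using hδ0
  have hl0 : ENNReal.ofReal lam ≠ 0 := by simpa using hlam
  have hsum1 : ∑ y ∈ A, μ (Metric.closedBall (y : Rn n) (s y)) ≤ ENNReal.ofReal J := by
    simpa using (hdisj Set.univ MeasurableSet.univ).trans (by simpa using hJ.le)
  have hsum2 : ∑ y ∈ A, μ (Metric.closedBall (y : Rn n) (s y) ∩ {x | t < u x ∧ u x ≤ t + δ})
      ≤ ENNReal.ofReal (4 * J / lam * δ) := by
    exact (hdisj _ (hLm t δ)).trans hδF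
  calc ∑ y ∈ A, ENNReal.ofReal (s y ^ (n - 1))
      ≤ ∑ y ∈ A, C * (μ (Metric.closedBall (y : Rn n) (s y)) / ENNReal.ofReal lam +
        μ (Metric.closedBall (y : Rn n) (s y) ∩ {x | t < u x ∧ u x ≤ t + δ})
          / ENNReal.ofReal δ) := Finset.sum_le_sum hδ
    _ = C * ((∑ y ∈ A, μ (Metric.closedBall (y : Rn n) (s y))) / ENNReal.ofReal lam +
        (∑ y ∈ A, μ (Metric.closedBall (y : Rn n) (s y) ∩ {x | t < u x ∧ u x ≤ t + δ}))
          / ENNReal.ofReal δ) := by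
        simp only [div_eq_mul_inv, Finset.sum_mul, ← Finset.mul_sum, ← Finset.sum_add_distrib]
    _ ≤ C * (ENNReal.ofReal J / ENNReal.ofReal lam +
        ENNReal.ofReal (4 * J / lam * δ) / ENNReal.ofReal δ) := by gcongr
    _ = 5 * C * (ENNReal.ofReal J / ENNReal.ofReal lam) := by
        rw [ENNReal.ofReal_mul (by positivity), ENNReal.mul_div_cancel_right hδt
          ENNReal.ofReal_ne_top, ENNReal.ofReal_div_of_pos hlam, ENNReal.ofReal_mul (by norm_num),
          ENNReal.ofReal_ofNat, ENNReal.div_eq_inv_mul, ENNReal.div_eq_inv_mul]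
        ring

end Boxing

/-! ### Differentiability in the mean -/

lemma IsWeakPartialDeriv.sub_contDiff {n : ℕ} {u v w : Rn n → ℝ} {k : Fin n}
    (hu : LocallyIntegrable u volume) (h : IsWeakPartialDeriv u k v) (hw : ContDiff ℝ 1 w) :
    IsWeakPartialDeriv (fun x => u x - w x) k
      (fun x => v x - fderiv ℝ w x (EuclideanSpace.single k 1)) := by
  have hdw : Continuous fun x => fderiv ℝ w x (EuclideanSpace.single k 1) :=
    (hw.continuous_fderiv one_ne_zero).clm_apply continuous_const
  refine ⟨h.1.sub hdw.locallyIntegrable, fun φ hφ hφc => ?_⟩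
  have hφ1 : ContDiff ℝ 1 φ := hφ.of_le (by exact_mod_cast le_top)
  have hdφ : Continuous fun x => fderiv ℝ φ x (EuclideanSpace.single k 1) :=
    (hφ1.continuous_fderiv one_ne_zero).clm_apply continuous_const
  have hdφc := hφc.fderiv_apply ℝ (EuclideanSpace.single k (1 : ℝ))
  have i1 : Integrable fun x => u x * fderiv ℝ φ x (EuclideanSpace.single k 1) := by
    simpa [mul_comm] using hu.integrable_smul_left_of_hasCompactSupport hdφ hdφc
  have i2 : Integrable fun x => w x * fderiv ℝ φ x (EuclideanSpace.single k 1) :=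
    (hw.continuous.mul hdφ).integrable_of_hasCompactSupport hdφc.mul_left
  have i3 : Integrable fun x => φ x * v x := by
    simpa using h.1.integrable_smul_left_of_hasCompactSupport hφ.continuous hφc
  have i4 : Integrable fun x => φ x * fderiv ℝ w x (EuclideanSpace.single k 1) :=
    (hφ.continuous.mul hdw).integrable_of_hasCompactSupport hφc.mul_right
  have hi := integral_mul_fderiv_eq_neg_fderiv_mul_of_integrable (μ := volume) (f := w) (g := φ)
    (v := EuclideanSpace.single k (1 : ℝ)) (by simpa only [mul_comm] using i4) i2
    ((hw.continuous.mul hφ.continuous).integrable_of_hasCompactSupport hφc.mul_left)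
    (fun x _ => (hw.differentiable one_ne_zero) x)
    (fun x _ => (hφ1.differentiable one_ne_zero) x)
  simp_rw [sub_mul, mul_sub]
  rw [integral_sub i1 i2, integral_sub i3 i4, h.2 φ hφ hφc, hi]
  simp_rw [mul_comm (fderiv ℝ w _ _)]
  ring

lemma IsWeakPartialDeriv.neg {n : ℕ} {u v : Rn n → ℝ} {k : Fin n}
    (h : IsWeakPartialDeriv u k v) : IsWeakPartialDeriv (fun x => -u x) k (fun x => -v x) := by
  refine ⟨h.1.neg, fun φ hφ hφc => ?_⟩
  simp_rw [neg_mul, mul_neg, integral_neg, h.2 φ hφ hφc]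

/-- The `j`-th component of the remainder `f(z) - f(x) - G(x)(z - x)` of the first order Taylor
expansion of `f` at `x`, as a function of `z`. -/
noncomputable def taylorRem {n : ℕ} (f : Rn n → Rn n) (G : Rn n → Matrix (Fin n) (Fin n) ℝ)
    (x : Rn n) (j : Fin n) (z : Rn n) : ℝ :=
  f z j - (f x j + ∑ k, G x j k * (z k - x k))

lemma contDiff_affine {n : ℕ} (a : ℝ) (c : Fin n → ℝ) (x : Rn n) :
    ContDiff ℝ 1 fun z : Rn n => a + ∑ k, c k * (z k - x k) := by
  fun_prop

lemma fderiv_affine {n : ℕ} (a : ℝ) (c : Fin n → ℝ) (x z : Rn n) (k : Fin n) :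
    fderiv ℝ (fun z : Rn n => a + ∑ k, c k * (z k - x k)) z (EuclideanSpace.single k 1) = c k := by
  have h : ∀ k, HasFDerivAt (fun z : Rn n => c k * (z k - x k))
      (c k • EuclideanSpace.proj (𝕜 := ℝ) k) z := fun k =>
    (((EuclideanSpace.proj (𝕜 := ℝ) (ι := Fin n) k).hasFDerivAt).sub_const (x k)).const_mul (c k)
  have h2 := (HasFDerivAt.fun_sum (u := Finset.univ) fun k _ => h k).const_add a
  rw [h2.fderiv]
  simp

section

variable {n : ℕ} {f : Rn n → Rn n} {G : Rn n → Matrix (Fin n) (Fin n) ℝ}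

lemma locallyIntegrable_coord (hf : LocallyIntegrable f volume) (j : Fin n) :
    LocallyIntegrable (fun x => f x j) volume := by
  intro x
  obtain ⟨s, hs, hi⟩ := hf x
  exact ⟨s, hs, (EuclideanSpace.proj (𝕜 := ℝ) j).integrable_comp hi⟩

lemma locallyIntegrable_taylorRem (hf : LocallyIntegrable f volume) (x : Rn n) (j : Fin n) :
    LocallyIntegrable (taylorRem f G x j) volume :=
  (locallyIntegrable_coord hf j).sub (contDiff_affine _ _ _).continuous.locallyIntegrable

lemma isWeakPartialDeriv_taylorRem (hf : LocallyIntegrable f volume) (hG : IsWeakGradient f G)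
    (x : Rn n) (j k : Fin n) :
    IsWeakPartialDeriv (taylorRem f G x j) k (fun z => G z j k - G x j k) := by
  have := (hG j k).sub_contDiff (locallyIntegrable_coord hf j)
    (contDiff_affine (f x j) (fun k => G x j k) x)
  simp only [fderiv_affine] at this
  exact this

/-- If the mean oscillation of `∇u` vanishes to order `ε` at a point where `u` vanishes in the
mean, then so does the mean of `|u|`, to order `ε` times the radius. -/
lemma lintegral_closedBall_le_of_gradMeasure_le {u : Rn n → ℝ} {v : Fin n → Rn n → ℝ}
    (hu : LocallyIntegrable u volume) (hv : ∀ k, IsWeakPartialDeriv u k (v k)) {x : Rn n}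
    (hx : Tendsto (fun r => (∫⁻ z in Metric.closedBall x r, ‖u z‖ₑ)
      / volume (Metric.closedBall x r)) (𝓝[>] 0) (𝓝 0)) {ε : ℝ≥0∞} {r : ℝ} (hr : 0 < r)
    (hε : ∀ ρ, 0 < ρ → ρ ≤ r →
      gradMeasure v (Metric.closedBall x ρ) ≤ ε * volume (Metric.closedBall x ρ)) :
    ∫⁻ z in Metric.closedBall x r, ‖u z‖ₑ
      ≤ 2 ^ (2 * n + 2) * ε * ENNReal.ofReal r * volume (Metric.closedBall x r) := by
  set I : ℝ → ℝ≥0∞ := fun ρ =>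
    (∫⁻ z in Metric.closedBall x ρ, ‖u z‖ₑ) / volume (Metric.closedBall x ρ) with hI
  have hpos : ∀ ρ, 0 < ρ → volume (Metric.closedBall x ρ) ≠ 0 := fun ρ hρ =>
    (Metric.measure_closedBall_pos volume _ hρ).ne'
  have hfin : ∀ ρ, volume (Metric.closedBall x ρ) ≠ ∞ := fun ρ => measure_closedBall_lt_top.ne
  have hum : AEMeasurable (fun z => ‖u z‖ₑ) volume := hu.aestronglyMeasurable.aemeasurable.enorm
  -- comparison of the means over concentric balls of radii `ρ` and `ρ / 2`
  have hstep : ∀ ρ, 0 < ρ → ρ ≤ r → I ρ ≤ 2 ^ (2 * n + 1) * ε * ENNReal.ofReal ρ + I (ρ / 2) := by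
    intro ρ hρ hρr
    set B := Metric.closedBall x ρ with hB
    set B' := Metric.closedBall x (ρ / 2) with hB'
    have hsub : B' ⊆ B := Metric.closedBall_subset_closedBall (by linarith)
    have hP := poincare_comp hu hv (ψ := id) contDiff_id (M := 1) (by simp) x hρ.le
    simp only [id, deriv_id, enorm_one, one_mul] at hP
    rw [← hB] at hP
    have hg : ∫⁻ x in B, ‖∑ k, |v k x|‖ₑ = gradMeasure v B := by
      rw [gradMeasure, withDensity_apply _ Metric.isClosed_closedBall.measurableSet]
    rw [hg] at hP
    have h1 : volume B' * ∫⁻ z in B, ‖u z‖ₑ ≤ ENNReal.ofReal (2 * ρ) * (volume B *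
        (2 ^ n * (ε * volume B))) + volume B * ∫⁻ w in B', ‖u w‖ₑ := by
      calc volume B' * ∫⁻ z in B, ‖u z‖ₑ = ∫⁻ z in B, ∫⁻ _ in B', ‖u z‖ₑ := by
            simp_rw [setLIntegral_const]
            rw [lintegral_mul_const' _ _ (hfin _), mul_comm]
        _ ≤ ∫⁻ z in B, ((∫⁻ w in B', ‖u z - u w‖ₑ) + ∫⁻ w in B', ‖u w‖ₑ) := by
            refine lintegral_mono fun z => ?_
            rw [← lintegral_add_right' _ hum.restrict]
            refine lintegral_mono fun w => ?_
            simpa using enorm_add_le (u z - u w) (u w)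
        _ = (∫⁻ z in B, ∫⁻ w in B', ‖u z - u w‖ₑ) + volume B * ∫⁻ w in B', ‖u w‖ₑ := by
            rw [lintegral_add_right _ measurable_const, setLIntegral_const, mul_comm (volume B)]
        _ ≤ _ := by
            gcongr
            refine (lintegral_mono fun z => lintegral_mono_set hsub).trans (hP.trans ?_)
            gcongr
            exact hε ρ hρ hρr
    have hvol : volume B ≤ 2 ^ n * volume B' := by
      simpa using volume_closedBall_le_pow_mul (x := x) (y := x) (r := ρ) (s := ρ / 2) (k := 1)
        (by positivity) (by linarith)
    have ha := hpos ρ hρ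
    have ha' := hpos (ρ / 2) (by positivity)
    have hfa := hfin ρ
    have hfa' := hfin (ρ / 2)
    rw [← hB] at ha hfa
    rw [← hB'] at ha' hfa'
    simp only [hI]
    rw [ENNReal.div_le_iff ha hfa, ← ENNReal.mul_le_mul_iff_right ha' hfa']
    refine h1.trans ?_
    rw [add_mul, mul_add]
    gcongr ?_ + ?_
    · calc _ ≤ ENNReal.ofReal (2 * ρ) * ((2 ^ n * volume B') * (2 ^ n * (ε * volume B))) := by
            gcongr
        _ = _ := by
            rw [ENNReal.ofReal_mul zero_le_two, ENNReal.ofReal_ofNat]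
            ring
    · rw [mul_comm (_ / _), ← mul_assoc, mul_comm (volume B'), mul_assoc,
        ENNReal.mul_div_cancel ha' hfa']
  have htel : ∀ k : ℕ, I r ≤ 2 ^ (2 * n + 2) * ε * ENNReal.ofReal (r - r / 2 ^ k)
      + I (r / 2 ^ k) := by
    intro k
    induction k with
    | zero => simp
    | succ k ih =>
      have hk : 0 < r / 2 ^ k := by positivity
      have h := hstep (r / 2 ^ k) hk (div_le_self hr.le (one_le_pow₀ one_le_two))
      have e : r / 2 ^ k / 2 = r / 2 ^ (k + 1) := by rw [pow_succ, div_div]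
      rw [e] at h
      refine ih.trans ((add_le_add le_rfl h).trans (le_of_eq ?_))
      rw [← add_assoc]
      congr 1
      have e2 : r - r / 2 ^ (k + 1) = (r - r / 2 ^ k) + r / 2 ^ (k + 1) := by
        rw [← e]; ring
      have e3 : r / 2 ^ k = 2 * (r / 2 ^ (k + 1)) := by rw [← e]; ring
      rw [e2, ENNReal.ofReal_add (sub_nonneg.2 (div_le_self hr.le (one_le_pow₀ one_le_two)))
        (by positivity), mul_add]
      congr 1
      rw [e3, ENNReal.ofReal_mul zero_le_two, ENNReal.ofReal_ofNat]
      ring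
  have hlim : Tendsto (fun k : ℕ => 2 ^ (2 * n + 2) * ε * ENNReal.ofReal r + I (r / 2 ^ k)) atTop
      (𝓝 (2 ^ (2 * n + 2) * ε * ENNReal.ofReal r + 0)) := by
    refine tendsto_const_nhds.add (hx.comp ?_)
    refine tendsto_nhdsWithin_iff.2 ⟨?_, Eventually.of_forall fun k => ?_⟩
    · have := (tendsto_pow_atTop_nhds_zero_of_lt_one (r := (1 / 2 : ℝ)) (by norm_num)
        (by norm_num)).const_mul r
      simpa [div_eq_mul_inv] using this
    · exact show (0 : ℝ) < r / 2 ^ k by positivity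
  have hI : I r ≤ 2 ^ (2 * n + 2) * ε * ENNReal.ofReal r := by
    have := ge_of_tendsto' hlim fun k => (htel k).trans (by
      gcongr
      have : 0 ≤ r / 2 ^ k := by positivity
      linarith)
    simpa using this
  exact (ENNReal.div_le_iff (hpos r hr) (hfin r)).1 hI

/-- The property that `x` is a Lebesgue point of `G` and a point of differentiability of `f` in the
mean, with derivative `G x`. -/
structure IsGoodPoint (f : Rn n → Rn n) (G : Rn n → Matrix (Fin n) (Fin n) ℝ) (x : Rn n) :
    Prop where
  gradMeasure_le : ∀ j, ∀ ε : ℝ, 0 < ε → ∀ᶠ r in 𝓝[>] (0 : ℝ),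
    gradMeasure (fun k z => G z j k - G x j k) (Metric.closedBall x r)
      ≤ ENNReal.ofReal ε * volume (Metric.closedBall x r)
  taylorRem_le : ∀ j, ∀ ε : ℝ, 0 < ε → ∀ᶠ r in 𝓝[>] (0 : ℝ),
    ∫⁻ z in Metric.closedBall x r, ‖taylorRem f G x j z‖ₑ
      ≤ ENNReal.ofReal (ε * r) * volume (Metric.closedBall x r)

/-- Almost every point is good, by the Lebesgue differentiation theorem for `f` and `G` and the
Poincaré inequality. -/
lemma ae_isGoodPoint (hf : LocallyIntegrable f volume) (hG : IsWeakGradient f G) :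
    ∀ᵐ x, IsGoodPoint f G x := by
  have h1 : ∀ᵐ x, ∀ j, Tendsto (fun r => (∫⁻ z in Metric.closedBall x r, ‖f z j - f x j‖ₑ)
      / volume (Metric.closedBall x r)) (𝓝[>] 0) (𝓝 0) := by
    refine ae_all_iff.2 fun j => ?_
    filter_upwards [(Besicovitch.vitaliFamily volume).ae_tendsto_lintegral_enorm_sub_div
      (locallyIntegrable_coord hf j)] with x hx
    exact hx.comp (Besicovitch.tendsto_filterAt volume x)
  have h2 : ∀ᵐ x, ∀ j k, Tendsto (fun r => (∫⁻ z in Metric.closedBall x r, ‖G z j k - G x j k‖ₑ)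
      / volume (Metric.closedBall x r)) (𝓝[>] 0) (𝓝 0) := by
    refine ae_all_iff.2 fun j => ae_all_iff.2 fun k => ?_
    filter_upwards [(Besicovitch.vitaliFamily volume).ae_tendsto_lintegral_enorm_sub_div
      (hG j k).1] with x hx
    exact hx.comp (Besicovitch.tendsto_filterAt volume x)
  filter_upwards [h1, h2] with x hx1 hx2
  have hgrad : ∀ j, ∀ ε : ℝ, 0 < ε → ∀ᶠ r in 𝓝[>] (0 : ℝ),
      gradMeasure (fun k z => G z j k - G x j k) (Metric.closedBall x r)
        ≤ ENNReal.ofReal ε * volume (Metric.closedBall x r) := by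
    intro j ε hε
    have hsum : Tendsto (fun r => ∑ k, (∫⁻ z in Metric.closedBall x r, ‖G z j k - G x j k‖ₑ)
        / volume (Metric.closedBall x r)) (𝓝[>] 0) (𝓝 0) := by
      simpa using tendsto_finsetSum Finset.univ fun k _ => hx2 j k
    filter_upwards [hsum.eventually (ge_mem_nhds (ENNReal.ofReal_pos.2 hε)),
      self_mem_nhdsWithin] with r hr hr0
    have hr0 : 0 < r := hr0
    have hpos : volume (Metric.closedBall x r) ≠ 0 :=
      (Metric.measure_closedBall_pos volume _ hr0).ne'
    rw [← ENNReal.div_le_iff hpos measure_closedBall_lt_top.ne]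
    refine le_trans ?_ hr
    simp_rw [div_eq_mul_inv, ← Finset.sum_mul]
    gcongr
    rw [gradMeasure, withDensity_apply _ Metric.isClosed_closedBall.measurableSet,
      ← lintegral_finsetSum']
    · refine lintegral_mono fun z => ?_
      refine (enorm_sum_le _ _).trans (le_of_eq ?_)
      simp
    · intro k _
      exact ((hG j k).1.aestronglyMeasurable.aemeasurable.sub_const _).enorm.restrict
  refine ⟨hgrad, fun j ε hε => ?_⟩
  have hc : 0 < ε / 2 ^ (2 * n + 2) := by positivity
  obtain ⟨r0, hr0, hsub⟩ := mem_nhdsGT_iff_exists_Ioo_subset.1 (hgrad j _ hc)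
  have hr0 : 0 < r0 := hr0
  have hrem : Tendsto (fun r => (∫⁻ z in Metric.closedBall x r, ‖taylorRem f G x j z‖ₑ)
      / volume (Metric.closedBall x r)) (𝓝[>] 0) (𝓝 0) := by
    set L := ∑ k, |G x j k| with hL
    have hlin : ∀ r : ℝ, 0 < r → (∫⁻ z in Metric.closedBall x r, ‖taylorRem f G x j z‖ₑ)
        / volume (Metric.closedBall x r) ≤ (∫⁻ z in Metric.closedBall x r, ‖f z j - f x j‖ₑ)
          / volume (Metric.closedBall x r) + ENNReal.ofReal (L * r) := by
      intro r hr
      have hpos : volume (Metric.closedBall x r) ≠ 0 :=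
        (Metric.measure_closedBall_pos volume _ hr).ne'
      rw [ENNReal.div_le_iff hpos measure_closedBall_lt_top.ne, add_mul,
        ENNReal.div_mul_cancel hpos measure_closedBall_lt_top.ne, ← setLIntegral_const,
        ← lintegral_add_right _ measurable_const]
      refine setLIntegral_mono' Metric.isClosed_closedBall.measurableSet fun z hz => ?_
      have e : taylorRem f G x j z = (f z j - f x j) + -∑ k, G x j k * (z k - x k) := by
        rw [taylorRem]; ring
      rw [e]
      refine (enorm_add_le _ _).trans ?_
      gcongr
      rw [enorm_neg, ← ofReal_norm]
      refine ENNReal.ofReal_le_ofReal ((norm_sum_le _ _).trans ?_)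
      rw [hL, Finset.sum_mul]
      refine Finset.sum_le_sum fun k _ => ?_
      rw [norm_mul, Real.norm_eq_abs]
      gcongr
      have h3 := PiLp.norm_apply_le (z - x) k
      rw [← dist_eq_norm z x] at h3
      exact h3.trans hz
    have hlim : Tendsto (fun r => (∫⁻ z in Metric.closedBall x r, ‖f z j - f x j‖ₑ)
          / volume (Metric.closedBall x r) + ENNReal.ofReal (L * r)) (𝓝[>] 0) (𝓝 0) := by
      have : Tendsto (fun r : ℝ => ENNReal.ofReal (L * r)) (𝓝[>] 0) (𝓝 0) := by
        have h4 : Tendsto (fun r : ℝ => ENNReal.ofReal (L * r)) (𝓝 0)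
            (𝓝 (ENNReal.ofReal (L * 0))) :=
          ENNReal.tendsto_ofReal (tendsto_id.const_mul L)
        simpa using h4.mono_left nhdsWithin_le_nhds
      simpa using (hx1 j).add this
    refine tendsto_of_tendsto_of_tendsto_of_le_of_le' tendsto_const_nhds hlim
      (Eventually.of_forall fun _ => zero_le) ?_
    filter_upwards [self_mem_nhdsWithin] with r hr using hlin r hr
  filter_upwards [Ioo_mem_nhdsGT hr0] with r hr
  have := lintegral_closedBall_le_of_gradMeasure_le (locallyIntegrable_taylorRem hf x j)
    (fun k => isWeakPartialDeriv_taylorRem hf hG x j k) hrem hr.1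
    (fun ρ hρ hρr => hsub ⟨hρ, hρr.trans_lt hr.2⟩)
  refine this.trans (le_of_eq ?_)
  congr 1
  have e : (2 : ℝ≥0∞) ^ (2 * n + 2) = ENNReal.ofReal (2 ^ (2 * n + 2)) := by
    rw [ENNReal.ofReal_pow zero_le_two, ENNReal.ofReal_ofNat]
  rw [e, ← ENNReal.ofReal_mul (by positivity), ← ENNReal.ofReal_mul (by positivity)]
  congr 1
  field_simp

end

/-! ### Fine neighbourhoods that avoid a thin family of balls -/

/-- The measure that puts the mass `s ^ (n - 1)` at the centre of each ball of radius `s` of a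
family of balls. -/
noncomputable def ballMeasure {n : ℕ} {ι : Type} (c : ι → Rn n) (s : ι → ℝ) : Measure (Rn n) :=
  Measure.sum fun i => ENNReal.ofReal (s i ^ (n - 1)) • Measure.dirac (c i)

section

variable {n : ℕ} {ι : Type} {c : ι → Rn n} {s : ι → ℝ}

lemma ballMeasure_apply {A : Set (Rn n)} (hA : MeasurableSet A) :
    ballMeasure c s A = ∑' i : {i // c i ∈ A}, ENNReal.ofReal (s i ^ (n - 1)) := by
  rw [ballMeasure, Measure.sum_apply _ hA]
  refine Eq.trans ?_ (tsum_subtype (c ⁻¹' A) fun i => ENNReal.ofReal (s i ^ (n - 1))).symm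
  refine tsum_congr fun i => ?_
  rw [Measure.smul_apply, Measure.dirac_apply' _ hA]
  by_cases h : c i ∈ A
  · rw [Set.indicator_of_mem h, Set.indicator_of_mem (show i ∈ c ⁻¹' A from h)]
    simp
  · rw [Set.indicator_of_notMem h, Set.indicator_of_notMem (show i ∉ c ⁻¹' A from h)]
    simp

/-- The family of balls is thin at `y`: the radii `s` of the balls with centre in `B(y, r)` satisfy
`∑ s ^ (n - 1) = o(r ^ (n - 1))`. -/
def IsThinFamilyAt (c : ι → Rn n) (s : ι → ℝ) (y : Rn n) : Prop :=
  ∀ ε : ℝ, 0 < ε → ∀ᶠ r in 𝓝[>] (0 : ℝ),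
    ballMeasure c s (Metric.closedBall y r) ≤ ENNReal.ofReal (ε * r ^ (n - 1))

lemma tendsto_mul_nhdsGT_zero {a : ℝ} (ha : 0 < a) :
    Tendsto (fun r : ℝ => a * r) (𝓝[>] 0) (𝓝[>] 0) := by
  refine tendsto_nhdsWithin_iff.2 ⟨?_, ?_⟩
  · have : Tendsto (fun r : ℝ => a * r) (𝓝 0) (𝓝 (a * 0)) := tendsto_id.const_mul a
    rw [mul_zero] at this
    exact this.mono_left nhdsWithin_le_nhds
  · filter_upwards [self_mem_nhdsWithin] with r hr
    have hr : 0 < r := hr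
    exact show 0 < a * r by positivity

lemma ofReal_mul_pow {a r : ℝ} (ha : 0 ≤ a) (m : ℕ) :
    ENNReal.ofReal ((a * r) ^ m) = ENNReal.ofReal (a ^ m) * ENNReal.ofReal (r ^ m) := by
  rw [mul_pow, ENNReal.ofReal_mul (by positivity)]

/-- Points that lie in infinitely many of the enlarged balls form a set of zero content. -/
lemma hasBallCover_limsup [Countable ι] (hs : ∀ i, 0 < s i ∧ s i ≤ 1 / 4)
    (hsum : ∑' i, ENNReal.ofReal (s i ^ (n - 1)) ≠ ∞) {ε : ℝ≥0∞} (hε : 0 < ε) :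
    HasBallCover {y | {i | y ∈ Metric.ball (c i) (4 * s i)}.Infinite} ε := by
  have h1 := ENNReal.Tendsto.const_mul (a := ENNReal.ofReal (4 ^ (n - 1)))
    (ENNReal.tendsto_tsum_compl_atTop_zero hsum) (Or.inr ENNReal.ofReal_ne_top)
  rw [mul_zero] at h1
  obtain ⟨F, hF⟩ := (h1.eventually (ge_mem_nhds hε)).exists
  refine ⟨{i // i ∉ F}, inferInstance, fun i => c i, fun i => 4 * s i, fun i => ?_, ?_, ?_⟩
  · have := hs i
    constructor <;> linarith
  · intro y hy
    obtain ⟨i, hi, hiF⟩ := Set.Infinite.exists_notMem_finset (s :=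
      {i | y ∈ Metric.ball (c i) (4 * s i)}) hy F
    exact Set.mem_iUnion.2 ⟨⟨i, hiF⟩, hi⟩
  · refine le_trans (le_of_eq ?_) hF
    rw [← ENNReal.tsum_mul_left]
    exact tsum_congr fun i => ofReal_mul_pow (by norm_num) _

/-- Points outside all centres at which the family of balls is not thin form a set of zero
content. -/
lemma hasBallCover_not_thin [Countable ι]
    (hsum : ∑' i, ENNReal.ofReal (s i ^ (n - 1)) ≠ ∞) {ε : ℝ≥0∞} (hε : 0 < ε) :
    HasBallCover {y | (∀ i, y ≠ c i) ∧ ¬ IsThinFamilyAt c s y} ε := by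
  set ν := ballMeasure c s with hν
  -- quantitative version for a fixed lower density
  have key : ∀ (m : ℕ) (ε : ℝ≥0∞), 0 < ε → HasBallCover {y | (∀ i, y ≠ c i) ∧
      ∃ᶠ r in 𝓝[>] (0 : ℝ), ENNReal.ofReal (r ^ (n - 1)) ≤ (m + 1) * ν (Metric.closedBall y r)}
      ε := by
    intro m ε hε
    set N := {y | (∀ i, y ≠ c i) ∧
      ∃ᶠ r in 𝓝[>] (0 : ℝ), ENNReal.ofReal (r ^ (n - 1)) ≤ (m + 1) * ν (Metric.closedBall y r)}
    have h1 := ENNReal.Tendsto.const_mul (a := ENNReal.ofReal (6 ^ (n - 1)) * (m + 1))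
      (ENNReal.tendsto_tsum_compl_atTop_zero hsum)
      (Or.inr (ENNReal.mul_ne_top ENNReal.ofReal_ne_top (by finiteness)))
    rw [mul_zero] at h1
    obtain ⟨F, hF⟩ := (h1.eventually (ge_mem_nhds hε)).exists
    set P : Set (Rn n) := c '' F with hP
    have hPfin : P.Finite := F.finite_toSet.image c
    have hPm : MeasurableSet Pᶜ := hPfin.measurableSet.compl
    have htail : ν Pᶜ ≤ ∑' i : {i // i ∉ F}, ENNReal.ofReal (s i ^ (n - 1)) := by
      rw [hν, ballMeasure_apply hPm]
      refine ENNReal.tsum_comp_le_tsum_of_injective (f := fun i : {i // c i ∈ Pᶜ} =>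
        (⟨i.1, fun hi => i.2 ⟨i.1, hi, rfl⟩⟩ : {i // i ∉ F})) (fun a b hab => ?_)
        fun i : {i // i ∉ F} => ENNReal.ofReal (s i ^ (n - 1))
      simp only [Subtype.mk.injEq] at hab
      exact Subtype.ext hab
    have hr : ∀ y ∈ N, ∃ r, 0 < r ∧ r ≤ 1 / 6 ∧
        ENNReal.ofReal (r ^ (n - 1)) ≤ (m + 1) * ν (Metric.closedBall y r ∩ Pᶜ) := by
      rintro y ⟨hy1, hy2⟩
      have hyP : y ∈ Pᶜ := by
        rintro ⟨i, _, hi⟩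
        exact hy1 i hi.symm
      obtain ⟨ρ, hρ, hρP⟩ := Metric.isOpen_iff.1 hPfin.isClosed.isOpen_compl y hyP
      have hev : ∀ᶠ r in 𝓝[>] (0 : ℝ), r < ρ ∧ r < 1 / 6 ∧ 0 < r := by
        filter_upwards [Ioo_mem_nhdsGT hρ, Ioo_mem_nhdsGT (show (0 : ℝ) < 1 / 6 by norm_num)]
          with r h1 h2 using ⟨h1.2, h2.2, h1.1⟩
      obtain ⟨r, h, hr1, hr2, hr3⟩ := (hy2.and_eventually hev).exists
      refine ⟨r, hr3, hr2.le, ?_⟩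
      rwa [Set.inter_eq_left.2 ((Metric.closedBall_subset_ball hr1).trans hρP)]
    choose! r hr0 hr1 hrν using hr
    obtain ⟨T, hTN, hTd, hTc⟩ := Vitali.exists_disjoint_subfamily_covering_enlargement_closedBall
      N (fun y => y) r (1 / 6) hr1 5 (by norm_num)
    have hTcount : T.Countable := by
      refine hTd.countable_of_nonempty_interior fun y hy => ?_
      exact ⟨y, Metric.ball_subset_interior_closedBall (Metric.mem_ball_self (hr0 y (hTN hy)))⟩
    refine ⟨T, hTcount.to_subtype, fun y => y, fun y => 6 * r y, fun y => ?_, ?_, ?_⟩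
    · have h0 := hr0 y (hTN y.2)
      have h1 := hr1 y (hTN y.2)
      constructor <;> linarith
    · intro y hy
      obtain ⟨z, hz, hyz⟩ := hTc y hy
      refine Set.mem_iUnion.2 ⟨⟨z, hz⟩, ?_⟩
      have h0 := hr0 z (hTN hz)
      exact Metric.closedBall_subset_ball (by simp only; linarith)
        (hyz (Metric.mem_closedBall_self (hr0 y hy).le))
    · refine le_trans ?_ hF
      calc ∑' y : T, ENNReal.ofReal ((6 * r y) ^ (n - 1))
          = ENNReal.ofReal (6 ^ (n - 1)) * ∑' y : T, ENNReal.ofReal (r y ^ (n - 1)) := by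
            rw [← ENNReal.tsum_mul_left]
            exact tsum_congr fun y => ofReal_mul_pow (by norm_num) _
        _ ≤ ENNReal.ofReal (6 ^ (n - 1)) * ∑' y : T, (m + 1) *
              ν (Metric.closedBall (y : Rn n) (r y) ∩ Pᶜ) := by
            gcongr with y
            exact hrν y (hTN y.2)
        _ = ENNReal.ofReal (6 ^ (n - 1)) * ((m + 1) *
              ν (⋃ y ∈ T, Metric.closedBall (y : Rn n) (r y) ∩ Pᶜ)) := by
            rw [ENNReal.tsum_mul_left, measure_biUnion hTcount]
            · intro y hy z hz hyz
              exact (hTd hy hz hyz).mono Set.inter_subset_left Set.inter_subset_left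
            · exact fun y _ => Metric.isClosed_closedBall.measurableSet.inter hPm
        _ ≤ ENNReal.ofReal (6 ^ (n - 1)) * ((m + 1) * ν Pᶜ) := by
            gcongr
            exact Set.iUnion₂_subset fun y _ => Set.inter_subset_right
        _ ≤ _ := by
            rw [mul_assoc]
            gcongr
  obtain ⟨δ, hδ0, hδ⟩ := ENNReal.exists_pos_sum_of_countable' hε.ne' ℕ
  refine (HasBallCover.iUnion fun m : ℕ => key m (δ m) (hδ0 m)).mono ?_ hδ.le
  rintro y ⟨hy1, hy2⟩
  simp only [IsThinFamilyAt, not_forall] at hy2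
  obtain ⟨η, hη, hy2⟩ := hy2
  obtain ⟨m, hm⟩ := exists_nat_one_div_lt hη
  refine Set.mem_iUnion.2 ⟨m, hy1, (Filter.not_eventually.1 hy2).mp ?_⟩
  filter_upwards [self_mem_nhdsWithin] with r hr h
  have hr : 0 < r := hr
  rw [not_le] at h
  have h2 : ENNReal.ofReal (r ^ (n - 1)) ≤ (m + 1) * ENNReal.ofReal (η * r ^ (n - 1)) := by
    rw [show (m : ℝ≥0∞) + 1 = ENNReal.ofReal (m + 1) by
      rw [ENNReal.ofReal_add (by positivity) zero_le_one]; simp,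
      ← ENNReal.ofReal_mul (by positivity)]
    refine ENNReal.ofReal_le_ofReal ?_
    rw [← mul_assoc]
    refine le_mul_of_one_le_left (by positivity) ?_
    rw [div_lt_iff₀ (by positivity)] at hm
    linarith
  exact h2.trans (by gcongr)

/-- A family of balls that is thin at `x` and whose members stay away from `x`, relative to their
size, is disjoint from a `1`-finely open neighbourhood of `x`. -/
theorem exists_isFinelyOpen [Countable ι] (hn : 2 ≤ n) (hs : ∀ i, 0 < s i ∧ s i ≤ 1 / 4)
    (hsum : ∑' i, ENNReal.ofReal (s i ^ (n - 1)) ≠ ∞) {x : Rn n}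
    (hx : ∀ i, 4 * s i ≤ dist x (c i)) (hthin : IsThinFamilyAt c s x) :
    ∃ U, IsFinelyOpen U ∧ x ∈ U ∧ ∀ i, Disjoint U (Metric.closedBall (c i) (s i)) := by
  obtain ⟨C, hC, hcap⟩ := exists_cap1_le_of_hasBallCover hn
  -- If a ball of radius `2 s` meets `B(y, r)` and the concentric ball of radius `4 s` does not
  -- contain `y`, then `2 s ≤ r`, and its centre lies in `B(y, 2 r)`. The finitely many other balls
  -- of radius `2 s` stay away from `y ∈ U`.
  set U : Set (Rn n) := {y | (∀ i, 2 * s i < dist y (c i)) ∧ IsThinFamilyAt c s y ∧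
    {i | y ∈ Metric.ball (c i) (4 * s i)}.Finite} with hU
  have hZ : ∀ ε : ℝ≥0∞, 0 < ε → HasBallCover
      ({y | {i | y ∈ Metric.ball (c i) (4 * s i)}.Infinite} ∪
        {y | (∀ i, y ≠ c i) ∧ ¬ IsThinFamilyAt c s y}) ε := by
    intro ε hε
    have h2 : 0 < ε / 2 := ENNReal.half_pos hε.ne'
    have := (hasBallCover_limsup (c := c) hs hsum h2).union
      (hasBallCover_not_thin (c := c) hsum h2)
    rwa [ENNReal.add_halves] at this
  refine ⟨U, fun y hy => ?_, ⟨fun i => ?_, hthin, ?_⟩, fun i => ?_⟩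
  · obtain ⟨hy1, hy2, hy3⟩ := hy
    -- near `y`, the complement of `U` consists of balls with centre near `y` and of a null set
    have hloc : ∀ᶠ r in 𝓝[>] (0 : ℝ), Uᶜ ∩ Metric.ball y r ⊆
        (⋃ i : {i // c i ∈ Metric.closedBall y (2 * r)}, Metric.ball (c i) (3 * s i)) ∪
        ({y | {i | y ∈ Metric.ball (c i) (4 * s i)}.Infinite} ∪
        {y | (∀ i, y ≠ c i) ∧ ¬ IsThinFamilyAt c s y}) := by
      have hfin : ∀ᶠ r in 𝓝[>] (0 : ℝ), ∀ i ∈ {i | y ∈ Metric.ball (c i) (4 * s i)},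
          r < dist y (c i) - 2 * s i := by
        refine (Filter.eventually_all_finite hy3).2 fun i _ => ?_
        exact eventually_nhdsWithin_of_eventually_nhds
          (eventually_lt_nhds (sub_pos.2 (hy1 i)))
      filter_upwards [hfin] with r hr
      rintro z ⟨hzU, hzr⟩
      have hzr : dist z y < r := hzr
      by_cases hzI : {i | z ∈ Metric.ball (c i) (4 * s i)}.Finite
      · by_cases hzD : ∀ i, 2 * s i < dist z (c i)
        · refine Or.inr (Or.inr ⟨fun i hi => ?_, fun ht => hzU ⟨hzD, ht, hzI⟩⟩)
          have := hzD i
          rw [hi, dist_self] at this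
          linarith [(hs i).1]
        · push Not at hzD
          obtain ⟨i, hi⟩ := hzD
          have h1 : dist y (c i) < r + 2 * s i := by
            linarith [dist_triangle_left y (c i) z]
          have h2 : 4 * s i ≤ dist y (c i) := by
            by_contra! h
            linarith [hr i h]
          refine Or.inl (Set.mem_iUnion.2 ⟨⟨i, ?_⟩, ?_⟩)
          · rw [Metric.mem_closedBall, dist_comm]
            linarith
          · rw [Metric.mem_ball]
            linarith [(hs i).1]
      · exact Or.inr (Or.inl hzI)
    rw [IsThinAt, ENNReal.tendsto_nhds_zero]
    intro ε hε
    -- the constant collects the cover constant and the enlargement of the balls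
    set D := C * (ENNReal.ofReal (6 ^ (n - 1)) + 1) with hD
    have hDt : D ≠ ∞ := ENNReal.mul_ne_top hC (by finiteness)
    obtain ⟨η, hη0, hη⟩ : ∃ η : ℝ, 0 < η ∧ D * ENNReal.ofReal η ≤ ε := by
      have h1 : Tendsto (fun η : ℝ => D * ENNReal.ofReal η) (𝓝[>] 0) (𝓝 (D * 0)) := by
        refine ENNReal.Tendsto.const_mul ?_ (Or.inr hDt)
        have := (ENNReal.continuous_ofReal.tendsto 0).mono_left
          (nhdsWithin_le_nhds (s := Set.Ioi (0 : ℝ)))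
        simpa using this
      rw [mul_zero] at h1
      obtain ⟨η, h2, h3⟩ := ((h1.eventually (ge_mem_nhds hε)).and self_mem_nhdsWithin).exists
      exact ⟨η, h3, h2⟩
    filter_upwards [hloc, (tendsto_mul_nhdsGT_zero two_pos).eventually (hy2 η hη0),
      self_mem_nhdsWithin] with r hr1 hr2 hr0
    have hr0 : 0 < r := hr0
    have hrp : 0 < ENNReal.ofReal (r ^ (n - 1)) := ENNReal.ofReal_pos.2 (by positivity)
    have hcov1 : HasBallCover
        (⋃ i : {i // c i ∈ Metric.closedBall y (2 * r)}, Metric.ball (c i) (3 * s i))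
        (ENNReal.ofReal (6 ^ (n - 1)) * ENNReal.ofReal (η * r ^ (n - 1))) := by
      refine ⟨{i // c i ∈ Metric.closedBall y (2 * r)}, inferInstance, fun i => c i,
        fun i => 3 * s i, fun i => ?_, le_rfl, ?_⟩
      · have := hs i
        constructor <;> linarith
      · simp_rw [ofReal_mul_pow (show (0 : ℝ) ≤ 3 by norm_num)]
        rw [ENNReal.tsum_mul_left,
          ← ballMeasure_apply (c := c) (s := s) Metric.isClosed_closedBall.measurableSet]
        refine (mul_le_mul' le_rfl hr2).trans (le_of_eq ?_)
        rw [← ENNReal.ofReal_mul (by positivity), ← ENNReal.ofReal_mul (by positivity)]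
        congr 1
        rw [show (6 : ℝ) = 3 * 2 by norm_num, mul_pow, mul_pow]
        ring
    have hcov := hcov1.union (hZ (ENNReal.ofReal (η * r ^ (n - 1)))
      (ENNReal.ofReal_pos.2 (by positivity)))
    have := hcap _ _ (hcov.mono hr1 le_rfl)
    rw [ENNReal.div_le_iff hrp.ne' ENNReal.ofReal_ne_top]
    refine this.trans ?_
    calc _ = D * ENNReal.ofReal η * ENNReal.ofReal (r ^ (n - 1)) := by
          rw [hD, ENNReal.ofReal_mul hη0.le]
          ring
      _ ≤ _ := by gcongr
  · linarith [hx i, (hs i).1]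
  · convert Set.finite_empty
    ext i
    simp only [Set.mem_ofPred_eq, Set.mem_empty_iff_false, iff_false, Metric.mem_ball, not_lt]
    exact hx i
  · rw [Set.disjoint_left]
    intro y hy hyi
    have h1 := hy.1 i
    have h2 : dist y (c i) ≤ s i := hyi
    linarith [(hs i).1]

end

/-! ### Fine differentiability at almost every point -/

section

variable {n : ℕ}

lemma volume_closedBall_eq_ofReal (x : Rn n) {r : ℝ} (hr : 0 ≤ r) :
    volume (Metric.closedBall x r)
      = ENNReal.ofReal (r ^ n * (volume (Metric.ball (0 : Rn n) 1)).toReal) := by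
  rw [Measure.addHaar_closedBall _ _ hr, finrank_euclideanSpace_fin,
    ENNReal.ofReal_mul (by positivity), ENNReal.ofReal_toReal measure_ball_lt_top.ne]

/-- The boxing inequality in a thin annulus around a point `x` at which `u` and its gradient
vanish in the mean: the points of the annulus near which averages of `u` reach `ε * dist y x` have
a ball cover with `∑ s ^ (n - 1) = o(r ^ (n - 1))`. -/
lemma exists_annulus_cover (hn : 2 ≤ n) {u : Rn n → ℝ} {v : Fin n → Rn n → ℝ} (hum : Measurable u)
    (hu : LocallyIntegrable u volume) (hv : ∀ k, IsWeakPartialDeriv u k (v k)) {x : Rn n}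
    (hg : ∀ η : ℝ, 0 < η → ∀ᶠ r in 𝓝[>] (0 : ℝ), gradMeasure v (Metric.closedBall x r)
      ≤ ENNReal.ofReal η * volume (Metric.closedBall x r))
    (h0 : ∀ η : ℝ, 0 < η → ∀ᶠ r in 𝓝[>] (0 : ℝ), ∫⁻ z in Metric.closedBall x r, ‖u z‖ₑ
      ≤ ENNReal.ofReal (η * r) * volume (Metric.closedBall x r)) {ε : ℝ} (hε : 0 < ε) :
    ∃ b : ℝ → ℝ≥0∞,
      (∀ η : ℝ, 0 < η → ∀ᶠ r in 𝓝[>] (0 : ℝ), b r ≤ ENNReal.ofReal (η * r ^ (n - 1))) ∧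
      ∀ᶠ r in 𝓝[>] (0 : ℝ), ∃ (T : Set (Rn n)) (s : Rn n → ℝ), T.Countable ∧
        (∀ y ∈ T, r / 2 ≤ dist y x ∧ dist y x < r ∧ 0 < s y ∧ s y ≤ r / 64) ∧
        {y | r / 2 ≤ dist y x ∧ dist y x < r ∧ ∃ᶠ s in 𝓝[>] (0 : ℝ),
          ε * dist y x ≤ ⨍ z in Metric.closedBall y s, u z}
            ⊆ ⋃ y ∈ T, Metric.closedBall y (5 * s y) ∧
        ∑' y : T, ENNReal.ofReal (s y ^ (n - 1)) ≤ b r := by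
  obtain ⟨C, hC, hbox⟩ := exists_boxing hn
  set ω := (volume (Metric.ball (0 : Rn n) 1)).toReal with hω
  have hω0 : 0 ≤ ω := ENNReal.toReal_nonneg
  -- `J r` exceeds the mass of the gradient near the annulus, and is still `o(r ^ n)`
  set J : ℝ → ℝ := fun r => (gradMeasure v (Metric.closedBall x (2 * r))).toReal + r ^ (n + 1)
    with hJ
  have hJsmall : ∀ η : ℝ, 0 < η → ∀ᶠ r in 𝓝[>] (0 : ℝ),
      gradMeasure v (Metric.closedBall x (2 * r)) ≠ ∞ ∧ J r ≤ η * r ^ n := by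
    intro η hη
    set η' := η / 2 / (2 ^ n * ω + 1) with hη'
    have hη'0 : 0 < η' := by positivity
    filter_upwards [(tendsto_mul_nhdsGT_zero two_pos).eventually (hg η' hη'0),
      Ioo_mem_nhdsGT (half_pos hη)] with r hr1 hr2
    have hr0 : 0 < r := hr2.1
    rw [volume_closedBall_eq_ofReal _ (by positivity), ← ENNReal.ofReal_mul hη'0.le] at hr1
    refine ⟨ne_top_of_le_ne_top ENNReal.ofReal_ne_top hr1, ?_⟩
    have h1 : (gradMeasure v (Metric.closedBall x (2 * r))).toReal ≤ η' * ((2 * r) ^ n * ω) :=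
      ENNReal.toReal_le_of_le_ofReal (by positivity) hr1
    have h2 : η' * (2 ^ n * ω) ≤ η / 2 := by
      rw [hη', div_mul_eq_mul_div, div_le_iff₀ (by positivity)]
      nlinarith
    have h3 : η' * ((2 * r) ^ n * ω) = η' * (2 ^ n * ω) * r ^ n := by rw [mul_pow]; ring
    have h4 : r ^ (n + 1) ≤ η / 2 * r ^ n := by
      rw [pow_succ, mul_comm]
      exact mul_le_mul_of_nonneg_right hr2.2.le (by positivity)
    have h5 : η' * (2 ^ n * ω) * r ^ n ≤ η / 2 * r ^ n :=
      mul_le_mul_of_nonneg_right h2 (by positivity)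
    simp only [hJ]
    linarith
  refine ⟨fun r => C * (ENNReal.ofReal (J r) / ENNReal.ofReal (ε * r / 2)), fun η hη => ?_, ?_⟩
  · obtain ⟨η', hη', hCη⟩ : ∃ η' : ℝ, 0 < η' ∧ C.toReal * (η' * (2 / ε)) ≤ η := by
      refine ⟨η * ε / 2 / (C.toReal + 1), by positivity, ?_⟩
      have : 0 ≤ C.toReal := ENNReal.toReal_nonneg
      field_simp
      nlinarith
    filter_upwards [hJsmall η' hη', self_mem_nhdsWithin] with r hr hr0
    have hr0 : 0 < r := hr0
    rw [← ENNReal.ofReal_div_of_pos (by positivity), ← ENNReal.ofReal_toReal hC,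
      ← ENNReal.ofReal_mul ENNReal.toReal_nonneg]
    refine ENNReal.ofReal_le_ofReal ?_
    have h1 : J r / (ε * r / 2) ≤ η' * (2 / ε) * r ^ (n - 1) := by
      rw [div_le_iff₀ (by positivity)]
      refine hr.2.trans (le_of_eq ?_)
      obtain ⟨m, rfl⟩ : ∃ m, n = m + 1 := ⟨n - 1, by omega⟩
      simp only [add_tsub_cancel_right]
      field_simp
      ring
    calc C.toReal * (J r / (ε * r / 2)) ≤ C.toReal * (η' * (2 / ε) * r ^ (n - 1)) :=
          mul_le_mul_of_nonneg_left h1 ENNReal.toReal_nonneg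
      _ = C.toReal * (η' * (2 / ε)) * r ^ (n - 1) := by ring
      _ ≤ _ := mul_le_mul_of_nonneg_right hCη (by positivity)
  · set η := ε / 2 ^ (8 * n + 5) with hη
    have hη0 : 0 < η := by positivity
    filter_upwards [hJsmall 1 one_pos, (tendsto_mul_nhdsGT_zero two_pos).eventually (h0 η hη0),
      self_mem_nhdsWithin] with r hr1 hr2 hr0
    have hr0 : 0 < r := hr0
    set E := {y | r / 2 ≤ dist y x ∧ dist y x < r ∧ ∃ᶠ s in 𝓝[>] (0 : ℝ),
          ε * dist y x ≤ ⨍ z in Metric.closedBall y s, u z} with hE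
    have hsub : ∀ y ∈ E, Metric.closedBall y (r / 64) ⊆ Metric.closedBall x (2 * r) := by
      intro y hy
      refine Metric.closedBall_subset_closedBall' ?_
      linarith [hy.2.1]
    have hWJ : gradMeasure v (Metric.closedBall x (2 * r)) < ENNReal.ofReal (J r) := by
      have hp : 0 < r ^ (n + 1) := by positivity
      have hlt : (gradMeasure v (Metric.closedBall x (2 * r))).toReal < J r := by
        simp only [hJ]
        linarith
      rw [← ENNReal.ofReal_toReal hr1.1]
      exact (ENNReal.ofReal_lt_ofReal_iff (ENNReal.toReal_nonneg.trans_lt hlt)).2 hlt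
    have hsparse : ∀ y ∈ E, 2 ^ (n + 1) * ∫⁻ z in Metric.closedBall y (r / 64), ‖u z‖ₑ
        ≤ ENNReal.ofReal (ε * r / 2 / 4) * volume (Metric.closedBall y (r / 64)) := by
      intro y hy
      have hvol : volume (Metric.closedBall x (2 * r))
          ≤ 2 ^ (7 * n) * volume (Metric.closedBall y (r / 64)) :=
        volume_closedBall_le_pow_mul (by positivity) (by
          have h7 : (2 : ℝ) ^ 7 * (r / 64) = 2 * r := by ring
          exact h7.ge)
      calc 2 ^ (n + 1) * ∫⁻ z in Metric.closedBall y (r / 64), ‖u z‖ₑ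
          ≤ 2 ^ (n + 1) * (ENNReal.ofReal (η * (2 * r)) *
              (2 ^ (7 * n) * volume (Metric.closedBall y (r / 64)))) := by
            refine mul_le_mul' le_rfl ((lintegral_mono_set (hsub y hy)).trans (hr2.trans ?_))
            exact mul_le_mul' le_rfl hvol
        _ = 2 ^ (8 * n + 1) * ENNReal.ofReal (η * (2 * r)) *
              volume (Metric.closedBall y (r / 64)) := by ring
        _ = _ := by
            congr 1
            rw [show (2 : ℝ≥0∞) ^ (8 * n + 1) = ENNReal.ofReal (2 ^ (8 * n + 1)) by
              rw [ENNReal.ofReal_pow zero_le_two, ENNReal.ofReal_ofNat],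
              ← ENNReal.ofReal_mul (by positivity), hη]
            congr 1
            field_simp
            ring
    have hfreq : ∀ y ∈ E, ∃ᶠ s in 𝓝[>] (0 : ℝ),
        ε * r / 2 ≤ ⨍ z in Metric.closedBall y s, u z := by
      intro y hy
      refine hy.2.2.mono fun s hs => le_trans ?_ hs
      have := hy.1
      nlinarith
    obtain ⟨T, s, hT, hTE, hs, hcov, hsum⟩ := hbox u v hum hu hv (ε * r / 2) (r / 64) (J r) E
      (Metric.closedBall x (2 * r)) (by positivity) (by positivity)
      Metric.isClosed_closedBall.measurableSet hsub hWJ hsparse hfreq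
    exact ⟨T, s, hT, fun y hy => ⟨(hTE hy).1, (hTE hy).2.1, hs y hy⟩, hcov, hsum⟩

lemma tsum_pow_half_le {r : ℝ} (hr : 0 < r) :
    ∑' k : ℕ, ENNReal.ofReal (if (1 / 2 : ℝ) ^ k ≤ r then (1 / 2) ^ k else 0)
      ≤ ENNReal.ofReal (2 * r) := by
  have hex : ∃ k : ℕ, (1 / 2 : ℝ) ^ k ≤ r := by
    obtain ⟨k, hk⟩ := exists_pow_lt_of_lt_one hr (show (1 / 2 : ℝ) < 1 by norm_num)
    exact ⟨k, hk.le⟩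
  classical
  set m := Nat.find hex with hm
  have hspec : (1 / 2 : ℝ) ^ m ≤ r := Nat.find_spec hex
  rw [← ENNReal.summable.sum_add_tsum_nat_add' (k := m), Finset.sum_eq_zero, zero_add]
  · calc _ ≤ ∑' k : ℕ, ENNReal.ofReal r * 2⁻¹ ^ k := by
          refine ENNReal.tsum_le_tsum fun k => ?_
          have e : (2 : ℝ≥0∞)⁻¹ ^ k = ENNReal.ofReal ((1 / 2) ^ k) := by
            rw [ENNReal.ofReal_pow (by norm_num), one_div, ENNReal.ofReal_inv_of_pos two_pos,
              ENNReal.ofReal_ofNat]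
          rw [e, ← ENNReal.ofReal_mul hr.le]
          refine ENNReal.ofReal_le_ofReal ?_
          split_ifs
          · rw [pow_add, mul_comm]
            gcongr
          · positivity
      _ = ENNReal.ofReal (2 * r) := by
          rw [ENNReal.tsum_mul_left, ENNReal.tsum_geometric, ENNReal.one_sub_inv_two, inv_inv,
            ENNReal.ofReal_mul zero_le_two, ENNReal.ofReal_ofNat, mul_comm]
  · intro k hk
    rw [if_neg (Nat.find_min hex (Finset.mem_range.1 hk)), ENNReal.ofReal_zero]

/-- A union of families of balls in dyadic annuli around `x` is thin at `x` if the sums of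
`s ^ (n - 1)` in the annuli are `o(r ^ (n - 1))`. -/
lemma isThinFamilyAt_sigma (hn : 2 ≤ n) {ι : ℕ → Type} {c : ∀ k, ι k → Rn n} {s : ∀ k, ι k → ℝ}
    {x : Rn n} (hc : ∀ k i, (1 / 2 : ℝ) ^ k / 2 ≤ dist (c k i) x)
    (h1 : ∀ η : ℝ, 0 < η → ∀ᶠ k in atTop, ∑' i, ENNReal.ofReal (s k i ^ (n - 1))
      ≤ ENNReal.ofReal (η * ((1 / 2) ^ k) ^ (n - 1))) :
    IsThinFamilyAt (fun p : Σ k, ι k => c p.1 p.2) (fun p => s p.1 p.2) x := by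
  intro ε hε
  set η := ε / 2 ^ n with hη
  have hη0 : 0 < η := by positivity
  obtain ⟨K, hK⟩ := eventually_atTop.1 (h1 η hη0)
  have hK0 : (0 : ℝ) < (1 / 2) ^ K / 2 := by positivity
  filter_upwards [Ioo_mem_nhdsGT hK0] with r hr
  have hr0 : 0 < r := hr.1
  rw [ballMeasure_apply Metric.isClosed_closedBall.measurableSet]
  calc ∑' p : {p : Σ k, ι k // c p.1 p.2 ∈ Metric.closedBall x r},
        ENNReal.ofReal (s p.1.1 p.1.2 ^ (n - 1))
      = ∑' p : Σ k, ι k, Set.indicator {p : Σ k, ι k | c p.1 p.2 ∈ Metric.closedBall x r}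
          (fun p => ENNReal.ofReal (s p.1 p.2 ^ (n - 1))) p :=
        tsum_subtype {p : Σ k, ι k | c p.1 p.2 ∈ Metric.closedBall x r}
          fun p => ENNReal.ofReal (s p.1 p.2 ^ (n - 1))
    _ = ∑' k, ∑' i, Set.indicator {p : Σ k, ι k | c p.1 p.2 ∈ Metric.closedBall x r}
          (fun p => ENNReal.ofReal (s p.1 p.2 ^ (n - 1))) ⟨k, i⟩ := ENNReal.tsum_sigma' _
    _ ≤ ∑' k : ℕ, ENNReal.ofReal (η * (2 * r) ^ (n - 2)) *
          ENNReal.ofReal (if (1 / 2 : ℝ) ^ k ≤ 2 * r then (1 / 2) ^ k else 0) := by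
        refine ENNReal.tsum_le_tsum fun k => ?_
        split_ifs with hk
        · have hkK : K ≤ k := by
            by_contra! h
            have : (1 / 2 : ℝ) ^ K ≤ (1 / 2) ^ k :=
              pow_le_pow_of_le_one (by norm_num) (by norm_num) h.le
            linarith [hr.2]
          have hle : ∀ i, Set.indicator {p : Σ k, ι k | c p.1 p.2 ∈ Metric.closedBall x r}
              (fun p => ENNReal.ofReal (s p.1 p.2 ^ (n - 1))) ⟨k, i⟩
                ≤ ENNReal.ofReal (s k i ^ (n - 1)) := fun i =>
            Set.indicator_le_self {p : Σ k, ι k | c p.1 p.2 ∈ Metric.closedBall x r}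
              (fun p : Σ k, ι k => ENNReal.ofReal (s p.1 p.2 ^ (n - 1))) ⟨k, i⟩
          refine (ENNReal.tsum_le_tsum hle).trans ((hK k hkK).trans ?_)
          rw [← ENNReal.ofReal_mul (by positivity)]
          refine ENNReal.ofReal_le_ofReal ?_
          rw [show n - 1 = (n - 2) + 1 by omega, pow_succ, ← mul_assoc]
          gcongr
        · rw [ENNReal.ofReal_zero, mul_zero, nonpos_iff_eq_zero, ENNReal.tsum_eq_zero]
          intro i
          refine Set.indicator_of_notMem (fun h => hk ?_) _
          have h2 : dist (c k i) x ≤ r := h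
          linarith [hc k i]
    _ ≤ ENNReal.ofReal (η * (2 * r) ^ (n - 2)) * ENNReal.ofReal (2 * (2 * r)) := by
        rw [ENNReal.tsum_mul_left]
        gcongr
        exact tsum_pow_half_le (by positivity)
    _ = ENNReal.ofReal (ε * r ^ (n - 1)) := by
        rw [← ENNReal.ofReal_mul (by positivity)]
        congr 1
        obtain ⟨m, rfl⟩ : ∃ m, n = m + 2 := ⟨n - 2, by omega⟩
        rw [hη, show m + 2 - 1 = m + 1 by omega, show m + 2 - 2 = m by omega]
        field_simp
        ring

end

section

variable {n : ℕ}

lemma tendsto_pow_half_nhdsGT_zero : Tendsto (fun k : ℕ => (1 / 2 : ℝ) ^ k) atTop (𝓝[>] 0) :=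
  tendsto_nhdsWithin_iff.2 ⟨tendsto_pow_atTop_nhds_zero_of_lt_one (by norm_num) (by norm_num),
    Eventually.of_forall fun k => show (0 : ℝ) < (1 / 2) ^ k by positivity⟩

/-- If finitely many functions vanish in the mean at `x` to first order, and their gradients to
zeroth order, then on a fine neighbourhood of `x` all averages over small balls around `y` are
below `ε * dist y x`. -/
theorem exists_isFinelyOpen_average_lt (hn : 2 ≤ n) {P : Type} [Fintype P] {u : P → Rn n → ℝ}
    {v : P → Fin n → Rn n → ℝ} (hum : ∀ p, Measurable (u p))
    (hu : ∀ p, LocallyIntegrable (u p) volume) (hv : ∀ p k, IsWeakPartialDeriv (u p) k (v p k))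
    {x : Rn n} (hg : ∀ p, ∀ η : ℝ, 0 < η → ∀ᶠ r in 𝓝[>] (0 : ℝ),
      gradMeasure (v p) (Metric.closedBall x r)
        ≤ ENNReal.ofReal η * volume (Metric.closedBall x r))
    (h0 : ∀ p, ∀ η : ℝ, 0 < η → ∀ᶠ r in 𝓝[>] (0 : ℝ), ∫⁻ z in Metric.closedBall x r, ‖u p z‖ₑ
      ≤ ENNReal.ofReal (η * r) * volume (Metric.closedBall x r)) {ε : ℝ} (hε : 0 < ε) :
    ∃ U, IsFinelyOpen U ∧ x ∈ U ∧ ∃ r0 : ℝ, 0 < r0 ∧ ∀ y ∈ U, y ≠ x → dist y x < r0 →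
      ∀ p, ∀ᶠ s in 𝓝[>] (0 : ℝ), ⨍ z in Metric.closedBall y s, u p z < ε * dist y x := by
  choose b hb hcov using fun p => exists_annulus_cover hn (hum p) (hu p) (hv p) (hg p) (h0 p) hε
  have hbsum : ∀ η : ℝ, 0 < η → ∀ᶠ k : ℕ in atTop,
      ∑ p, ENNReal.ofReal (5 ^ (n - 1)) * b p ((1 / 2) ^ k)
        ≤ ENNReal.ofReal (η * ((1 / 2) ^ k) ^ (n - 1)) := by
    intro η hη
    set η' := η / (5 ^ (n - 1) * (Fintype.card P + 1)) with hη'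
    have hη'0 : 0 < η' := by positivity
    have h1 := tendsto_pow_half_nhdsGT_zero.eventually (eventually_all.2 fun p => hb p η' hη'0)
    filter_upwards [h1] with k hk
    calc ∑ p, ENNReal.ofReal (5 ^ (n - 1)) * b p ((1 / 2) ^ k)
        ≤ ∑ p : P, ENNReal.ofReal (5 ^ (n - 1) * (η' * ((1 / 2) ^ k) ^ (n - 1))) := by
          refine Finset.sum_le_sum fun p _ => ?_
          rw [ENNReal.ofReal_mul (by positivity)]
          exact mul_le_mul' le_rfl (hk p)
      _ = ENNReal.ofReal (Fintype.card P * (5 ^ (n - 1) * (η' * ((1 / 2) ^ k) ^ (n - 1)))) := by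
          rw [Finset.sum_const, Finset.card_univ, nsmul_eq_mul,
            ENNReal.ofReal_mul (p := (Fintype.card P : ℝ)) (by positivity),
            ENNReal.ofReal_natCast]
      _ ≤ _ := by
          refine ENNReal.ofReal_le_ofReal ?_
          have e : Fintype.card P * (5 ^ (n - 1) * (η' * ((1 / 2 : ℝ) ^ k) ^ (n - 1)))
              = (Fintype.card P / (Fintype.card P + 1)) * (η * ((1 / 2 : ℝ) ^ k) ^ (n - 1)) := by
            rw [hη']
            field_simp
          rw [e]
          refine mul_le_of_le_one_left (by positivity) ?_
          rw [div_le_one (by positivity)]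
          linarith
  obtain ⟨k0, hk0⟩ := eventually_atTop.1 ((hbsum 1 one_pos).and
    (tendsto_pow_half_nhdsGT_zero.eventually (eventually_all.2 hcov)))
  set E : ℕ → P → Set (Rn n) := fun k p => {y | (1 / 2 : ℝ) ^ k / 2 ≤ dist y x ∧
    dist y x < (1 / 2) ^ k ∧ ∃ᶠ s in 𝓝[>] (0 : ℝ), ε * dist y x
      ≤ ⨍ z in Metric.closedBall y s, u p z} with hE
  -- no balls are taken in the first `k0` annuli
  have hfam : ∀ k p, ∃ (T : Set (Rn n)) (s : Rn n → ℝ), T.Countable ∧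
      (∀ y ∈ T, (1 / 2 : ℝ) ^ k / 2 ≤ dist y x ∧ 0 < s y ∧ s y ≤ (1 / 2) ^ k / 64) ∧
      (k0 ≤ k → E k p ⊆ ⋃ y ∈ T, Metric.closedBall y (5 * s y)) ∧
      ∑' y : T, ENNReal.ofReal (s y ^ (n - 1)) ≤ if k0 ≤ k then b p ((1 / 2) ^ k) else 0 := by
    intro k p
    by_cases hk : k0 ≤ k
    · obtain ⟨T, s, hT, hTs, hc, hsum⟩ := (hk0 k hk).2 p
      refine ⟨T, s, hT, fun y hy => ⟨(hTs y hy).1, (hTs y hy).2.2⟩, fun _ => hc, ?_⟩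
      rwa [if_pos hk]
    · exact ⟨∅, fun _ => 0, Set.countable_empty, by simp, fun h => absurd h hk, by simp⟩
  choose T s hT hTs hTc hsum using hfam
  have hcount : ∀ k p, Countable (T k p) := fun k p => (hT k p).to_subtype
  have hsumk : ∀ k, ∑' i : Σ p, T k p, ENNReal.ofReal ((5 * s k i.1 i.2) ^ (n - 1))
      ≤ if k0 ≤ k then ∑ p, ENNReal.ofReal (5 ^ (n - 1)) * b p ((1 / 2) ^ k) else 0 := by
    intro k
    rw [ENNReal.tsum_sigma', tsum_fintype]
    have h1 : ∀ p, ∑' y : T k p, ENNReal.ofReal ((5 * s k p y) ^ (n - 1))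
        ≤ ENNReal.ofReal (5 ^ (n - 1)) * if k0 ≤ k then b p ((1 / 2) ^ k) else 0 := by
      intro p
      refine le_trans (le_of_eq ?_) (mul_le_mul' le_rfl (hsum k p))
      rw [← ENNReal.tsum_mul_left]
      exact tsum_congr fun y => ofReal_mul_pow (by norm_num) _
    refine (Finset.sum_le_sum fun p _ => h1 p).trans ?_
    split_ifs <;> simp
  have hpow : ∀ k : ℕ, ((1 / 2 : ℝ) ^ k) ≤ 1 := fun k => pow_le_one₀ (by norm_num) (by norm_num)
  obtain ⟨U, hU, hxU, hUd⟩ := exists_isFinelyOpen (ι := Σ k, Σ p, T k p)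
    (c := fun i => (i.2.2 : Rn n)) (s := fun i => 5 * s i.1 i.2.1 i.2.2) (x := x) hn
    (by
      rintro ⟨k, p, y⟩
      have h1 := hTs k p y y.2
      have h2 := hpow k
      simp only
      constructor <;> linarith)
    (by
      rw [ENNReal.tsum_sigma']
      refine ne_top_of_le_ne_top (b := ∑' k : ℕ, (2 : ℝ≥0∞)⁻¹ ^ k) (by
        rw [ENNReal.tsum_geometric, ENNReal.one_sub_inv_two, inv_inv]
        exact ENNReal.ofNat_ne_top) (ENNReal.tsum_le_tsum fun k => (hsumk k).trans ?_)
      split_ifs with hk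
      · refine (hk0 k hk).1.trans ?_
        have e : (2 : ℝ≥0∞)⁻¹ ^ k = ENNReal.ofReal ((1 / 2) ^ k) := by
          rw [ENNReal.ofReal_pow (by norm_num), one_div, ENNReal.ofReal_inv_of_pos two_pos,
            ENNReal.ofReal_ofNat]
        rw [e, one_mul]
        exact ENNReal.ofReal_le_ofReal
          (pow_le_of_le_one (by positivity) (hpow k) (by omega))
      · exact zero_le)
    (by
      rintro ⟨k, p, y⟩
      have h1 := hTs k p y y.2
      have h2 : (0 : ℝ) < (1 / 2) ^ k := by positivity
      simp only
      rw [dist_comm]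
      linarith)
    (isThinFamilyAt_sigma (ι := fun k => Σ p, T k p) (c := fun k i => (i.2 : Rn n))
      (s := fun k i => 5 * s k i.1 i.2) hn (fun k i => (hTs k i.1 i.2 i.2.2).1) fun η hη => by
        filter_upwards [hbsum η hη] with k hk
        refine (hsumk k).trans ?_
        split_ifs
        · exact hk
        · exact zero_le)
  refine ⟨U, hU, hxU, (1 / 2) ^ k0, by positivity, fun y hyU hyx hyr p => ?_⟩
  have hd : 0 < dist y x := dist_pos.2 hyx
  obtain ⟨k, hk1, hk2⟩ : ∃ k : ℕ, (1 / 2 : ℝ) ^ (k + 1) ≤ dist y x ∧ dist y x < (1 / 2) ^ k := by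
    have hex : ∃ m : ℕ, (1 / 2 : ℝ) ^ m ≤ dist y x := by
      obtain ⟨m, hm⟩ := exists_pow_lt_of_lt_one hd (show (1 / 2 : ℝ) < 1 by norm_num)
      exact ⟨m, hm.le⟩
    classical
    have hne : Nat.find hex ≠ 0 := by
      intro h
      have := Nat.find_spec hex
      rw [h, pow_zero] at this
      linarith [hpow k0]
    obtain ⟨k, hk⟩ := Nat.exists_eq_succ_of_ne_zero hne
    refine ⟨k, ?_, ?_⟩
    · have := Nat.find_spec hex
      rwa [hk] at this
    · exact not_le.1 (Nat.find_min hex (m := k) (by omega))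
  have hkk : k0 ≤ k := by
    by_contra! h
    have : (1 / 2 : ℝ) ^ k0 ≤ (1 / 2) ^ (k + 1) :=
      pow_le_pow_of_le_one (by norm_num) (by norm_num) h
    linarith
  by_contra hcon
  have hfr : ∃ᶠ s in 𝓝[>] (0 : ℝ), ε * dist y x ≤ ⨍ z in Metric.closedBall y s, u p z :=
    (Filter.not_eventually.1 hcon).mono fun s hs => not_lt.1 hs
  have hyE : y ∈ E k p := by
    refine Set.mem_ofPred_eq ▸ ⟨?_, hk2, hfr⟩
    rw [pow_succ] at hk1
    linarith
  obtain ⟨z, hz, hyz⟩ := Set.mem_iUnion₂.1 (hTc k p hkk hyE)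
  exact Set.disjoint_left.1 (hUd ⟨k, p, z, hz⟩) hyU hyz

end

section

variable {n : ℕ} {f : Rn n → Rn n} {G : Rn n → Matrix (Fin n) (Fin n) ℝ}

lemma setAverage_ball_eq (u : Rn n → ℝ) (y : Rn n) {s : ℝ} (hs : s ≠ 0) :
    ⨍ z in Metric.ball y s, u z = ⨍ z in Metric.closedBall y s, u z := by
  refine setAverage_congr ?_
  rw [← Metric.ball_union_sphere]
  have h : Metric.sphere y s =ᵐ[volume] (∅ : Set (Rn n)) :=
    ae_eq_empty.2 (Measure.addHaar_sphere_of_ne_zero _ _ hs)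
  simpa using (EventuallyEq.refl (ae volume) (Metric.ball y s)).union h.symm

/-- If the averages of the Taylor remainder over small balls around `y` are at most `δ` in absolute
value, then the precise representative at `y` is finite, and differs from the Taylor polynomial by
at most `δ + η`, for any `η > 0`. -/
lemma exists_preciseRep_eq (hf : LocallyIntegrable f volume) {x y : Rn n} {j : Fin n} {δ η : ℝ}
    (hη : 0 < η) (h : ∀ᶠ s in 𝓝[>] (0 : ℝ),
      |⨍ z in Metric.closedBall y s, taylorRem f G x j z| ≤ δ) :
    ∃ e : ℝ, |e| ≤ δ + η ∧
      preciseRep f y j = ((f x j + ∑ k, G x j k * (y k - x k) + e : ℝ) : EReal) := by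
  set a : Rn n → ℝ := fun z => f x j + ∑ k, G x j k * (z k - x k) with ha
  have hac : Continuous a := (contDiff_affine _ _ _).continuous
  have hnear : ∀ᶠ s in 𝓝[>] (0 : ℝ), ∀ z ∈ Metric.closedBall y s,
      a z ∈ Metric.closedBall (a y) η := by
    obtain ⟨ρ, hρ, hρs⟩ := Metric.continuous_iff.1 hac y η hη
    filter_upwards [Ioo_mem_nhdsGT hρ] with s hs z hz
    exact (hρs z (lt_of_le_of_lt hz hs.2)).le
  have hmain : ∀ᶠ s in 𝓝[>] (0 : ℝ), a y - (δ + η) ≤ ⨍ z in Metric.ball y s, f z j ∧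
      ⨍ z in Metric.ball y s, f z j ≤ a y + (δ + η) := by
    filter_upwards [h, hnear, self_mem_nhdsWithin] with s h1 h2 hs
    have hs : 0 < s := hs
    have hpos : volume (Metric.closedBall y s) ≠ 0 :=
      (Metric.measure_closedBall_pos volume _ hs).ne'
    have i1 : IntegrableOn (taylorRem f G x j) (Metric.closedBall y s) :=
      (locallyIntegrable_taylorRem hf x j).integrableOn_isCompact (isCompact_closedBall y s)
    have i2 : IntegrableOn a (Metric.closedBall y s) :=
      hac.locallyIntegrable.integrableOn_isCompact (isCompact_closedBall y s)
    have h3 : (⨍ z in Metric.closedBall y s, a z) ∈ Metric.closedBall (a y) η := by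
      refine (convex_closedBall (a y) η).set_average_mem Metric.isClosed_closedBall hpos
        measure_closedBall_lt_top.ne ?_ i2
      exact (ae_restrict_iff' Metric.isClosed_closedBall.measurableSet).2 (Eventually.of_forall h2)
    have h4 : ⨍ z in Metric.ball y s, f z j
        = (⨍ z in Metric.closedBall y s, taylorRem f G x j z)
          + ⨍ z in Metric.closedBall y s, a z := by
      rw [setAverage_ball_eq _ _ hs.ne', setAverage_eq, setAverage_eq, setAverage_eq, ← smul_add,
        ← integral_add i1 i2]
      simp [taylorRem, ha]
    rw [Metric.mem_closedBall, Real.dist_eq] at h3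
    rw [h4]
    rw [abs_le] at h1 h3
    constructor <;> linarith
  have hle : preciseRep f y j ≤ ((a y + (δ + η) : ℝ) : EReal) := by
    refine limsup_le_of_le (by isBoundedDefault) ?_
    filter_upwards [hmain] with s hs
    exact EReal.coe_le_coe_iff.2 hs.2
  have hge : ((a y - (δ + η) : ℝ) : EReal) ≤ preciseRep f y j := by
    refine le_limsup_of_frequently_le (Eventually.frequently ?_) (by isBoundedDefault)
    filter_upwards [hmain] with s hs
    exact EReal.coe_le_coe_iff.2 hs.1
  have hfin : ((preciseRep f y j).toReal : EReal) = preciseRep f y j :=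
    EReal.coe_toReal (ne_top_of_le_ne_top (EReal.coe_ne_top _) hle)
      (ne_bot_of_le_ne_bot (EReal.coe_ne_bot _) hge)
  rw [← hfin, EReal.coe_le_coe_iff] at hle hge
  refine ⟨(preciseRep f y j).toReal - a y, ?_, ?_⟩
  · rw [abs_le]
    constructor <;> linarith
  · rw [← hfin]
    simp [ha]

/-- The precise representative of `f` agrees with `f` itself at the good points of `f`. -/
lemma IsGoodPoint.preciseRep_eq (hf : LocallyIntegrable f volume) {x : Rn n}
    (hx : IsGoodPoint f G x) (j : Fin n) : preciseRep f x j = (f x j : EReal) := by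
  have key : ∀ δ : ℝ, 0 < δ → ∃ e : ℝ, |e| ≤ δ ∧ preciseRep f x j = ((f x j + e : ℝ) : EReal) := by
    intro δ hδ
    have h2 : 0 < δ / 2 := by positivity
    have h : ∀ᶠ s in 𝓝[>] (0 : ℝ),
        |⨍ z in Metric.closedBall x s, taylorRem f G x j z| ≤ δ / 2 := by
      filter_upwards [hx.taylorRem_le j (δ / 2) h2, Ioo_mem_nhdsGT one_pos] with s hs hs1
      have hpos : volume (Metric.closedBall x s) ≠ 0 :=
        (Metric.measure_closedBall_pos volume _ hs1.1).ne'
      have hreal : 0 < volume.real (Metric.closedBall x s) :=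
        ENNReal.toReal_pos hpos measure_closedBall_lt_top.ne
      rw [setAverage_eq, smul_eq_mul, abs_mul, abs_inv, abs_of_pos hreal, inv_mul_le_iff₀ hreal]
      have h3 := (enorm_integral_le_lintegral_enorm (μ := volume.restrict (Metric.closedBall x s))
        (taylorRem f G x j)).trans hs
      rw [← ENNReal.ofReal_toReal (measure_closedBall_lt_top (μ := volume) (x := x) (r := s)).ne,
        ← ENNReal.ofReal_mul (by have := hs1.1; positivity), ← ofReal_norm,
        ENNReal.ofReal_le_ofReal_iff (by have := hs1.1; positivity)] at h3
      refine h3.trans ?_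
      change δ / 2 * s * volume.real (Metric.closedBall x s) ≤ _
      rw [mul_comm]
      refine mul_le_mul_of_nonneg_left ?_ hreal.le
      exact mul_le_of_le_one_right h2.le hs1.2.le
    obtain ⟨e, he, heq⟩ := exists_preciseRep_eq hf h2 h
    refine ⟨e, by linarith, ?_⟩
    simpa using heq
  obtain ⟨e, _, he⟩ := key 1 one_pos
  have he0 : e = 0 := by
    refine abs_nonpos_iff.1 (le_of_forall_pos_le_add fun δ hδ => ?_)
    obtain ⟨e', he', h⟩ := key δ hδ
    rw [he, EReal.coe_eq_coe_iff] at h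
    have : e = e' := by linarith
    rw [this, zero_add]
    exact he'
  rw [he, he0, add_zero]

lemma gradMeasure_neg (v : Fin n → Rn n → ℝ) :
    gradMeasure (fun k z => -v k z) = gradMeasure v := by
  simp [gradMeasure]

/-- Fine differentiability: at a good point `x` the precise representative agrees with the Taylor
polynomial up to `ε * dist y x` for all `y` in a fine neighbourhood of `x`. -/
theorem IsGoodPoint.exists_isFinelyOpen (hn : 2 ≤ n) (hfm : Measurable f)
    (hf : LocallyIntegrable f volume) (hG : IsWeakGradient f G) {x : Rn n}
    (hx : IsGoodPoint f G x) {ε : ℝ} (hε : 0 < ε) :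
    ∃ U, IsFinelyOpen U ∧ x ∈ U ∧ ∃ r0 : ℝ, 0 < r0 ∧ ∀ y ∈ U, dist y x < r0 → ∀ j,
      ∃ e : ℝ, |e| ≤ ε * dist y x ∧
        preciseRep f y j = ((f x j + ∑ k, G x j k * (y k - x k) + e : ℝ) : EReal) := by
  have hRm : ∀ j, Measurable (taylorRem f G x j) := fun j => by
    have h1 : Measurable fun z => f z j :=
      (EuclideanSpace.proj (𝕜 := ℝ) j).continuous.measurable.comp hfm
    exact h1.sub (contDiff_affine _ _ _).continuous.measurable
  have hRi := fun j => locallyIntegrable_taylorRem (G := G) hf x j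
  have hRw := fun j k => isWeakPartialDeriv_taylorRem hf hG x j k
  obtain ⟨U, hU, hxU, r0, hr0, h⟩ := exists_isFinelyOpen_average_lt (P := Fin n × Bool) hn
    (u := fun p z => if p.2 then taylorRem f G x p.1 z else -taylorRem f G x p.1 z)
    (v := fun p k z => if p.2 then G z p.1 k - G x p.1 k else -(G z p.1 k - G x p.1 k))
    (by rintro ⟨j, _ | _⟩; exacts [(hRm j).neg, hRm j])
    (by rintro ⟨j, _ | _⟩; exacts [(hRi j).neg, hRi j])
    (by rintro ⟨j, _ | _⟩ k; exacts [(hRw j k).neg, hRw j k]) (x := x)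
    (by
      rintro ⟨j, _ | _⟩ η hη
      · simp only [Bool.false_eq_true, if_false, gradMeasure_neg]
        exact hx.gradMeasure_le j η hη
      · exact hx.gradMeasure_le j η hη)
    (by
      rintro ⟨j, _ | _⟩ η hη
      · simp only [Bool.false_eq_true, if_false, enorm_neg]
        exact hx.taylorRem_le j η hη
      · exact hx.taylorRem_le j η hη) (half_pos hε)
  refine ⟨U, hU, hxU, r0, hr0, fun y hyU hyr j => ?_⟩
  by_cases hyx : y = x
  · refine ⟨0, by simp [hyx], ?_⟩
    rw [hyx, hx.preciseRep_eq hf]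
    simp
  · have hd : 0 < dist y x := dist_pos.2 hyx
    have h1 : ∀ᶠ s in 𝓝[>] (0 : ℝ),
        |⨍ z in Metric.closedBall y s, taylorRem f G x j z| ≤ ε / 2 * dist y x := by
      filter_upwards [h y hyU hyx hyr (j, true), h y hyU hyx hyr (j, false)] with s hs1 hs2
      simp only [if_true] at hs1
      simp only [Bool.false_eq_true, if_false, setAverage_eq, integral_neg, smul_neg] at hs2
      rw [← setAverage_eq] at hs2
      rw [abs_le]
      constructor <;> linarith
    obtain ⟨e, he, heq⟩ := exists_preciseRep_eq hf (η := ε / 2 * dist y x) (by positivity) h1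
    exact ⟨e, by linarith, heq⟩

end

/-! ### A lower bound for the measure of images of balls -/

section

variable {n : ℕ} {f : Rn n → Rn n} {G : Rn n → Matrix (Fin n) (Fin n) ℝ}

lemma abs_sum_mul_sub_le {a : Fin n → ℝ} {ε : ℝ} (ha : ∀ k, |a k| ≤ ε) (w y : Rn n) :
    |∑ k, a k * (w k - y k)| ≤ n * ε * dist w y := by
  refine (Finset.abs_sum_le_sum_abs _ _).trans ?_
  have h : ∀ k ∈ Finset.univ, |a k * (w k - y k)| ≤ ε * dist w y := by
    intro k _
    have h3 := PiLp.norm_apply_le (w - y) k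
    rw [← dist_eq_norm w y] at h3
    rw [abs_mul]
    exact mul_le_mul (ha k) h3 (abs_nonneg _) ((abs_nonneg _).trans (ha k))
  refine (Finset.sum_le_card_nsmul _ _ _ h).trans (le_of_eq ?_)
  simp [mul_assoc]

/-- Comparison of the Taylor polynomials of `f` at two points `y` and `z`, through the means over
`B(y, |y - z|)` and `B(z, 2 |y - z|)`. -/
lemma abs_sub_sub_sum_le (hf : LocallyIntegrable f volume) {y z : Rn n} {j : Fin n}
    (hyz : y ≠ z) {ε : ℝ} (hε : 0 ≤ ε) (hGyz : ∀ k, |G y j k - G z j k| ≤ ε)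
    (hy : ∫⁻ w in Metric.closedBall y (dist y z), ‖taylorRem f G y j w‖ₑ
      ≤ ENNReal.ofReal (ε * dist y z) * volume (Metric.closedBall y (dist y z)))
    (hz : ∫⁻ w in Metric.closedBall z (2 * dist y z), ‖taylorRem f G z j w‖ₑ
      ≤ ENNReal.ofReal (ε * (2 * dist y z)) * volume (Metric.closedBall z (2 * dist y z))) :
    |f y j - f z j - ∑ k, G z j k * (y k - z k)| ≤ (1 + 2 ^ (n + 1) + n) * ε * dist y z := by
  set d := dist y z with hd
  have hd0 : 0 < d := dist_pos.2 hyz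
  set c := f y j - f z j - ∑ k, G z j k * (y k - z k) with hc
  set V := volume (Metric.closedBall y d) with hV
  have hV0 : V ≠ 0 := (Metric.measure_closedBall_pos volume _ hd0).ne'
  have hVt : V ≠ ∞ := measure_closedBall_lt_top.ne
  have hsub : Metric.closedBall y d ⊆ Metric.closedBall z (2 * d) :=
    Metric.closedBall_subset_closedBall' (by rw [← hd]; linarith)
  have hvol : volume (Metric.closedBall z (2 * d)) ≤ 2 ^ n * V := by
    simpa using volume_closedBall_le_pow_mul (x := z) (y := y) (r := 2 * d) (s := d) (k := 1)
      hd0.le (by linarith)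
  have hpt : ∀ w ∈ Metric.closedBall y d, ENNReal.ofReal |c|
      ≤ ‖taylorRem f G y j w‖ₑ + (‖taylorRem f G z j w‖ₑ + ENNReal.ofReal (n * ε * d)) := by
    intro w hw
    have h1 := abs_sum_mul_sub_le hGyz w y
    have h2 : n * ε * dist w y ≤ n * ε * d := mul_le_mul_of_nonneg_left hw (by positivity)
    have e : c = taylorRem f G z j w - taylorRem f G y j w
        - ∑ k, (G y j k - G z j k) * (w k - y k) := by
      have e1 : ∑ k, (G y j k - G z j k) * (w k - y k) = ∑ k, G y j k * (w k - y k)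
          - ∑ k, G z j k * (w k - z k) + ∑ k, G z j k * (y k - z k) := by
        rw [← Finset.sum_sub_distrib, ← Finset.sum_add_distrib]
        exact Finset.sum_congr rfl fun k _ => by ring
      rw [e1, hc, taylorRem, taylorRem]
      ring
    rw [← ofReal_norm, ← ofReal_norm, ← ENNReal.ofReal_add (norm_nonneg _) (by positivity),
      ← ENNReal.ofReal_add (norm_nonneg _) (by positivity)]
    refine ENNReal.ofReal_le_ofReal ?_
    rw [e, Real.norm_eq_abs, Real.norm_eq_abs]
    have h3 := abs_sub (taylorRem f G z j w - taylorRem f G y j w)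
      (∑ k, (G y j k - G z j k) * (w k - y k))
    have h4 := abs_sub (taylorRem f G z j w) (taylorRem f G y j w)
    linarith
  have hint : ENNReal.ofReal |c| * V ≤ ENNReal.ofReal ((1 + 2 ^ (n + 1) + n) * ε * d) * V := by
    calc ENNReal.ofReal |c| * V = ∫⁻ _ in Metric.closedBall y d, ENNReal.ofReal |c| := by
          rw [setLIntegral_const]
      _ ≤ ∫⁻ w in Metric.closedBall y d, (‖taylorRem f G y j w‖ₑ
            + (‖taylorRem f G z j w‖ₑ + ENNReal.ofReal (n * ε * d))) :=
          setLIntegral_mono' Metric.isClosed_closedBall.measurableSet hpt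
      _ = (∫⁻ w in Metric.closedBall y d, ‖taylorRem f G y j w‖ₑ)
            + ((∫⁻ w in Metric.closedBall y d, ‖taylorRem f G z j w‖ₑ)
              + ENNReal.ofReal (n * ε * d) * V) := by
          rw [lintegral_add_left', lintegral_add_right _ measurable_const, setLIntegral_const]
          have hm := (locallyIntegrable_taylorRem (G := G) hf y j).aestronglyMeasurable
          exact hm.aemeasurable.enorm.restrict
      _ ≤ ENNReal.ofReal (ε * d) * V + (ENNReal.ofReal (ε * (2 * d)) * (2 ^ n * V)
            + ENNReal.ofReal (n * ε * d) * V) := by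
          refine add_le_add hy (add_le_add ?_ le_rfl)
          exact (lintegral_mono_set hsub).trans (hz.trans (mul_le_mul' le_rfl hvol))
      _ = _ := by
          rw [← mul_assoc, ← add_mul, ← add_mul, show (2 : ℝ≥0∞) ^ n = ENNReal.ofReal (2 ^ n) by
              rw [ENNReal.ofReal_pow zero_le_two, ENNReal.ofReal_ofNat],
            ← ENNReal.ofReal_mul (by positivity), ← ENNReal.ofReal_add (by positivity)
              (by positivity), ← ENNReal.ofReal_add (by positivity) (by positivity)]
          congr 2
          ring
  rw [mul_comm, mul_comm _ V, ENNReal.mul_le_mul_iff_right hV0 hVt,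
    ENNReal.ofReal_le_ofReal_iff (by positivity)] at hint
  exact hint

/-- The good points at which `G` is `ε`-close to the matrix `B` and at which the mean of the Taylor
remainder is at most `ε * r` at all scales `r < ρ`. -/
def uniformSet (f : Rn n → Rn n) (G : Rn n → Matrix (Fin n) (Fin n) ℝ)
    (B : Fin n → Fin n → ℝ) (ε ρ : ℝ) : Set (Rn n) :=
  {y | IsGoodPoint f G y ∧ (∀ j k, |G y j k - B j k| ≤ ε) ∧ ∀ j, ∀ r, 0 < r → r < ρ →
    ∫⁻ w in Metric.closedBall y r, ‖taylorRem f G y j w‖ₑ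
      ≤ ENNReal.ofReal (ε * r) * volume (Metric.closedBall y r)}

lemma norm_le_of_forall_abs_le {v : Rn n} {a : ℝ} (ha : 0 ≤ a) (h : ∀ j, |v j| ≤ a) :
    ‖v‖ ≤ n * a := by
  rw [EuclideanSpace.norm_eq]
  refine Real.sqrt_le_iff.2 ⟨by positivity, ?_⟩
  have h1 : ∀ j ∈ Finset.univ, ‖v j‖ ^ 2 ≤ a ^ 2 := fun j _ =>
    pow_le_pow_left₀ (norm_nonneg _) (h j) 2
  refine (Finset.sum_le_card_nsmul _ _ _ h1).trans ?_
  rw [Finset.card_univ, Fintype.card_fin, nsmul_eq_mul, mul_pow]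
  have h2 : (n : ℝ) ≤ n ^ 2 := by exact_mod_cast Nat.le_self_pow two_ne_zero n
  gcongr

lemma toEuclideanCLM_apply_coord (A : Matrix (Fin n) (Fin n) ℝ) (v : Rn n) (j : Fin n) :
    (Matrix.toEuclideanCLM (𝕜 := ℝ) A v) j = ∑ k, A j k * v k := by
  rw [show (Matrix.toEuclideanCLM (𝕜 := ℝ) A v) j
    = (Matrix.toEuclideanCLM (𝕜 := ℝ) A v).ofLp j from rfl, Matrix.ofLp_toEuclideanCLM]
  rfl

/-- On small pieces of a set on which the Taylor remainders are uniformly small and `G` varies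
little, `f` is close to its linearization at any point of the set. -/
lemma approximatesLinearOn_uniformSet (hf : LocallyIntegrable f volume) {B : Fin n → Fin n → ℝ}
    {ε ρ r : ℝ} (hε : 0 ≤ ε) (hr : 4 * r < ρ) {x : Rn n} (hx : x ∈ uniformSet f G B ε ρ)
    {δ : NNReal} (hδ : n * ((2 + 2 ^ (n + 2) + 4 * n) * ε) ≤ δ) :
    ApproximatesLinearOn f (Matrix.toEuclideanCLM (𝕜 := ℝ) (G x))
      (uniformSet f G B ε ρ ∩ Metric.ball x r) δ := by
  rintro y ⟨hy, hyr⟩ z ⟨hz, hzr⟩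
  have hyr : dist y x < r := hyr
  have hzr : dist z x < r := hzr
  by_cases hyz : y = z
  · simp [hyz]
  have hd0 : 0 < dist y z := dist_pos.2 hyz
  have hd : dist y z < 2 * r := by linarith [dist_triangle_right y z x]
  have hclose : ∀ {a b}, a ∈ uniformSet f G B ε ρ → b ∈ uniformSet f G B ε ρ →
      ∀ j k, |G a j k - G b j k| ≤ 2 * ε := by
    intro a b ha hb j k
    have h1 := ha.2.1 j k
    have h2 := hb.2.1 j k
    rw [abs_le] at *
    constructor <;> linarith
  have hmul : ∀ s : ℝ, 0 ≤ s → ENNReal.ofReal (ε * s) ≤ ENNReal.ofReal (2 * ε * s) := fun s hs =>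
    ENNReal.ofReal_le_ofReal (by nlinarith [mul_nonneg hε hs])
  have key : ∀ j, |(f y - f z - Matrix.toEuclideanCLM (𝕜 := ℝ) (G x) (y - z)) j|
      ≤ (2 + 2 ^ (n + 2) + 4 * n) * ε * dist y z := by
    intro j
    have h1 := abs_sub_sub_sum_le (G := G) hf hyz (j := j) (ε := 2 * ε) (by positivity)
      (hclose hy hz j)
      ((hy.2.2 j _ hd0 (by linarith)).trans (mul_le_mul' (hmul _ hd0.le) le_rfl))
      ((hz.2.2 j _ (by positivity) (by linarith)).trans
        (mul_le_mul' (hmul _ (by positivity)) le_rfl))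
    have h2 := abs_sum_mul_sub_le (hclose hz hx j) y z
    have e : (f y - f z - Matrix.toEuclideanCLM (𝕜 := ℝ) (G x) (y - z)) j
        = (f y j - f z j - ∑ k, G z j k * (y k - z k))
          + ∑ k, (G z j k - G x j k) * (y k - z k) := by
      simp only [PiLp.sub_apply, toEuclideanCLM_apply_coord, sub_mul, Finset.sum_sub_distrib]
      ring
    rw [e]
    refine (abs_add_le _ _).trans ((add_le_add h1 h2).trans ?_)
    have h3 : (1 + 2 ^ (n + 1) + n) * (2 * ε) * dist y z + n * (2 * ε) * dist y z
        = (2 + 2 ^ (n + 2) + 4 * n) * ε * dist y z := by ring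
    rw [h3]
  refine (norm_le_of_forall_abs_le (by positivity) key).trans ?_
  rw [← dist_eq_norm y z, ← mul_assoc]
  exact mul_le_mul_of_nonneg_right hδ dist_nonneg

/-- On sets of good points the precise representative may be replaced by `f`. -/
lemma measure_image_le_extVolume (hf : LocallyIntegrable f volume) {S : Set (Rn n)}
    (hS : ∀ y ∈ S, IsGoodPoint f G y) : volume (f '' S) ≤ extVolume (preciseRep f '' S) := by
  refine measure_mono ?_
  rintro _ ⟨y, hy, rfl⟩
  refine show (fun i => ((f y i : ℝ) : EReal)) ∈ preciseRep f '' S from ⟨y, hy, ?_⟩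
  exact funext fun j => (hS y hy).preciseRep_eq hf j

lemma det_toEuclideanCLM (A : Matrix (Fin n) (Fin n) ℝ) :
    (Matrix.toEuclideanCLM (𝕜 := ℝ) A : Rn n →L[ℝ] Rn n).det = A.det := by
  rw [ContinuousLinearMap.det, Matrix.coe_toEuclideanCLM_eq_toEuclideanLin,
    Matrix.toEuclideanLin_eq_toLin_orthonormal, LinearMap.det_toLin]

/-- At almost every point, the images of small balls under the precise representative have at least
the measure that the linearization predicts. -/
theorem ae_le_extVolume_image_ball (hf : LocallyIntegrable f volume) (hG : IsWeakGradient f G) :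
    ∀ᵐ x, ∀ m : NNReal, (m : ℝ≥0∞) < ENNReal.ofReal |(G x).det| → ∀ᶠ r in 𝓝[>] (0 : ℝ),
      m * volume (Metric.ball x r) ≤ extVolume (preciseRep f '' Metric.ball x r) := by
  -- almost every point of each of countably many uniform sets, measurable or not, is a point of
  -- outer density of it
  have hdens : ∀ᵐ x, ∀ (B : Fin n → Fin n → ℚ) (p q : ℕ),
      x ∈ uniformSet f G (fun j k => B j k) (1 / (p + 1)) (1 / (q + 1)) →
      Tendsto (fun r => volume (uniformSet f G (fun j k => B j k) (1 / (p + 1)) (1 / (q + 1)) ∩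
        Metric.closedBall x r) / volume (Metric.closedBall x r)) (𝓝[>] 0) (𝓝 1) := by
    refine ae_all_iff.2 fun B => ae_all_iff.2 fun p => ae_all_iff.2 fun q => ?_
    exact ae_imp_of_ae_restrict (Besicovitch.ae_tendsto_measure_inter_div volume _)
  filter_upwards [hdens, ae_isGoodPoint hf hG] with x hxd hxg m hm
  obtain ⟨m', hm1, hm2⟩ := ENNReal.lt_iff_exists_nnreal_btwn.1 hm
  rw [← det_toEuclideanCLM] at hm2
  obtain ⟨δ, hδ, hδ0⟩ :=
    ((mul_le_addHaar_image_of_lt_det volume _ hm2).and self_mem_nhdsWithin).exists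
  have hδ0 : (0 : ℝ) < δ := hδ0
  set K : ℝ := n * (2 + 2 ^ (n + 2) + 4 * n) with hK
  have hK0 : 0 ≤ K := by positivity
  obtain ⟨p, hp⟩ := exists_nat_one_div_lt (show 0 < δ / (K + 1) by positivity)
  have hp0 : (0 : ℝ) < 1 / (p + 1) := by positivity
  choose B hB using fun j k => exists_rat_near (G x j k) hp0
  have hev : ∀ᶠ r in 𝓝[>] (0 : ℝ), ∀ j, ∫⁻ w in Metric.closedBall x r, ‖taylorRem f G x j w‖ₑ
      ≤ ENNReal.ofReal (1 / (p + 1) * r) * volume (Metric.closedBall x r) :=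
    eventually_all.2 fun j => hxg.taylorRem_le j _ hp0
  obtain ⟨ρ, hρ0, hρ⟩ := mem_nhdsGT_iff_exists_Ioo_subset.1 hev
  have hρ0 : 0 < ρ := hρ0
  obtain ⟨q, hq⟩ := exists_nat_one_div_lt hρ0
  have hq0 : (0 : ℝ) < 1 / (q + 1) := by positivity
  set S := uniformSet f G (fun j k => B j k) (1 / (p + 1)) (1 / (q + 1)) with hS
  have hxS : x ∈ S := ⟨hxg, fun j k => (hB j k).le, fun j r hr hrq =>
    hρ ⟨hr, hrq.trans hq⟩ j⟩
  have hlim := hxd B p q hxS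
  have hm0 : (m' : ℝ≥0∞) ≠ 0 := (zero_le.trans_lt hm1).ne'
  have hmm : (m : ℝ≥0∞) / m' < 1 := by
    rw [ENNReal.div_lt_iff (Or.inl hm0) (Or.inl ENNReal.coe_ne_top), one_mul]
    exact hm1
  filter_upwards [hlim.eventually (lt_mem_nhds hmm), Ioo_mem_nhdsGT (div_pos hq0 four_pos)]
    with r hr1 hr2
  have hr0 : 0 < r := hr2.1
  have happ : ApproximatesLinearOn f (Matrix.toEuclideanCLM (𝕜 := ℝ) (G x))
      (S ∩ Metric.ball x r) δ := by
    refine approximatesLinearOn_uniformSet hf hp0.le (by linarith [hr2.2]) hxS ?_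
    rw [← mul_assoc, ← hK]
    have h1 : 1 / ((p : ℝ) + 1) * (K + 1) < δ := (lt_div_iff₀ (by positivity)).1 hp
    nlinarith
  have hball : volume (S ∩ Metric.closedBall x r) ≤ volume (S ∩ Metric.ball x r) := by
    calc volume (S ∩ Metric.closedBall x r)
        ≤ volume (S ∩ Metric.ball x r ∪ Metric.sphere x r) := by
          refine measure_mono ?_
          rintro y ⟨hyS, hy⟩
          rw [← Metric.ball_union_sphere] at hy
          exact hy.imp (fun h => ⟨hyS, h⟩) id
      _ ≤ volume (S ∩ Metric.ball x r) + volume (Metric.sphere x r) := measure_union_le _ _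
      _ = volume (S ∩ Metric.ball x r) := by
          rw [Measure.addHaar_sphere_of_ne_zero _ _ hr0.ne', add_zero]
  have hpos : volume (Metric.closedBall x r) ≠ 0 :=
    (Metric.measure_closedBall_pos volume _ hr0).ne'
  calc m * volume (Metric.ball x r) ≤ m * volume (Metric.closedBall x r) := by
        gcongr
        exact Metric.ball_subset_closedBall
    _ = m' * (m / m' * volume (Metric.closedBall x r)) := by
        rw [← mul_assoc, ENNReal.mul_div_cancel hm0 ENNReal.coe_ne_top]
    _ ≤ m' * volume (S ∩ Metric.closedBall x r) := by
        refine mul_le_mul' le_rfl ?_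
        exact ((ENNReal.lt_div_iff_mul_lt (Or.inl hpos)
          (Or.inl measure_closedBall_lt_top.ne)).1 hr1).le
    _ ≤ m' * volume (S ∩ Metric.ball x r) := mul_le_mul' le_rfl hball
    _ ≤ volume (f '' (S ∩ Metric.ball x r)) := hδ _ _ happ
    _ ≤ extVolume (preciseRep f '' (S ∩ Metric.ball x r)) :=
        measure_image_le_extVolume hf fun y hy => hy.1.1
    _ ≤ extVolume (preciseRep f '' Metric.ball x r) :=
        measure_mono fun y hy => Set.image_mono Set.inter_subset_right hy

end

/-! ### The distortion estimate -/

section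

variable {n : ℕ} {f : Rn n → Rn n} {G : Rn n → Matrix (Fin n) (Fin n) ℝ}

lemma extDist_coe (p q : Rn n) :
    extDist (fun i => ((p i : ℝ) : EReal)) (fun i => ((q i : ℝ) : EReal))
      = ENNReal.ofReal ‖p - q‖ := by
  have h : ∀ i, erealDist ((p i : ℝ) : EReal) ((q i : ℝ) : EReal)
      = ENNReal.ofReal ‖(p - q) i‖ := by
    intro i
    rw [erealDist]
    split_ifs with h
    · rw [EReal.coe_eq_coe_iff] at h
      simp [h]
    · rw [← EReal.coe_sub, EReal.abs_def]
      rfl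
  simp_rw [extDist, h, ← ENNReal.ofReal_pow (norm_nonneg _)]
  rw [← ENNReal.ofReal_sum_of_nonneg (fun _ _ => by positivity),
    ENNReal.ofReal_rpow_of_nonneg (Finset.sum_nonneg fun _ _ => by positivity) (by norm_num),
    EuclideanSpace.norm_eq, Real.sqrt_eq_rpow]

/-- Near a good point, the diameter of the image of a ball in a fine neighbourhood is at most that
of the image of the ball under the linearization, up to an error of first order. -/
lemma IsGoodPoint.exists_extDiam_le (hn : 2 ≤ n) (hfm : Measurable f)
    (hf : LocallyIntegrable f volume) (hG : IsWeakGradient f G) {x : Rn n}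
    (hx : IsGoodPoint f G x) {ε : ℝ} (hε : 0 < ε) :
    ∃ U, IsFinelyOpen U ∧ x ∈ U ∧ ∀ᶠ r in 𝓝[>] (0 : ℝ),
      extDiam (preciseRep f '' (Metric.ball x r ∩ U))
        ≤ ENNReal.ofReal (2 * r * (matrixMaxNorm (G x) + n * ε)) := by
  obtain ⟨U, hU, hxU, r0, hr0, h⟩ := hx.exists_isFinelyOpen hn hfm hf hG hε
  refine ⟨U, hU, hxU, ?_⟩
  filter_upwards [Ioo_mem_nhdsGT hr0] with r hr
  set A := Matrix.toEuclideanCLM (𝕜 := ℝ) (G x) with hA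
  have hpt : ∀ y ∈ Metric.ball x r ∩ U, ∃ p : Rn n, ‖p - (f x + A (y - x))‖ ≤ n * (ε * r) ∧
      preciseRep f y = fun i => ((p i : ℝ) : EReal) := by
    rintro y ⟨hyr, hyU⟩
    have hyr : dist y x < r := hyr
    choose e he heq using h y hyU (hyr.trans hr.2)
    refine ⟨f x + A (y - x) + WithLp.toLp 2 e, ?_, funext fun j => ?_⟩
    · rw [add_sub_cancel_left]
      refine norm_le_of_forall_abs_le (mul_nonneg hε.le hr.1.le) fun j => ?_
      exact (he j).trans (mul_le_mul_of_nonneg_left hyr.le hε.le)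
    · rw [heq j]
      congr 1
  refine iSup₂_le fun p hp => iSup₂_le fun q hq => ?_
  obtain ⟨y, hy, rfl⟩ := hp
  obtain ⟨z, hz, rfl⟩ := hq
  obtain ⟨p, hp, hpe⟩ := hpt y hy
  obtain ⟨q, hq, hqe⟩ := hpt z hz
  rw [hpe, hqe, extDist_coe]
  refine ENNReal.ofReal_le_ofReal ?_
  have hyz : ‖y - z‖ ≤ 2 * r := by
    rw [← dist_eq_norm y z]
    have h1 : dist y x < r := hy.1
    have h2 : dist z x < r := hz.1
    linarith [dist_triangle_right y z x]
  have h1 : ‖A (y - z)‖ ≤ matrixMaxNorm (G x) * (2 * r) :=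
    (A.le_opNorm _).trans (mul_le_mul_of_nonneg_left hyz (norm_nonneg _))
  have e : p - q = (p - (f x + A (y - x))) + A (y - z) - (q - (f x + A (z - x))) := by
    simp only [map_sub]
    abel
  rw [e]
  refine (norm_sub_le _ _).trans ((add_le_add (norm_add_le _ _) le_rfl).trans ?_)
  linarith

/-- The distortion estimate at a good point, given a lower bound for the measure of the images of
balls. For `m ≠ 0` neither convention for `K = ∞` is in force at small radii. -/
lemma IsGoodPoint.fineDistortion_pow_mul_le (hn : 2 ≤ n) (hfm : Measurable f)
    (hf : LocallyIntegrable f volume) (hG : IsWeakGradient f G) {x : Rn n}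
    (hx : IsGoodPoint f G x) {m : NNReal} (hm0 : m ≠ 0) (hm : ∀ᶠ r in 𝓝[>] (0 : ℝ),
      m * volume (Metric.ball x r) ≤ extVolume (preciseRep f '' Metric.ball x r))
    {ε : ℝ} (hε : 0 < ε) :
    fineDistortion (preciseRep f) x ^ (n - 1) * m
      ≤ 2 ^ n / volume (Metric.ball (0 : Rn n) 1)
        * ENNReal.ofReal (matrixMaxNorm (G x) + n * ε) ^ n := by
  obtain ⟨U, hU, hxU, hdiam⟩ := hx.exists_extDiam_le hn hfm hf hG hε
  set ω := volume (Metric.ball (0 : Rn n) 1) with hω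
  have hω0 : ω ≠ 0 := (Metric.measure_ball_pos volume _ one_pos).ne'
  have hωt : ω ≠ ∞ := measure_ball_lt_top.ne
  have hm0' : (m : ℝ≥0∞) ≠ 0 := by exact_mod_cast hm0
  set L := matrixMaxNorm (G x) + n * ε with hL
  set Q : ℝ≥0∞ := 2 ^ n / ω * ENNReal.ofReal L ^ n / m with hQ
  have hn1 : (0 : ℝ) < n - 1 := by
    have : (2 : ℝ) ≤ n := by exact_mod_cast hn
    linarith
  have hdist : ∀ᶠ r in 𝓝[>] (0 : ℝ),
      distortionOn (preciseRep f) U x r ≤ Q ^ (1 / ((n : ℝ) - 1)) := by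
    filter_upwards [hdiam, hm, self_mem_nhdsWithin] with r h1 h2 hr
    have hr : 0 < r := hr
    have hr' : ENNReal.ofReal r ^ n ≠ 0 := pow_ne_zero _ (ENNReal.ofReal_pos.2 hr).ne'
    have hrt : ENNReal.ofReal r ^ n ≠ ∞ := ENNReal.pow_ne_top ENNReal.ofReal_ne_top
    have hvol : volume (Metric.ball x r) = ENNReal.ofReal r ^ n * ω := by
      rw [Measure.addHaar_ball_of_pos _ _ hr, finrank_euclideanSpace_fin,
        ENNReal.ofReal_pow hr.le]
    rw [hvol] at h2
    rw [distortionOn, if_neg]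
    · refine ENNReal.rpow_le_rpow ?_ (by positivity)
      calc _ ≤ ENNReal.ofReal (2 * r * L) ^ n / (m * (ENNReal.ofReal r ^ n * ω)) :=
            ENNReal.div_le_div (pow_le_pow_left₀ zero_le h1 n) h2
        _ = Q := by
            rw [hQ, ENNReal.ofReal_mul (by positivity), ENNReal.ofReal_mul zero_le_two,
              ENNReal.ofReal_ofNat, mul_pow, mul_pow, div_eq_mul_inv, div_eq_mul_inv,
              div_eq_mul_inv, ENNReal.mul_inv (Or.inl hm0') (Or.inl ENNReal.coe_ne_top),
              ENNReal.mul_inv (Or.inl hr') (Or.inl hrt)]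
            calc _ = (ENNReal.ofReal r ^ n * (ENNReal.ofReal r ^ n)⁻¹)
                  * (2 ^ n * ω⁻¹ * ENNReal.ofReal L ^ n * (m : ℝ≥0∞)⁻¹) := by ring
              _ = _ := by rw [ENNReal.mul_inv_cancel hr' hrt, one_mul]
    · rintro (h | h)
      · rw [h, nonpos_iff_eq_zero] at h2
        exact mul_ne_zero hm0' (mul_ne_zero hr' hω0) h2
      · rw [h, top_le_iff] at h1
        exact ENNReal.ofReal_ne_top h1
  have hfine : fineDistortion (preciseRep f) x ≤ Q ^ (1 / ((n : ℝ) - 1)) :=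
    (iInf_le_of_le U (iInf₂_le hU hxU)).trans (limsup_le_of_le (by isBoundedDefault) hdist)
  have hpow : fineDistortion (preciseRep f) x ^ (n - 1) ≤ Q := by
    refine (pow_le_pow_left₀ zero_le hfine _).trans (le_of_eq ?_)
    rw [← ENNReal.rpow_natCast, ← ENNReal.rpow_mul, Nat.cast_sub (by omega), Nat.cast_one,
      one_div, inv_mul_cancel₀ hn1.ne', ENNReal.rpow_one]
  exact (mul_le_mul' hpow le_rfl).trans (ENNReal.div_mul_cancel hm0' ENNReal.coe_ne_top).le

/-- The distortion estimate at almost every point, for a Borel representative of the map. -/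
theorem ae_fineDistortion_pow_mul_le (hn : 2 ≤ n) (hfm : Measurable f)
    (hf : LocallyIntegrable f volume) (hG : IsWeakGradient f G) :
    ∀ᵐ x, fineDistortion (preciseRep f) x ^ (n - 1) * ENNReal.ofReal |(G x).det|
      ≤ 2 ^ n / volume (Metric.ball (0 : Rn n) 1)
        * ENNReal.ofReal (matrixMaxNorm (G x)) ^ n := by
  filter_upwards [ae_isGoodPoint hf hG, ae_le_extVolume_image_ball hf hG] with x hx hvol
  refine ENNReal.mul_le_of_forall_lt fun a ha m hm => ?_
  -- the case `m = 0` is trivial; it covers `det G x = 0`, where the distortion may be infinite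
  lift m to NNReal using (hm.trans ENNReal.ofReal_lt_top).ne
  by_cases hm0 : m = 0
  · simp [hm0]
  refine (mul_le_mul' ha.le le_rfl).trans ?_
  have hlim : Tendsto (fun ε : ℝ => 2 ^ n / volume (Metric.ball (0 : Rn n) 1)
      * ENNReal.ofReal (matrixMaxNorm (G x) + n * ε) ^ n) (𝓝[>] 0)
      (𝓝 (2 ^ n / volume (Metric.ball (0 : Rn n) 1)
        * ENNReal.ofReal (matrixMaxNorm (G x)) ^ n)) := by
    refine ENNReal.Tendsto.const_mul ?_ (Or.inr (ENNReal.div_ne_top (by finiteness)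
      (Metric.measure_ball_pos volume _ one_pos).ne'))
    have hc : Continuous fun ε : ℝ => ENNReal.ofReal (matrixMaxNorm (G x) + n * ε) ^ n :=
      (ENNReal.continuous_pow n).comp (ENNReal.continuous_ofReal.comp (by fun_prop))
    have := hc.tendsto 0
    rw [mul_zero, add_zero] at this
    exact this.mono_left nhdsWithin_le_nhds
  refine ge_of_tendsto hlim ?_
  filter_upwards [self_mem_nhdsWithin] with ε hε
  exact hx.fineDistortion_pow_mul_le hn hfm hf hG hm0 (hvol m hm) hε

lemma preciseRep_congr_ae {g : Rn n → Rn n} (h : f =ᵐ[volume] g) : preciseRep f = preciseRep g := by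
  funext x j
  refine congrArg (fun u : ℝ → EReal => limsup u (𝓝[>] 0)) (funext fun r => ?_)
  congr 1
  rw [setAverage_eq, setAverage_eq]
  congr 1
  refine integral_congr_ae (ae_restrict_of_ae ?_)
  filter_upwards [h] with y hy
  rw [hy]

lemma IsWeakGradient.congr_ae {g : Rn n → Rn n} (hG : IsWeakGradient f G) (h : f =ᵐ[volume] g) :
    IsWeakGradient g G := by
  refine fun j k => ⟨(hG j k).1, fun φ hφ hφc => ?_⟩
  rw [← (hG j k).2 φ hφ hφc]
  refine integral_congr_ae ?_
  filter_upwards [h] with y hy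
  rw [hy]

end

end FineQC

theorem theorem1p1 (n : ℕ) (hn : 2 ≤ n) (f : FineQC.Rn n → FineQC.Rn n)
    (hf : FineQC.MemW11Loc f) :
    ∀ G : FineQC.Rn n → Matrix (Fin n) (Fin n) ℝ, FineQC.IsWeakGradient f G →
      ∀ᵐ x ∂(volume : Measure (FineQC.Rn n)),
        FineQC.fineDistortion (FineQC.preciseRep f) x ^ (n - 1) * ENNReal.ofReal |(G x).det| ≤
          2 ^ n / volume (Metric.ball (0 : FineQC.Rn n) 1) *
            ENNReal.ofReal (FineQC.matrixMaxNorm (G x)) ^ n := by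
  intro G hG
  have hm := hf.1.aestronglyMeasurable
  rw [FineQC.preciseRep_congr_ae hm.ae_eq_mk]
  exact FineQC.ae_fineDistortion_pow_mul_le hn hm.stronglyMeasurable_mk.measurable
    (hf.1.congr hm.ae_eq_mk) (hG.congr_ae hm.ae_eq_mk)
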